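/- A parallel (resp. series) extension of a matroid $M$ is a matroid $M'$ having an element $e$ that lies in a circuit (resp. cocircuit) of size $2$ of $M'$ and such that $M'\setminus e=M$ (resp. $M'/e=M$). A matroid is series-parallel if it is obtained from a single loop or a single coloop by a finite (possibly empty) sequence of series and parallel extensions, and quasi series-parallel if all of its connected components are series-parallel. A triangular cactus is a connected graph in which every edge is contained in a unique cycle, and that cycle is a triangle. The Kazhdan--Lusztig polynomials $P_M(t)\in\mathbb{Z}[t]$ of finite loopless matroids $M$ are the unique polynomials such that: $P_M(t)=1$ if $\operatorname{rk} M=0$; $\deg P_M<\frac12\operatorname{rk} M$ if $\operatorname{rk} M>0$; and for every $M$ the polynomial $Z_M(t)=\sum_F t^{\operatorname{rk} F}P_{M/F}(t)$, the sum over all flats $F$ of $M$, is palindromic of degree $\operatorname{rk} M$ (that is, $\deg Z_M=\operatorname{rk} M$ and $Z_M(t)=t^{\operatorname{rk} M}Z_M(t^{-1})$). Let $K_n$ denote the cycle matroid of the complete graph on $n$ vertices. Corollary. Let $k\ge 1$. Then the number of simple quasi series-parallel matroids of rank $k$ on the ground set $[2k-1]=\{1,\dots,2k-1\}$ is $$(2k-3)!!\,(2k-1)^{k-2},$$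 where for $k=1$ we put $(-1)!!=1$. Moreover, $P_{K_{2k}}(t)$ has degree $k-1$, and its leading coefficient is equal to this number, and also (as conjectured by Elias, Proudfoot and Wakefield) to the number of triangular cacti with vertex set $[2k-1]$. -/

import Mathlib

open scoped Matroid

/-! ### Cycle matroids of simple graphs and the braid matroids -/

/-- The cycle (graphic) matroid of a finite simple graph `G`: the ground set is the edge set of `G`,
and a set of edges is independent when it forms a forest. -/
def SimpleGraph.cycleMatroid {V : Type*} [Finite V] (G : SimpleGraph V) : Matroid (Sym2 V) :=
  (IndepMatroid.ofFinite (E := G.edgeSet) (Set.toFinite _)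
    (Indep := fun I => I ⊆ G.edgeSet ∧ (SimpleGraph.fromEdgeSet I).IsAcyclic)
    (indep_empty := ⟨Set.empty_subset _, by simp⟩)
    (indep_subset := fun _ _ hJ hIJ =>
      ⟨hIJ.trans hJ.1, hJ.2.anti (SimpleGraph.fromEdgeSet_mono hIJ)⟩)
    (indep_aug := by
      classical
      intro I J hI hJ hlt
      by_contra hcon
      push Not at hcon
      have hreach : ∀ u v, s(u, v) ∈ J → (SimpleGraph.fromEdgeSet I).Reachable u v := by
        intro u v huv
        have hne : u ≠ v := (G.mem_edgeSet.1 (hJ.1 huv)).ne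
        by_cases hmem : s(u, v) ∈ I
        · exact SimpleGraph.Adj.reachable (by simp [hmem, hne])
        · by_contra hnr
          refine hcon _ huv hmem (Set.insert_subset (hJ.1 huv) hI.1) ?_
          have h := (SimpleGraph.isAcyclic_add_edge_iff_of_not_reachable u v hnr).2 hI.2
          rwa [SimpleGraph.edge, ← SimpleGraph.fromEdgeSet_union, Set.union_singleton] at h
      have hnondiag : ∀ K ⊆ G.edgeSet, (SimpleGraph.fromEdgeSet K).edgeSet = K := by
        intro K hK
        rw [SimpleGraph.edgeSet_fromEdgeSet]
        ext e
        simp only [Set.mem_sdiff, and_iff_left_iff_imp]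
        exact fun he => G.not_isDiag_of_mem_edgeSet (hK he)
      rcases isEmpty_or_nonempty V with hV | hV
      · have : J = ∅ := by
          ext e
          induction e with
          | _ x y => exact hV.elim x
        simp [this] at hlt
      obtain ⟨T, hJT, -, hT⟩ := SimpleGraph.Connected.exists_isTree_le_of_le_of_isAcyclic
        (G := (⊤ : SimpleGraph V)) SimpleGraph.connected_top le_top hJ.2
      have hJT' : J ⊆ T.edgeSet := by
        rw [← hnondiag J hJ.1]
        exact SimpleGraph.edgeSet_mono hJT
      set X : Set (Sym2 V) := T.edgeSet \ J with hX
      have hconn : (SimpleGraph.fromEdgeSet (I ∪ X)).Connected := by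
        refine { preconnected := fun u v => ?_, nonempty := hV }
        obtain ⟨w⟩ := hT.connected.preconnected u v
        induction w with
        | nil => exact SimpleGraph.Reachable.refl _
        | @cons a b c hab _ ih =>
          refine SimpleGraph.Reachable.trans ?_ ih
          by_cases hj : s(a, b) ∈ J
          · exact (hreach a b hj).mono (SimpleGraph.fromEdgeSet_mono Set.subset_union_left)
          · refine SimpleGraph.Adj.reachable ?_
            rw [SimpleGraph.fromEdgeSet_adj]
            exact ⟨Or.inr ⟨hab, hj⟩, hab.ne⟩
      have h1 := hconn.card_vert_le_card_edgeSet_add_one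
      have h2 := (SimpleGraph.isTree_iff_connected_and_card.1 hT).2
      have h3 : (SimpleGraph.fromEdgeSet (I ∪ X)).edgeSet.ncard ≤ I.ncard + X.ncard := by
        refine (Set.ncard_le_ncard ?_ (Set.toFinite _)).trans (Set.ncard_union_le _ _)
        rw [SimpleGraph.edgeSet_fromEdgeSet]
        exact Set.sdiff_subset
      have h4 : X.ncard + J.ncard = T.edgeSet.ncard :=
        Set.ncard_sdiff_add_ncard_of_subset hJT' (Set.toFinite _)
      rw [Nat.card_coe_set_eq] at h1 h2
      omega)
    (subset_ground := fun _ hI => hI.1)).matroid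

theorem SimpleGraph.cycleMatroid_ground {V : Type*} [Finite V] (G : SimpleGraph V) :
    G.cycleMatroid.E = G.edgeSet := rfl

theorem SimpleGraph.cycleMatroid_indep_iff {V : Type*} [Finite V] (G : SimpleGraph V)
    (I : Set (Sym2 V)) : G.cycleMatroid.Indep I ↔
      I ⊆ G.edgeSet ∧ (SimpleGraph.fromEdgeSet I).IsAcyclic := by
  simp [SimpleGraph.cycleMatroid, IndepMatroid.ofFinite, IndepMatroid.ofBddAugment,
    IndepMatroid.ofBdd]

/-- The braid matroid `K_n`: the cycle matroid of the complete graph on `n` vertices. -/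
def braidMatroid (n : ℕ) : Matroid (Sym2 (Fin n)) :=
  (⊤ : SimpleGraph (Fin n)).cycleMatroid

namespace Matroid

variable {α : Type*}

/-! ### Simple and quasi series-parallel matroids -/

/-- A matroid is simple if it is loopless and has no circuit of size `2`. -/
def IsSimpleMatroid (M : Matroid α) : Prop :=
  M.Loopless ∧ ∀ C, M.IsCircuit C → C.encard ≠ 2

/-- `M'` is a parallel extension of `M`: deleting from `M'` an element `e` that lies in a
circuit of size `2` gives `M`. -/
def IsParallelExtension (M M' : Matroid α) : Prop :=
  ∃ e C, M'.IsCircuit C ∧ C.encard = 2 ∧ e ∈ C ∧ M' ＼ {e} = M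

/-- `M'` is a series extension of `M`: contracting in `M'` an element `e` that lies in a
cocircuit of size `2` gives `M`. -/
def IsSeriesExtension (M M' : Matroid α) : Prop :=
  ∃ e C, M'.IsCocircuit C ∧ C.encard = 2 ∧ e ∈ C ∧ M' ／ {e} = M

/-- Series-parallel matroids: those obtained from a single loop or a single coloop by a finite
sequence of series and parallel extensions. -/
inductive IsSeriesParallel : Matroid α → Prop
  | loop (e : α) : IsSeriesParallel (loopyOn {e})
  | coloop (e : α) : IsSeriesParallel (freeOn {e})
  | parallel {M M' : Matroid α} :
      IsSeriesParallel M → IsParallelExtension M M' → IsSeriesParallel M'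
  | series {M M' : Matroid α} :
      IsSeriesParallel M → IsSeriesExtension M M' → IsSeriesParallel M'

/-- The connected component of an element `e`: all elements that are equal to `e` or lie on a
common circuit with `e`. -/
def connectedComponent (M : Matroid α) (e : α) : Set α :=
  {f | f ∈ M.E ∧ (f = e ∨ ∃ C, M.IsCircuit C ∧ e ∈ C ∧ f ∈ C)}

/-- A matroid is quasi series-parallel if all its connected components are series-parallel. -/
def IsQuasiSeriesParallel (M : Matroid α) : Prop :=
  ∀ e ∈ M.E, (M ↾ M.connectedComponent e).IsSeriesParallel

/-- The set of simple quasi series-parallel matroids of rank `k` on the ground set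
`[n] = Fin n`. -/
def simpleQuasiSeriesParallel (n k : ℕ) : Set (Matroid (Fin n)) :=
  {M | M.E = Set.univ ∧ M.IsSimpleMatroid ∧ M.IsQuasiSeriesParallel ∧ M.eRank = k}

/-! ### The Kazhdan–Lusztig polynomial of a matroid -/

/-- The rank of a matroid of finite rank, as a natural number. -/
noncomputable def natRank (M : Matroid α) : ℕ := M.eRank.toNat

/-- `Z_M(t) = ∑_F t ^ rk F * P_{M/F}(t)`, the sum over all flats `F` of `M`. -/
noncomputable def zSum (P : Matroid α → Polynomial ℤ) (M : Matroid α) : Polynomial ℤ :=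
  ∑ᶠ (F : Set α) (_ : M.IsFlat F), Polynomial.X ^ (M ↾ F).natRank * P (M ／ F)

/-- The defining properties of the Kazhdan–Lusztig polynomials of finite loopless matroids.
A polynomial `f` of degree `d` is palindromic when `f.reverse = f`, where
`f.reverse = t ^ d * f (t⁻¹)`. -/
structure IsKazhdanLusztigFamily (P : Matroid α → Polynomial ℤ) : Prop where
  rank_zero : ∀ M : Matroid α, M.Finite → M.Loopless → M.natRank = 0 → P M = 1
  degree_lt : ∀ M : Matroid α, M.Finite → M.Loopless → 0 < M.natRank →
    2 * (P M).natDegree < M.natRank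
  palindromic : ∀ M : Matroid α, M.Finite → M.Loopless →
    (zSum P M).natDegree = M.natRank ∧ (zSum P M).reverse = zSum P M

/-- The Kazhdan–Lusztig polynomial `P_M(t)` of a matroid (meaningful for finite loopless `M`),
computed recursively. If `Q` is the part of `Z_M(t)` coming from the nonempty flats (for loopless
`M`, those whose contraction lowers the rank), then `P_M + Q` is palindromic of degree `r = rk M`
with `deg P_M < r / 2` exactly when `[t^i] P_M = [t^(r-i)] Q - [t^i] Q` for `i < r / 2`.
The theorems `klPolynomial_isKazhdanLusztigFamily` and `IsKazhdanLusztigFamily.eq_klPolynomial`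
show that this is the unique family with the defining properties. -/
noncomputable def klPolynomial (M : Matroid α) : Polynomial ℤ :=
  if M.natRank = 0 then 1 else
    let Q : Polynomial ℤ :=
      ∑ᶠ (F : Set α) (_h : M.IsFlat F ∧ (M ／ F).natRank < M.natRank),
        Polynomial.X ^ (M ↾ F).natRank * klPolynomial (M ／ F)
    ∑ i ∈ Finset.range ((M.natRank + 1) / 2),
      Polynomial.C (Q.coeff (M.natRank - i) - Q.coeff i) * Polynomial.X ^ i
termination_by M.natRank
decreasing_by exact _h.2

/-- The part of `zSum` coming from the flats whose contraction lowers the rank. -/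
noncomputable def properSum (P : Matroid α → Polynomial ℤ) (M : Matroid α) : Polynomial ℤ :=
  ∑ᶠ (F : Set α) (_ : M.IsFlat F ∧ (M ／ F).natRank < M.natRank),
    Polynomial.X ^ (M ↾ F).natRank * P (M ／ F)

theorem klPolynomial_of_rank_zero {M : Matroid α} (h : M.natRank = 0) : M.klPolynomial = 1 := by
  rw [klPolynomial, if_pos h]

theorem klPolynomial_of_rank_pos {M : Matroid α} (h : M.natRank ≠ 0) :
    M.klPolynomial = ∑ i ∈ Finset.range ((M.natRank + 1) / 2),
      Polynomial.C ((properSum klPolynomial M).coeff (M.natRank - i) -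
        (properSum klPolynomial M).coeff i) * Polynomial.X ^ i := by
  rw [klPolynomial, if_neg h]
  rfl

theorem coeff_klPolynomial {M : Matroid α} (h : M.natRank ≠ 0) (i : ℕ) :
    M.klPolynomial.coeff i = if 2 * i < M.natRank then
      (properSum klPolynomial M).coeff (M.natRank - i) - (properSum klPolynomial M).coeff i
      else 0 := by
  rw [klPolynomial_of_rank_pos h, Polynomial.finsetSum_coeff]
  simp only [Polynomial.coeff_C_mul, Polynomial.coeff_X_pow, mul_ite, mul_one, mul_zero]
  rw [Finset.sum_ite_eq]
  simp only [Finset.mem_range]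
  congr 1
  apply propext
  omega

theorem two_mul_natDegree_klPolynomial_lt {M : Matroid α} (h : M.natRank ≠ 0) :
    2 * M.klPolynomial.natDegree < M.natRank := by
  by_contra hcon
  have h0 : M.klPolynomial.leadingCoeff = 0 := by
    rw [Polynomial.leadingCoeff, coeff_klPolynomial h, if_neg hcon]
  rw [Polynomial.leadingCoeff_eq_zero] at h0
  simp [h0] at hcon
  omega

theorem natRank_restrict_add_contract {M : Matroid α} (hfin : M.Finite) {F : Set α}
    (hF : M.IsFlat F) : (M ↾ F).natRank + (M ／ F).natRank = M.natRank := by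
  obtain ⟨I, hI⟩ := M.exists_isBasis F hF.subset_ground
  obtain ⟨B, hB, hIB⟩ := hI.indep.exists_isBase_superset
  have hBE : M.IsBasis B M.E := hB.isBasis_ground
  have hBF : B ∩ F = I :=
    (hI.eq_of_subset_indep (hB.indep.inter_right F) (Set.subset_inter hIB hI.subset)
      Set.inter_subset_right).symm
  have hdiff : (M ／ F).IsBase (B \ I) := by
    have h : (M ／ F).IsBasis (B \ I) (M.E \ F) := by
      rw [hI.contract_eq_contract_delete, delete_isBasis_iff]
      exact ⟨hI.contract_sdiff_isBasis_sdiff hBE hIB, Set.disjoint_left.2 fun _ h1 h2 => h1.2 h2.1⟩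
    rwa [← contract_ground, isBasis_ground_iff] at h
  have h1 : (M ↾ F).natRank = I.ncard := by
    rw [natRank, eRank_restrict, ← hI.encard_eq_eRk]; rfl
  have h2 : (M ／ F).natRank = (B \ I).ncard := by
    rw [natRank, ← hdiff.encard_eq_eRank]; rfl
  have h3 : M.natRank = B.ncard := by
    rw [natRank, ← hB.encard_eq_eRank]; rfl
  rw [h1, h2, h3, add_comm]
  exact Set.ncard_sdiff_add_ncard_of_subset hIB (M.ground_finite.subset hB.subset_ground)

theorem finite_contract {M : Matroid α} (hfin : M.Finite) (F : Set α) : (M ／ F).Finite :=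
  ⟨hfin.ground_finite.subset Set.sdiff_subset⟩

theorem loopless_contract {M : Matroid α} {F : Set α} (hF : M.IsFlat F) :
    (M ／ F).Loopless :=
  ⟨by rw [contract_loops_eq, hF.closure, Set.sdiff_self]⟩

theorem natRank_restrict_eq_zero_iff {M : Matroid α} (hfin : M.Finite) (hl : M.Loopless)
    {F : Set α} (hF : M.IsFlat F) : (M ↾ F).natRank = 0 ↔ F = ∅ := by
  have hfinE : M.eRk F ≠ ⊤ :=
    ((M.eRk_le_encard F).trans_lt
      (Set.encard_lt_top_iff.2 (M.ground_finite.subset hF.subset_ground))).ne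
  rw [natRank, eRank_restrict, ENat.toNat_eq_zero, or_iff_left hfinE,
    eRk_eq_zero_iff hF.subset_ground, hl.loops_eq_empty, Set.subset_empty_iff]

theorem eq_ground_of_natRank_contract {M : Matroid α} (hfin : M.Finite)
    {F : Set α} (hF : M.IsFlat F) (h : (M ／ F).natRank = 0) : F = M.E := by
  have hl := loopless_contract hF
  have hfin' := finite_contract hfin F
  have h' := (natRank_restrict_eq_zero_iff hfin' hl (M ／ F).ground_isFlat).1
    (by rwa [restrict_ground_eq_self])
  exact hF.subset_ground.antisymm (Set.sdiff_eq_empty.1 h')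

theorem finite_flats {M : Matroid α} (hfin : M.Finite) : {F | M.IsFlat F}.Finite :=
  M.ground_finite.finite_subsets.subset fun _ hF => hF.subset_ground

theorem isFlat_empty {M : Matroid α} (hl : M.Loopless) : M.IsFlat ∅ := by
  rw [isFlat_iff_closure_eq, closure_empty, hl.loops_eq_empty]

theorem zSum_eq (P : Matroid α → Polynomial ℤ) {M : Matroid α} (hfin : M.Finite)
    (hl : M.Loopless) : zSum P M = P M + properSum P M := by
  have hset : {F | M.IsFlat F} =
      insert ∅ {F | M.IsFlat F ∧ (M ／ F).natRank < M.natRank} := by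
    ext F
    simp only [Set.mem_ofPred, Set.mem_insert_iff]
    constructor
    · intro hF
      by_cases h : F = ∅
      · exact Or.inl h
      · have h1 := natRank_restrict_add_contract hfin hF
        have h2 := mt (natRank_restrict_eq_zero_iff hfin hl hF).1 h
        exact Or.inr ⟨hF, by omega⟩
    · rintro (rfl | h)
      · exact isFlat_empty hl
      · exact h.1
  have hnot : ∅ ∉ {F | M.IsFlat F ∧ (M ／ F).natRank < M.natRank} := by
    simp
  have hz : zSum P M = ∑ᶠ F ∈ {F | M.IsFlat F},
      Polynomial.X ^ (M ↾ F).natRank * P (M ／ F) := rfl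
  have hq : properSum P M = ∑ᶠ F ∈ {F | M.IsFlat F ∧ (M ／ F).natRank < M.natRank},
      Polynomial.X ^ (M ↾ F).natRank * P (M ／ F) := rfl
  rw [hz, hset, finsum_mem_insert _ hnot ((finite_flats hfin).subset fun _ h => h.1), ← hq,
    (natRank_restrict_eq_zero_iff hfin hl (isFlat_empty hl)).2 rfl, contract_empty]
  simp

theorem coeff_properSum (P : Matroid α → Polynomial ℤ)
    {M : Matroid α} (hfin : M.Finite) (j : ℕ) :
    (properSum P M).coeff j = ∑ᶠ F ∈ {F | M.IsFlat F ∧ (M ／ F).natRank < M.natRank},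
      (Polynomial.X ^ (M ↾ F).natRank * P (M ／ F)).coeff j := by
  have hs : {F | M.IsFlat F ∧ (M ／ F).natRank < M.natRank}.Finite :=
    (finite_flats hfin).subset fun _ h => h.1
  have hq : properSum P M = ∑ᶠ F ∈ {F | M.IsFlat F ∧ (M ／ F).natRank < M.natRank},
      Polynomial.X ^ (M ↾ F).natRank * P (M ／ F) := rfl
  rw [hq, finsum_mem_eq_finite_toFinset_sum _ hs, finsum_mem_eq_finite_toFinset_sum _ hs,
    Polynomial.finsetSum_coeff]

theorem coeff_properSum_klPolynomial {M : Matroid α} (hfin : M.Finite)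
    (h : M.natRank ≠ 0) {j : ℕ} (hj : M.natRank ≤ j) :
    (properSum klPolynomial M).coeff j = if j = M.natRank then 1 else 0 := by
  have hs : {F | M.IsFlat F ∧ (M ／ F).natRank < M.natRank}.Finite :=
    (finite_flats hfin).subset fun _ h => h.1
  have hE0 : (M ／ M.E).natRank = 0 := by
    have h1 : (M ／ M.E).E = ∅ := by simp
    have h2 : (M ／ M.E).eRank ≤ 0 := by
      simpa [h1] using (M ／ M.E).eRank_le_encard_ground
    simp [natRank, nonpos_iff_eq_zero.1 h2]
  rw [coeff_properSum _ hfin, finsum_mem_eq_finite_toFinset_sum _ hs,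
    Finset.sum_eq_single M.E]
  · rw [klPolynomial_of_rank_zero hE0, restrict_ground_eq_self, mul_one,
      Polynomial.coeff_X_pow]
  · intro F hF hne
    have hF' : M.IsFlat F ∧ (M ／ F).natRank < M.natRank := by simpa using hF
    have h0 : (M ／ F).natRank ≠ 0 :=
      fun h0 => hne (eq_ground_of_natRank_contract hfin hF'.1 h0)
    have h1 := two_mul_natDegree_klPolynomial_lt h0
    have h2 := natRank_restrict_add_contract hfin hF'.1
    rw [Polynomial.coeff_X_pow_mul', if_pos (by omega)]
    exact Polynomial.coeff_eq_zero_of_natDegree_lt (by omega)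
  · intro hE
    refine absurd ?_ hE
    simp only [Set.Finite.mem_toFinset, Set.mem_ofPred]
    exact ⟨M.ground_isFlat, by omega⟩

theorem klPolynomial_isKazhdanLusztigFamily :
    IsKazhdanLusztigFamily (klPolynomial : Matroid α → Polynomial ℤ) where
  rank_zero _ _ _ h := klPolynomial_of_rank_zero h
  degree_lt _ _ _ h := two_mul_natDegree_klPolynomial_lt h.ne'
  palindromic M hfin hl := by
    by_cases h : M.natRank = 0
    · have hq : properSum klPolynomial M = 0 := by
        simp [properSum, h]
      rw [zSum_eq _ hfin hl, hq, klPolynomial_of_rank_zero h, h]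
      refine ⟨by simp, ?_⟩
      rw [add_zero, ← Polynomial.C_1, Polynomial.reverse_C]
    · have hbig : ∀ j, M.natRank ≤ j →
          (zSum klPolynomial M).coeff j = if j = M.natRank then 1 else 0 := by
        intro j hj
        rw [zSum_eq _ hfin hl, Polynomial.coeff_add, coeff_properSum_klPolynomial hfin h hj,
          coeff_klPolynomial h, if_neg (by omega), zero_add]
      have hsymm : ∀ i, 2 * i < M.natRank →
          (zSum klPolynomial M).coeff (M.natRank - i) = (zSum klPolynomial M).coeff i := by
        intro i hi
        rw [zSum_eq _ hfin hl, Polynomial.coeff_add, Polynomial.coeff_add,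
          coeff_klPolynomial h, coeff_klPolynomial h, if_neg (by omega), if_pos hi]
        ring
      have hdeg : (zSum klPolynomial M).natDegree = M.natRank := by
        refine Polynomial.natDegree_eq_of_le_of_coeff_ne_zero ?_ ?_
        · rw [Polynomial.natDegree_le_iff_coeff_eq_zero]
          intro j hj
          rw [hbig j (by omega), if_neg (by omega)]
        · rw [hbig _ le_rfl, if_pos rfl]
          exact one_ne_zero
      refine ⟨hdeg, ?_⟩
      ext i
      rw [Polynomial.coeff_reverse, hdeg]
      by_cases hi : i ≤ M.natRank
      · rw [Polynomial.revAt_le hi]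
        rcases lt_trichotomy (2 * i) M.natRank with h1 | h1 | h1
        · exact hsymm i h1
        · congr 1
          omega
        · have h2 := hsymm (M.natRank - i) (by omega)
          rw [← h2]
          congr 1
          omega
      · rw [Polynomial.revAt_eq_self_of_lt (by omega)]

theorem IsKazhdanLusztigFamily.coeff_eq {P : Matroid α → Polynomial ℤ}
    (hP : IsKazhdanLusztigFamily P) {M : Matroid α} (hfin : M.Finite) (hl : M.Loopless)
    (h : M.natRank ≠ 0) (i : ℕ) :
    (P M).coeff i = if 2 * i < M.natRank then
      (properSum P M).coeff (M.natRank - i) - (properSum P M).coeff i else 0 := by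
  have hd := hP.degree_lt M hfin hl (Nat.pos_of_ne_zero h)
  split_ifs with hi
  · obtain ⟨h1, h2⟩ := hP.palindromic M hfin hl
    have h3 := congrArg (fun f => Polynomial.coeff f i) h2
    simp only [Polynomial.coeff_reverse, h1] at h3
    rw [Polynomial.revAt_le (by omega), zSum_eq _ hfin hl, Polynomial.coeff_add,
      Polynomial.coeff_add,
      Polynomial.coeff_eq_zero_of_natDegree_lt (p := P M) (n := M.natRank - i) (by omega)] at h3
    linarith
  · exact Polynomial.coeff_eq_zero_of_natDegree_lt (by omega)

theorem IsKazhdanLusztigFamily.eq_klPolynomial {P : Matroid α → Polynomial ℤ}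
    (hP : IsKazhdanLusztigFamily P) (M : Matroid α) (hfin : M.Finite) (hl : M.Loopless) :
    P M = M.klPolynomial := by
  induction hn : M.natRank using Nat.strong_induction_on generalizing M with
  | _ n ih =>
    by_cases h : M.natRank = 0
    · rw [hP.rank_zero M hfin hl h, klPolynomial_of_rank_zero h]
    · have hq : properSum P M = properSum klPolynomial M := by
        refine finsum_congr fun F => finsum_congr fun hF => ?_
        rw [ih _ (hn ▸ hF.2) (M ／ F) (finite_contract hfin F) (loopless_contract hF.1) rfl]
      ext i
      rw [hP.coeff_eq hfin hl h, coeff_klPolynomial h, hq]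

end Matroid

/-! ### Triangular cacti -/

/-- `C` is the edge set of a cycle of `G`. -/
def SimpleGraph.IsCycleEdgeSet {V : Type*} (G : SimpleGraph V) (C : Set (Sym2 V)) : Prop :=
  ∃ (v : V) (w : G.Walk v v), w.IsCycle ∧ w.edgeSet = C

/-- A triangular cactus: a connected graph in which every edge is contained in a unique cycle,
and that cycle is a triangle. -/
def SimpleGraph.IsTriangularCactus {V : Type*} (G : SimpleGraph V) : Prop :=
  G.Connected ∧ ∀ e ∈ G.edgeSet, ∃ C : Set (Sym2 V),
    (G.IsCycleEdgeSet C ∧ e ∈ C) ∧ C.ncard = 3 ∧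
      ∀ C' : Set (Sym2 V), G.IsCycleEdgeSet C' → e ∈ C' → C' = C

/-! ### Series-parallel reductions and pullbacks along maps. -/

namespace Matroid

variable {α β : Type*} {M N : Matroid α} {e f g x y : α}

/-! Write s(n, r) for the number of simple quasi series-parallel matroids of rank r on [n], and q(n,
r) for the number of all quasi series-parallel ones. The proof shows that s(n, n - i) is the
coefficient of t^i in the Kazhdan–Lusztig polynomial of K_{n+1}, and then counts s(2k - 1, k).

Quasi series-parallel matroids are handled as `SPReducible` ones (`isQuasiSeriesParallel_iff`), a
class visibly closed under duality. In its constructors the set `X` is empty or a singleton, so one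
constructor covers loops and parallel elements, and the other covers coloops and series elements.

Coefficients: flats of K_{n+1} are partitions π of n + 1 points, and contracting the flat of π gives
the partition lattice on the |π| blocks. By induction, the part of Z coming from nonempty flats has
t^j-coefficient equal to the sum of s(|π| - 1, n - j) over π ≠ ⊥. A matroid on [n] amounts to a
partition of {0} ∪ [n], with the loops in the block of 0 and the parallel classes as the other
blocks, together with a simple matroid on those other blocks. Hence the sum over all π is q(n, n -
j) (`sum_ncard_simpleQuasiSeriesParallel`). Since q(n, r) = q(n, n - r) by duality, the recursion
leaves s(n, n - i) - s(n, i) for 2i < n. The second term vanishes for n > 0, because a nonempty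
simple reducible matroid of rank r has at most 2r - 1 elements (`SPReducible.ncard_add_one_le`):
contracting a series element lowers the rank by one and costs at most two elements.

Extremal case: with exactly 2k - 1 elements every such step must cost two elements, which forces a
triangle attached to the rest along one element. So the triangles form a tree of triples, which
determines the matroid, and every such tree occurs (`SPReducible.hyperTree_triangles`,
`eq_of_hyperTree`, `exists_of_hyperTree`). The same trees are the sets of triangles of triangular
cacti (`ncard_isTriangularCactus`).

Counting trees on 2t + 1 vertices: once a root is fixed, a tree is a pairing of the other 2t
vertices, in (2t - 1)!! ways, together with a parent vertex for each pair such that all pairs lead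
to the root. A Cayley-type count (`card_blockReach_mul_card`) gives (2t + 1)^(t - 1) choices of
parents. -/

/-- Matroids that can be reduced to the empty matroid by deleting loops and elements of parallel
pairs and contracting coloops and elements of series pairs. -/
inductive SPReducible : Matroid α → Prop
  | empty : SPReducible (emptyOn α)
  | ext {M : Matroid α} {e : α} {X : Set α} : X.Subsingleton → e ∉ X → e ∈ M.closure X →
      SPReducible (M ＼ {e}) → SPReducible M
  | coext {M : Matroid α} {e : α} {X : Set α} : X.Subsingleton → e ∉ X → e ∈ M✶.closure X →
      SPReducible (M ／ {e}) → SPReducible M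

theorem SPReducible.dual (h : M.SPReducible) : M✶.SPReducible := by
  induction h with
  | empty => simpa using SPReducible.empty
  | ext hX he hc _ ih => exact .coext hX he (by simpa using hc) (by simpa using ih)
  | coext hX he hc _ ih => exact .ext hX he hc (by simpa using ih)

/-- A point sent outside the ground set becomes a loop, and points with equal image become parallel.
Thus `comapOn` deletes, relabels, and adds loops and parallel elements in a single operation. -/
theorem mem_closure_comapOn {M : Matroid β} {E X : Set α} {f : α → β} :
    e ∈ (M.comapOn E f).closure X ↔ e ∈ E ∧ (f e ∈ M.closure (f '' (X ∩ E)) ∨ f e ∉ M.E) := by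
  rw [comapOn, restrict_closure_eq', comap_closure_eq]
  simp
  tauto

theorem comapOn_delete {M : Matroid β} {E : Set α} {f : α → β} :
    (M.comapOn E f) ＼ {e} = M.comapOn (E \ {e}) f := by
  refine ext_indep rfl fun I hI => ?_
  simp only [deleteElem_indep_iff, comapOn_indep_iff, Set.subset_sdiff, Set.disjoint_singleton_right]
  tauto

/-- `e` is a loop of `M✶ ／ X` exactly when it is a coloop of the dual matroid `M ＼ X`. -/
theorem dual_mem_closure_iff {X : Set α} (he : e ∈ M.E) (heX : e ∉ X) :
    e ∈ M✶.closure X ↔ e ∉ M.closure (M.E \ insert e X) := by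
  have h : (M✶ ／ X).IsLoop e ↔ (M ＼ X).IsColoop e := by
    rw [← dual_delete, dual_isLoop_iff_isColoop]
  rw [contract_isLoop_iff_mem_closure, isColoop_iff_notMem_closure_compl (by simp [he, heX]),
    delete_closure_eq, and_iff_left heX] at h
  rw [h]
  have : ((M.E \ X) \ {e}) \ X = M.E \ insert e X := by
    ext; simp; tauto
  simp only [delete_ground, this, Set.mem_sdiff, heX, not_false_eq_true, and_true]

/-- An element can be recovered from one with the same span by pulling back along the map that
identifies the two. This lets a reduction by `x` be absorbed into the map of a pullback. -/
theorem eq_comap_of_closure_eq (hx : x ∈ M.E) (hy : y ∈ M.E) (hxy : x ≠ y)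
    (hcl : M.closure {x} = M.closure {y}) [DecidableEq α] :
    M = (M ＼ {x}).comap (Function.update id x y) := by
  have himg : ∀ J : Set α, x ∉ J → Function.update id x y '' J = J := by
    intro J hJ
    have : Set.EqOn (Function.update id x y) id J := fun z hz => by
      exact Function.update_of_ne (by rintro rfl; exact hJ hz) _ _
    rw [this.image_eq, Set.image_id]
  have hinj : ∀ J : Set α, x ∉ J → Set.InjOn (Function.update id x y) J := by
    intro J hJ a ha b hb hab
    rwa [Function.update_of_ne (by rintro rfl; exact hJ ha),
      Function.update_of_ne (by rintro rfl; exact hJ hb)] at hab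
  refine ext_indep ?_ fun I hI => ?_
  · ext z
    by_cases hz : z = x
    · simp [hz, hx, hy, hxy.symm]
    · simp [hz]
  rw [comap_indep_iff, deleteElem_indep_iff]
  by_cases hxI : x ∈ I
  · obtain ⟨J, hxJ, rfl⟩ : ∃ J, x ∉ J ∧ I = insert x J := ⟨I \ {x}, by simp, by simp [hxI]⟩
    rw [Set.image_insert_eq, himg J hxJ, Function.update_self, Set.injOn_insert hxJ,
      himg J hxJ, Function.update_self]
    by_cases hyJ : y ∈ J
    · simp only [hyJ, hinj J hxJ, not_true, and_false, iff_false]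
      intro h
      refine h.notMem_closure_sdiff_of_mem (Set.mem_insert x J) ?_
      refine M.closure_subset_closure (X := {y}) ?_ (hcl ▸ M.mem_closure_self x)
      simp [hyJ, hxy.symm]
    · have h1 : x ∉ insert y J := by simp [hxy, hxJ]
      simp only [hyJ, hinj J hxJ, h1, not_false_eq_true, and_true]
      have key : M.closure (insert x J) = M.closure (insert y J) := by
        rw [Set.insert_eq, Set.insert_eq, ← closure_union_closure_left_eq, hcl,
          closure_union_closure_left_eq]
      have key2 : x ∈ M.closure J ↔ y ∈ M.closure J := by
        rw [← Set.singleton_subset_iff, ← closure_subset_closure_iff_subset_closure, hcl,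
          closure_subset_closure_iff_subset_closure, Set.singleton_subset_iff]
      by_cases hJ : M.Indep J
      · rw [hJ.insert_indep_iff_of_notMem hxJ, hJ.insert_indep_iff_of_notMem hyJ]
        simp [hx, hy, key2]
      · exact iff_of_false (fun h => hJ (h.subset (Set.subset_insert _ _)))
          (fun h => hJ (h.subset (Set.subset_insert _ _)))
  · simp [himg I hxI, hxI, hinj I hxI]

theorem comapOn_contract {M : Matroid β} {E : Set α} {f : α → β} (hf : Set.InjOn f E)
    (he : e ∈ E) (hne : M.IsNonloop (f e)) :
    (M.comapOn E f) ／ {e} = (M ／ {f e}).comapOn (E \ {e}) f := by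
  have hne' : (M.comapOn E f).IsNonloop e := by
    rw [← indep_singleton, comapOn_indep_iff]
    simp [hne, he]
  refine ext_indep rfl fun I hI => ?_
  have hI' : I ⊆ E \ {e} := hI
  rw [hne'.contractElem_indep_iff, comapOn_indep_iff, comapOn_indep_iff,
    hne.contractElem_indep_iff, Set.image_insert_eq]
  have h1 : e ∉ I := fun h => (hI' h).2 rfl
  have h2 : I ⊆ E := hI'.trans Set.sdiff_subset
  have h3 : f e ∉ f '' I := fun ⟨a, ha, hae⟩ => h1 (hf (h2 ha) he hae ▸ ha)
  have h4 : Set.InjOn f (insert e I) := hf.mono (Set.insert_subset he h2)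
  simp [h1, h3, h4, hf.mono h2, hI', Set.insert_subset he h2]

/-- Adding `x` to an independent subset of `f '' E` keeps it independent, so deleting and
contracting `x` look the same from the image. -/
theorem comapOn_eq_of_coloop {M : Matroid β} {E : Set α} {f : α → β} {x : β}
    (hx : x ∈ M.E) (h : x ∉ M.closure (f '' E)) :
    M.comapOn E f = (M ／ {x}).comapOn E f := by
  have hx' : M.IsNonloop x := isNonloop_of_notMem_closure h
  refine ext_indep rfl fun I hI => ?_
  have hI' : f '' I ⊆ f '' E := Set.image_mono hI
  rw [comapOn_indep_iff, comapOn_indep_iff, hx'.contractElem_indep_iff]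
  have hcl : x ∉ M.closure (f '' I) := fun hc => h (M.closure_subset_closure hI' hc)
  have hxI : x ∉ f '' I := by
    intro hc
    by_cases hi : M.Indep (f '' I)
    · exact hcl (M.mem_closure_of_mem hc hi.subset_ground)
    · exact h (M.mem_closure_of_mem' (hI' hc) hx)
  refine and_congr_left fun _ => ⟨fun h1 => ⟨hxI, ?_⟩, fun h1 => h1.2.subset (Set.subset_insert _ _)⟩
  rw [h1.insert_indep_iff_of_notMem hxI]
  exact ⟨hx, hcl⟩

theorem comapOn_eq_delete_of_loop {M : Matroid β} {E : Set α} {f : α → β} {x : β}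
    (hx : M.IsLoop x) : M.comapOn E f = (M ＼ {x}).comapOn E f := by
  refine ext_indep rfl fun I hI => ?_
  rw [comapOn_indep_iff, comapOn_indep_iff, deleteElem_indep_iff]
  have : M.Indep (f '' I) → x ∉ f '' I := fun h => hx.notMem_of_indep h
  tauto

theorem comapOn_comap {γ : Type*} (M : Matroid γ) (E : Set α) (f : α → β) (g : β → γ)
    : (M.comap g).comapOn E f = M.comapOn E (g ∘ f) := by
  refine ext_indep rfl fun I hI => ?_
  simp only [comapOn_indep_iff, comap_indep_iff, Set.image_comp]
  constructor
  · rintro ⟨⟨h1, h2⟩, h3, h4⟩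
    exact ⟨h1, h2.comp h3 (Set.mapsTo_image f I), h4⟩
  · rintro ⟨h1, h2, h3⟩
    refine ⟨⟨h1, ?_⟩, ?_, h3⟩
    · rintro _ ⟨a, ha, rfl⟩ _ ⟨b, hb, rfl⟩ hab
      rw [h2 ha hb hab]
    · intro a ha b hb hab
      exact h2 ha hb (congrArg g hab)

/-- Reducibility passes to deletions, isomorphic copies, and extensions by loops and parallel
elements. -/
theorem SPReducible.comapOn [Finite α] {M : Matroid β} (h : M.SPReducible) (E : Set α)
    (f : α → β) : (M.comapOn E f).SPReducible := by
  classical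
  induction h generalizing E f with
  | empty =>
    induction hn : E.ncard using Nat.strong_induction_on generalizing E with
    | _ n ih =>
      rcases E.eq_empty_or_nonempty with rfl | ⟨e, he⟩
      · have : (emptyOn β).comapOn ∅ f = emptyOn α := by
          rw [← ground_eq_empty_iff, comapOn_ground_eq]
        rw [this]; exact .empty
      · refine .ext (e := e) (X := ∅) Set.subsingleton_empty (by simp) ?_ ?_
        · rw [mem_closure_comapOn]; simp [he]
        · rw [comapOn_delete]
          exact ih _ (hn ▸ Set.ncard_sdiff_singleton_lt_of_mem he) _ rfl
  | @ext M x X hX hxX hcl hM ih =>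
    by_cases hl : M.IsLoop x
    · rw [comapOn_eq_delete_of_loop hl]
      exact ih E f
    · have hxE : x ∈ M.E := M.closure_subset_ground _ hcl
      rcases hX.eq_empty_or_singleton with rfl | ⟨y, rfl⟩
      · exact absurd hcl hl
      have hnl : M.IsNonloop x := ⟨hl, hxE⟩
      have hyE : y ∈ M.E := (hnl.isNonloop_of_mem_closure hcl).mem_ground
      rw [eq_comap_of_closure_eq hxE hyE (by simpa using hxX) (hnl.closure_eq_of_mem_closure hcl),
        comapOn_comap]
      exact ih _ _
  | @coext M x X hX hxX hcl hM ih =>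
    have hxE : x ∈ M.E := M✶.closure_subset_ground _ hcl
    -- The pullback may acquire loops, parallel pairs or coloops before its own series reduction is
    -- available; the inner induction removes such elements one at a time.
    induction hn : E.ncard using Nat.strong_induction_on generalizing E with
    | _ n ihE =>
      have hdel : ∀ e ∈ E, ((M.comapOn E f) ＼ {e}).SPReducible := by
        intro e he
        rw [comapOn_delete]
        exact ihE _ (hn ▸ Set.ncard_sdiff_singleton_lt_of_mem he) _ rfl
      by_cases hE : f '' E ⊆ M.E
      swap
      · obtain ⟨_, ⟨e, he, rfl⟩, hne⟩ := Set.not_subset.1 hE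
        refine .ext (e := e) (X := ∅) Set.subsingleton_empty (by simp) ?_ (hdel e he)
        rw [mem_closure_comapOn]; simp [he, hne]
      by_cases hf : Set.InjOn f E
      swap
      · simp only [Set.InjOn, not_forall] at hf
        obtain ⟨a, ha, b, hb, hab, hne⟩ := hf
        refine .ext (e := a) (X := {b}) Set.subsingleton_singleton (by simpa using hne) ?_
          (hdel a ha)
        rw [mem_closure_comapOn, Set.singleton_inter_of_mem hb, hab, Set.image_singleton]
        exact ⟨ha, Or.inl (M.mem_closure_self _ (hE ⟨b, hb, rfl⟩))⟩
      -- When `x` is a coloop, `X` may be taken empty; a nonempty `X` then comes from a genuine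
      -- series pair.
      wlog hX' : M✶.IsLoop x → X = ∅ generalizing X
      · rw [Classical.not_imp] at hX'
        exact this Set.subsingleton_empty (by simp) hX'.1 (fun _ => rfl)
      have hcl' := (dual_mem_closure_iff hxE hxX).1 hcl
      by_cases hxf : x ∈ f '' E
      · obtain ⟨e, he, rfl⟩ := hxf
        refine .coext (e := e) (X := f ⁻¹' X ∩ E) ?_ (by simp [hxX]) ?_ ?_
        · intro a ha b hb
          exact hf ha.2 hb.2 (hX ha.1 hb.1)
        · rw [dual_mem_closure_iff (by exact he) (by simp [hxX]), mem_closure_comapOn]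
          rintro ⟨-, h | h⟩
          · refine hcl' (M.closure_subset_closure ?_ h)
            rintro _ ⟨a, ha, rfl⟩
            simp only [comapOn_ground_eq, Set.mem_inter_iff, Set.mem_sdiff, Set.mem_insert_iff,
              Set.mem_preimage, not_or, not_and] at ha
            refine ⟨hE ⟨a, ha.2, rfl⟩, ?_⟩
            simp only [Set.mem_insert_iff, not_or]
            exact ⟨fun h => ha.1.2.1 (hf ha.2 he h), fun h => ha.1.2.2 h ha.2⟩
          · exact h hxE
        · rw [comapOn_contract hf he (isNonloop_of_notMem_closure hcl')]
          exact ih _ _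
      -- If the image misses both `x` and `X`, it does not span `x`, so contracting `x` does not
      -- change the pullback. If it misses only `x`, the series partner of `x` becomes a coloop of
      -- the pullback and is removed.
      · by_cases hXf : Disjoint X (f '' E)
        · rw [comapOn_eq_of_coloop hxE]
          · exact ih _ _
          · refine fun h => hcl' (M.closure_subset_closure ?_ h)
            intro z hz
            refine ⟨hE hz, ?_⟩
            simp only [Set.mem_insert_iff, not_or]
            exact ⟨fun h => hxf (h ▸ hz), fun h => hXf.ne_of_mem h hz rfl⟩
        · obtain ⟨y, hy, ⟨e, he, rfl⟩⟩ := Set.not_disjoint_iff.1 hXf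
          have hXy : X = {f e} := hX.eq_singleton_of_mem hy
          subst hXy
          have hnl : M✶.IsNonloop x := ⟨fun h => by simpa using hX' h, hxE⟩
          have hcl2 := hnl.mem_closure_singleton hcl
          have hex : f e ≠ x := fun h => hxX (by simp [h])
          rw [dual_mem_closure_iff (hE ⟨e, he, rfl⟩) (by simpa using hex)] at hcl2
          have hl : (M.comapOn E f).IsColoop e := by
            rw [isColoop_iff_notMem_closure_compl (by exact he), mem_closure_comapOn]
            rintro ⟨-, h | h⟩
            · refine hcl2 (M.closure_subset_closure ?_ h)
              rintro _ ⟨a, ha, rfl⟩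
              refine ⟨hE ⟨a, ha.2, rfl⟩, ?_⟩
              simp only [Set.mem_insert_iff, Set.mem_singleton_iff, not_or]
              exact ⟨fun h => ha.1.2 (hf ha.2 he h), fun h => hxf ⟨a, ha.2, h⟩⟩
            · exact h (hE ⟨e, he, rfl⟩)
          refine .coext (e := e) (X := ∅) Set.subsingleton_empty (by simp) hl ?_
          rw [contract_eq_delete_of_subset_coloops (Set.singleton_subset_iff.2 hl)]
          exact hdel e he

theorem SPReducible.delete [Finite α] (h : M.SPReducible) (D : Set α) :
    (M ＼ D).SPReducible := by
  have h1 : M ＼ D = M.comapOn (M.E \ D) id := by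
    refine ext_indep rfl fun I hI => ?_
    rw [delete_indep_iff, comapOn_indep_iff]
    have := Set.subset_sdiff.1 (show I ⊆ M.E \ D from hI)
    simp [Set.subset_sdiff, this, Set.injOn_id]
  rw [h1]
  exact h.comapOn _ _

theorem SPReducible.restrict [Finite α] (h : M.SPReducible) {R : Set α} (hR : R ⊆ M.E) :
    (M ↾ R).SPReducible := by
  rw [← delete_compl hR]
  exact h.delete _

end Matroid

/-! ### Simplicity and the bound of 2r - 1 elements. -/

namespace Matroid

variable {α β : Type*} {M N : Matroid α} {e f g x y : α}

/-- Every pair of elements of `X` is independent; in particular `X` contains no loop. -/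
def PairwiseIndep (M : Matroid α) (X : Set α) : Prop := ∀ x ∈ X, ∀ y ∈ X, M.Indep {x, y}

theorem PairwiseIndep.subset_ground {X : Set α} (h : M.PairwiseIndep X) : X ⊆ M.E :=
  fun x hx => (h x hx x hx).subset_ground (by simp)

theorem isSimpleMatroid_iff_pairwiseIndep : M.IsSimpleMatroid ↔ M.PairwiseIndep M.E := by
  constructor
  · rintro ⟨h1, h2⟩ x hx y hy
    by_contra hd
    have hx' : M.IsNonloop x := by
      rw [isNonloop_iff_mem_compl_loops, h1.loops_eq_empty]; simpa
    have hy' : M.IsNonloop y := by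
      rw [isNonloop_iff_mem_compl_loops, h1.loops_eq_empty]; simpa
    by_cases hxy : x = y
    · subst hxy; exact hd (by simpa using hx')
    · have := (hx'.closure_eq_closure_iff_eq_or_dep hy').2 (Or.inr hd)
      refine h2 _ ((hx'.closure_eq_closure_iff_isCircuit_of_ne hxy).1 this) ?_
      exact Set.encard_pair hxy
  · intro h
    refine ⟨⟨?_⟩, fun C hC h2 => ?_⟩
    · rw [Set.eq_empty_iff_forall_notMem]
      intro x hx
      have hl : M.IsLoop x := hx
      have := h x hl.mem_ground x hl.mem_ground
      rw [Set.pair_eq_singleton] at this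
      exact (indep_singleton.1 this).not_isLoop hl
    · obtain ⟨x, y, hxy, rfl⟩ := Set.encard_eq_two.1 h2
      exact hC.not_indep (h x (hC.subset_ground (by simp)) y (hC.subset_ground (by simp)))

theorem natRank_cast [Finite α] (M : Matroid α) : (M.natRank : ℕ∞) = M.eRank := by
  rw [natRank, ENat.natCast_toNat]
  exact ((M.eRank_le_encard_ground).trans_lt
    (Set.encard_lt_top_iff.2 (Set.toFinite _))).ne

theorem natRank_eq_iff [Finite α] {M : Matroid α} {k : ℕ} : M.natRank = k ↔ M.eRank = k := by
  rw [← natRank_cast]; exact Nat.cast_inj.symm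

theorem natRank_contract_add_one [Finite α] (h : M.IsNonloop e) :
    (M ／ {e}).natRank + 1 = M.natRank := by
  obtain ⟨B, hB⟩ := (M ／ {e}).exists_isBase
  have hB' := hB
  rw [h.indep.contract_isBase_iff] at hB'
  have h1 := hB.encard_eq_eRank
  have h2 := hB'.1.encard_eq_eRank
  rw [Set.union_singleton, Set.encard_insert_of_notMem (by simpa using hB'.2), h1,
    ← natRank_cast, ← natRank_cast] at h2
  exact_mod_cast h2

theorem natRank_delete_of_mem_closure [Finite α] {X : Set α} (heX : e ∉ X)
    (h : e ∈ M.closure X) : (M ＼ {e}).natRank = M.natRank := by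
  have hs : M.Spanning (M.E \ {e}) := by
    rw [spanning_iff_closure_eq]
    refine (M.closure_subset_ground _).antisymm fun z hz => ?_
    by_cases hze : z = e
    · subst hze
      rw [← closure_inter_ground] at h
      refine M.closure_subset_closure ?_ h
      rintro w ⟨hw, hwE⟩
      exact ⟨hwE, fun hwz => heX (by rwa [← Set.mem_singleton_iff.1 hwz])⟩
    · exact M.mem_closure_of_mem' ⟨hz, hze⟩
  rw [natRank, natRank, delete_eq_restrict, hs.eRank_restrict]

theorem Indep.ncard_le_natRank [Finite α] {I : Set α} (h : M.Indep I) : I.ncard ≤ M.natRank := by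
  have := h.encard_le_eRank
  rw [← natRank_cast, ← (Set.toFinite I).cast_ncard_eq] at this
  exact_mod_cast this

theorem notMem_closure_of_dual {X Z : Set α} (heX : e ∉ X)
    (hcl : e ∈ M✶.closure X) (hZ : Z ⊆ M.E) (heZ : e ∉ Z) (hXZ : Disjoint X Z) :
    e ∉ M.closure Z := by
  intro h
  refine (dual_mem_closure_iff (M := M) (M✶.closure_subset_ground _ hcl) heX).1 hcl
    (M.closure_subset_closure ?_ h)
  intro z hz
  refine ⟨hZ hz, ?_⟩
  simp only [Set.mem_insert_iff, not_or]
  exact ⟨fun h => heZ (h ▸ hz), fun h => hXZ.ne_of_mem h hz rfl⟩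

/-- If contracting `e` made `{x, y}` dependent, a circuit inside `{e, x, y}` through `e` would avoid
`Y`, whereas `e` is in the dual closure of `Y`. Only `e` and the possible element of `Y` have to be
given up. -/
theorem PairwiseIndep.contract {X Y : Set α} (hX : M.PairwiseIndep X) (heY : e ∉ Y)
    (hcl : e ∈ M✶.closure Y) : (M ／ {e}).PairwiseIndep (X \ insert e Y) := by
  have hdis : ∀ x ∈ X \ insert e Y, ∀ y ∈ X \ insert e Y, e ∉ M.closure {x, y} ∧ e ∉ ({x, y} : Set α) := by
    rintro x ⟨hx, hx'⟩ y ⟨hy, hy'⟩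
    simp only [Set.mem_insert_iff, not_or] at hx' hy'
    have h1 : e ∉ ({x, y} : Set α) := by simp [Ne.symm hx'.1, Ne.symm hy'.1]
    refine ⟨notMem_closure_of_dual heY hcl (hX x hx y hy).subset_ground h1 ?_, h1⟩
    rw [Set.disjoint_right]
    rintro z (rfl | rfl)
    exacts [hx'.2, hy'.2]
  intro x hx y hy
  obtain ⟨h1, h2⟩ := hdis x hx y hy
  have hE := M✶.closure_subset_ground _ hcl
  have hnl : M.IsNonloop e := isNonloop_of_notMem_closure h1 hE
  rw [hnl.contractElem_indep_iff, (hX x hx.1 y hy.1).insert_indep_iff_of_notMem h2]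
  exact ⟨h2, hE, h1⟩

theorem PairwiseIndep.ncard_le_natRank [Finite α] {X : Set α} (hX : M.PairwiseIndep X)
    (h : X.ncard ≤ 2) : X.ncard ≤ M.natRank := by
  refine Indep.ncard_le_natRank ?_
  interval_cases hn : X.ncard
  · rw [Set.ncard_eq_zero] at hn
    subst hn; exact M.empty_indep
  · obtain ⟨a, rfl⟩ := Set.ncard_eq_one.1 hn
    simpa using hX a rfl a rfl
  · obtain ⟨a, b, hab, rfl⟩ := Set.ncard_eq_two.1 hn
    exact hX a (by simp) b (by simp)

/-- A pairwise independent set in a reducible matroid of rank `r` has at most `2 r - 1` elements. -/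
theorem SPReducible.ncard_add_one_le [Finite α] (h : M.SPReducible) {X : Set α}
    (hX : M.PairwiseIndep X) (hne : X.Nonempty) : X.ncard + 1 ≤ 2 * M.natRank := by
  classical
  induction h generalizing X with
  | empty => 
    obtain ⟨x, hx⟩ := hne
    exact absurd (hX.subset_ground hx) (by simp)
  | @ext M e Y hY heY hcl _ ih =>
    rw [← natRank_delete_of_mem_closure heY hcl]
    by_cases heX : e ∈ X
    swap
    · refine ih (fun x hx y hy => ?_) hne
      rw [deleteElem_indep_iff]
      refine ⟨hX x hx y hy, ?_⟩
      rintro (rfl | rfl)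
      exacts [heX hx, heX hy]
    have henl : M.IsNonloop e := by simpa using hX e heX e heX
    rcases hY.eq_empty_or_singleton with rfl | ⟨y, rfl⟩
    · exact absurd hcl henl.not_isLoop
    have hey : e ≠ y := by simpa using heY
    have hceq := henl.closure_eq_of_mem_closure hcl
    have hyE := (henl.isNonloop_of_mem_closure hcl).mem_ground
    have hyX : y ∉ X := fun hyX =>
      ((henl.closure_eq_closure_iff_isCircuit_of_ne hey).1 hceq).not_indep (hX e heX y hyX)
    -- `X` survives the deletion of `e` once `e` is traded for its parallel partner `y`, which is
    -- not already in `X`.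
    have hcard : (Function.update id e y '' X).ncard = X.ncard := by
      refine Set.InjOn.ncard_image fun a ha b hb hab => ?_
      by_cases hae : a = e <;> by_cases hbe : b = e
      · rw [hae, hbe]
      · simp [hae, hbe] at hab; exact absurd (hab ▸ hb) hyX
      · simp [hae, hbe] at hab; exact absurd (hab ▸ ha) hyX
      · simpa [hae, hbe] using hab
    rw [← hcard]
    refine ih ?_ (hne.image _)
    rintro _ ⟨a, ha, rfl⟩ _ ⟨b, hb, rfl⟩
    have h1 := hX a ha b hb
    rw [eq_comap_of_closure_eq henl.mem_ground hyE hey hceq, comap_indep_iff,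
      Set.image_pair] at h1
    exact h1.1
  | @coext M e Y hY heY hcl _ ih =>
    have heE : e ∈ M.E := M✶.closure_subset_ground _ hcl
    have hnl : M.IsNonloop e := isNonloop_of_notMem_closure
      ((dual_mem_closure_iff heE heY).1 hcl) heE
    have hr := natRank_contract_add_one hnl
    have h2 : (insert e Y).ncard ≤ 2 := by
      have h3 := Set.ncard_insert_le e Y
      have h4 := Set.ncard_le_one_iff_subsingleton.2 hY
      omega
    -- If nothing survives, 1 ≤ |X| ≤ 2 and |X| is at most the rank r, so |X| + 1 ≤ 2|X| ≤ 2r.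
    -- Otherwise |X| drops by at most two while r drops by one.
    rcases (X \ insert e Y).eq_empty_or_nonempty with hemp | hne'
    · have h3 := Set.ncard_le_ncard (Set.sdiff_eq_empty.1 hemp) (Set.toFinite _)
      have h4 := hX.ncard_le_natRank (by omega)
      have h5 : 0 < X.ncard := hne.ncard_pos
      omega
    · have h3 := ih (hX.contract heY hcl) hne'
      have h4 := Set.le_ncard_sdiff (insert e Y) X
      omega

/-! ### Attaching a triangle along an element -/

/-- A circuit and a cocircuit never meet in exactly one element. -/
theorem IsCircuit.mem_iff_of_isCocircuit_pair {C : Set α} (hC : M.IsCircuit C)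
    (hK : M.IsCocircuit {e, g}) : e ∈ C ↔ g ∈ C := by
  have h1 := hC.inter_isCocircuit_ne_singleton hK (e := e)
  have h2 := hC.inter_isCocircuit_ne_singleton hK (e := g)
  by_cases he : e ∈ C <;> by_cases hg : g ∈ C <;> simp only [he, hg]
  · exact absurd (by ext z; simp; grind) h1
  · exact absurd (by ext z; simp; grind) h2

/-- The triangle `{e, f, g}` of `M` is attached along `f`: its other two elements are in series. -/
structure IsTriangleAt (M : Matroid α) (e f g : α) : Prop where
  ne : e ≠ g
  ne_left : e ≠ f
  ne_right : g ≠ f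
  cocircuit : M.IsCocircuit {e, g}
  circuit : M.IsCircuit {e, f, g}

namespace IsTriangleAt

variable (h : M.IsTriangleAt e f g)
include h

theorem mem_left : e ∈ M.E := h.circuit.subset_ground (by simp)
theorem mem_right : g ∈ M.E := h.circuit.subset_ground (by simp)
theorem nonloop : M.IsNonloop e := by
  refine h.circuit.isNonloop_of_mem ⟨e, by simp, g, by simp, h.ne⟩ (by simp)

theorem isCircuit_contract : (M ／ {e}).IsCircuit {g, f} := by
  have := h.circuit.contractElem_isCircuit (e := e) ⟨e, by simp, g, by simp, h.ne⟩ (by simp)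
  convert this using 1
  ext z; simp
  have := h.ne; have := h.ne_left
  grind

/-- Once `g` is gone its series partner `e` is a coloop, and contracting a coloop is deleting it. -/
theorem contract_delete : M ／ {e} ＼ {g} = M ＼ {e, g} := by
  have hco : (M ＼ {g}).IsColoop e := by
    rw [← singleton_isCocircuit]
    convert h.cocircuit.delete_isCocircuit (D := {g}) ?_ using 1
    · ext z; simp; have := h.ne; grind
    · refine ⟨by simp, fun hs => h.ne (by simpa using hs (Set.mem_insert e _))⟩
  rw [contract_delete_comm _ (by simpa using h.ne),
    contract_eq_delete_of_subset_coloops (Set.singleton_subset_iff.2 hco), delete_delete,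
    Set.union_singleton]

theorem natRank [Finite α] : (M ＼ {e, g}).natRank + 1 = M.natRank := by
  rw [← h.contract_delete, natRank_delete_of_mem_closure (X := {f}) (by simpa using h.ne_right),
    natRank_contract_add_one h.nonloop]
  have := h.isCircuit_contract.mem_closure_sdiff_singleton_of_mem (e := g) (by simp)
  refine Matroid.closure_subset_closure _ ?_ this
  rintro z ⟨hz, hz'⟩
  simpa [show z ≠ g from hz'] using hz

theorem mem_dual_closure : e ∈ M✶.closure {g} := by
  have := h.cocircuit.isCircuit.mem_closure_sdiff_singleton_of_mem (e := e) (by simp)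
  refine Matroid.closure_subset_closure _ ?_ this
  rintro z ⟨hz, hz'⟩
  simpa [show z ≠ e from hz'] using hz

theorem spReducible (hM : (M ＼ {e, g}).SPReducible) : M.SPReducible := by
  refine .coext (e := e) (X := {g}) Set.subsingleton_singleton (by simpa using h.ne)
    h.mem_dual_closure ?_
  refine .ext (e := g) (X := {f}) Set.subsingleton_singleton (by simpa using h.ne_right) ?_
    (by rwa [h.contract_delete])
  have := h.isCircuit_contract.mem_closure_sdiff_singleton_of_mem (e := g) (by simp)
  refine Matroid.closure_subset_closure _ ?_ this
  rintro z ⟨hz, hz'⟩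
  simpa [show z ≠ g from hz'] using hz

/-- A circuit inside a pair contains both of `e`, `g` or neither. In the first case it would lie
properly inside the triangle; in the second it is a circuit of the rest. -/
theorem pairwiseIndep (hM : (M ＼ {e, g}).PairwiseIndep (M ＼ {e, g}).E) :
    M.PairwiseIndep M.E := by
  intro x hx y hy
  by_contra hd
  obtain ⟨C, hCs, hC⟩ := Dep.exists_isCircuit_subset ⟨hd, Set.pair_subset hx hy⟩
  have hiff := hC.mem_iff_of_isCocircuit_pair h.cocircuit
  by_cases heC : e ∈ C
  · have hgC := hiff.1 heC
    have hsub : C ⊆ {e, g} := by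
      have h1 := hCs heC; have h2 := hCs hgC
      intro z hz
      have h3 := hCs hz
      have := h.ne
      simp only [Set.mem_insert_iff, Set.mem_singleton_iff] at *
      grind
    have := h.circuit.eq_of_superset_isCircuit hC (fun z hz => by
      have := hsub hz; simp only [Set.mem_insert_iff, Set.mem_singleton_iff] at *; tauto)
    have hf : f ∈ C := by rw [← this]; simp
    have := hsub hf
    simp [h.ne_left.symm, h.ne_right.symm] at this
  · have hgC := fun hg => heC (hiff.2 hg)
    have hC' : (M ＼ {e, g}).IsCircuit C := by
      rw [delete_isCircuit_iff]
      refine ⟨hC, Set.disjoint_right.2 ?_⟩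
      rintro z (rfl | rfl)
      exacts [heC, hgC]
    have key : ∀ a ∈ C, ∀ b ∈ C, ¬ C ⊆ {a, b} := fun a ha b hb hab =>
      hC'.not_indep ((hM a (hC'.subset_ground ha) b (hC'.subset_ground hb)).subset hab)
    obtain ⟨a, ha⟩ := hC.nonempty
    by_cases hxC : x ∈ C <;> by_cases hyC : y ∈ C
    · exact key x hxC y hyC hCs
    · exact key x hxC x hxC fun z hz => by rcases hCs hz with rfl | rfl <;> simp_all
    · exact key y hyC y hyC fun z hz => by rcases hCs hz with rfl | rfl <;> simp_all
    · rcases hCs ha with rfl | rfl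
      exacts [hxC ha, hyC ha]

end IsTriangleAt

end Matroid

/-! ### Trees of triples. -/

/-- `HyperTree E T`: the set `T` of triples is obtained from a single vertex by repeatedly
attaching a triple to an old vertex and two new ones; `E` is the set of vertices. -/
inductive HyperTree {V : Type*} : Set V → Set (Set V) → Prop
  | single (v : V) : HyperTree {v} ∅
  | step {E : Set V} {T : Set (Set V)} {e f g : V} : HyperTree E T → f ∈ E → e ∉ E → g ∉ E →
      e ≠ g → HyperTree (insert e (insert g E)) (insert {e, f, g} T)

namespace HyperTree

variable {V : Type*} {E : Set V} {T : Set (Set V)}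

theorem subset (h : HyperTree E T) : ∀ t ∈ T, t ⊆ E := by
  induction h with
  | single v => simp
  | step _ hf _ _ _ ih =>
    rintro t (rfl | ht) z hz
    · rcases hz with rfl | rfl | rfl <;> simp [hf]
    · simp [ih t ht hz]

theorem nonempty (h : HyperTree E T) : E.Nonempty := by
  cases h with
  | single v => simp
  | step => simp

theorem notMem {e f g : V} (h : HyperTree E T) (he : e ∉ E) : {e, f, g} ∉ T :=
  fun ht => he (h.subset _ ht (by simp))

theorem finite (h : HyperTree E T) : T.Finite := by
  induction h with
  | single v => simp
  | step _ _ _ _ _ ih => exact ih.insert _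

theorem ncard_eq [Finite V] (h : HyperTree E T) : E.ncard = 2 * T.ncard + 1 := by
  induction h with
  | single v => simp
  | step h hf he hg hne ih =>
    rw [Set.ncard_insert_of_notMem (by simp [hne, he]), Set.ncard_insert_of_notMem hg,
      Set.ncard_insert_of_notMem (h.notMem he) h.finite, ih]
    ring

end HyperTree

/-! ### Extremal simple matroids and trees of triples. -/

namespace Matroid

variable {α β : Type*} {M N : Matroid α} {e f g x y : α}

/-- The circuits of size three. -/
def triangles (M : Matroid α) : Set (Set α) := {C | M.IsCircuit C ∧ C.ncard = 3}

theorem PairwiseIndep.isCircuit_of_dep (hM : M.PairwiseIndep M.E) (he : e ∈ M.E) (hf : f ∈ M.E)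
    (hg : g ∈ M.E) (hd : ¬ M.Indep {e, f, g}) : M.IsCircuit {e, f, g} := by
  rw [isCircuit_iff_dep_forall_sdiff_singleton_indep]
  have hE : ({e, f, g} : Set α) ⊆ M.E := by
    rintro z (rfl | rfl | rfl) <;> assumption
  refine ⟨⟨hd, hE⟩, ?_⟩
  rintro z (rfl | rfl | rfl)
  · exact (hM f hf g hg).subset (by intro w; simp; tauto)
  · exact (hM e he g hg).subset (by intro w; simp; tauto)
  · exact (hM e he f hf).subset (by intro w; simp; tauto)

theorem PairwiseIndep.two_lt_ncard_of_isCircuit [Finite α] (hM : M.PairwiseIndep M.E) {C : Set α}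
    (hC : M.IsCircuit C) : 2 < C.ncard := by
  by_contra hle
  have : C.ncard ≤ M.eRk C := by
    have h1 : (M ↾ C).PairwiseIndep C := fun x hx y hy => by
      rw [restrict_indep_iff]
      exact ⟨hM x (hC.subset_ground hx) y (hC.subset_ground hy), Set.pair_subset hx hy⟩
    have h2 := h1.ncard_le_natRank (by omega)
    rw [← eRank_restrict, ← natRank_cast]
    exact_mod_cast h2
  have h3 := hC.eRk_add_one_eq
  rw [← (Set.toFinite C).cast_ncard_eq] at h3
  have h4 : M.eRk C ≠ ⊤ := fun h => by
    rw [h, top_add] at h3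
    exact ENat.natCast_ne_top _ h3.symm
  lift M.eRk C to ℕ using h4 with r
  norm_cast at h3 this
  omega

theorem PairwiseIndep.delete (hM : M.PairwiseIndep M.E) (D : Set α) :
    (M ＼ D).PairwiseIndep (M ＼ D).E := by
  intro x hx y hy
  rw [delete_indep_iff]
  refine ⟨hM x hx.1 y hy.1, Set.disjoint_left.2 ?_⟩
  rintro z (rfl | rfl)
  exacts [hx.2, hy.2]

namespace IsTriangleAt

theorem ncard (h : M.IsTriangleAt e f g) : ({e, f, g} : Set α).ncard = 3 :=
  Set.ncard_eq_three.2 ⟨e, f, g, h.ne_left, h.ne, h.ne_right.symm, rfl⟩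

theorem ground_eq (h : M.IsTriangleAt e f g) : M.E = insert e (insert g (M ＼ {e, g}).E) := by
  have h1 := h.mem_left
  have h2 := h.mem_right
  ext z
  simp only [delete_ground, Set.mem_insert_iff, Set.mem_sdiff, Set.mem_singleton_iff]
  by_cases hz : z = e <;> by_cases hz' : z = g <;> simp_all

/-- Another 3-circuit through `e` also contains `g`. Eliminating `e` between it and `{e, f, g}`
leaves a circuit avoiding `e`, hence `g`, so of at most two elements, which simplicity forbids. -/
theorem triangles_eq [Finite α] (h : M.IsTriangleAt e f g) (hM : M.PairwiseIndep M.E) :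
    M.triangles = insert {e, f, g} (M ＼ {e, g}).triangles := by
  ext C
  simp only [triangles, Set.mem_ofPred, Set.mem_insert_iff]
  constructor
  · rintro ⟨hC, h3⟩
    have hiff := hC.mem_iff_of_isCocircuit_pair h.cocircuit
    by_cases heC : e ∈ C
    · left
      by_contra hne
      obtain ⟨D, hDs, hD⟩ := hC.elimination h.circuit hne e
      have heD : e ∉ D := fun he => (hDs he).2 rfl
      have hgD : g ∉ D := fun hg =>
        heD ((hD.mem_iff_of_isCocircuit_pair h.cocircuit).2 hg)
      have hDs' : D ⊆ insert f (C \ {e, g}) := by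
        intro z hz
        have h1 := hDs hz
        have h2 : z ≠ e := fun h => heD (h ▸ hz)
        have h3 : z ≠ g := fun h => hgD (h ▸ hz)
        simp only [Set.mem_sdiff, Set.mem_union, Set.mem_insert_iff, Set.mem_singleton_iff] at h1 ⊢
        tauto
      have h4 := Set.ncard_le_ncard hDs' (Set.toFinite _)
      have h5 := Set.ncard_insert_le f (C \ {e, g})
      have h6 : ({e, g} : Set α).ncard = 2 := Set.ncard_pair h.ne
      have h7 := Set.ncard_sdiff_add_ncard_of_subset
        (Set.insert_subset heC (Set.singleton_subset_iff.2 (hiff.1 heC))) (Set.toFinite C)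
      have h8 := hM.two_lt_ncard_of_isCircuit hD
      omega
    · right
      refine ⟨?_, h3⟩
      rw [delete_isCircuit_iff]
      refine ⟨hC, Set.disjoint_right.2 ?_⟩
      rintro z (rfl | rfl)
      exacts [heC, fun hg => heC (hiff.2 hg)]
  · rintro (rfl | ⟨hC, h3⟩)
    · exact ⟨h.circuit, h.ncard⟩
    · exact ⟨hC.of_delete, h3⟩

/-- A matroid with a triangle attached along `f` is determined by the rest. -/
theorem eq_of_delete_eq (h : M.IsTriangleAt e f g) (h' : N.IsTriangleAt e f g)
    (heq : M ＼ {e, g} = N ＼ {e, g}) : M = N := by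
  classical
  -- Contracting `e` turns the triangle into the parallel pair `{g, f}`, so `M ／ {e}` is the rest
  -- with `g` doubled from `f`. Dually, `key2` recovers `M` from `M ／ {e}` by placing `e` in series
  -- with `g`.
  have key : ∀ M : Matroid α, M.IsTriangleAt e f g →
      M ／ {e} = (M ＼ {e, g}).comap (Function.update id g f) := by
    intro M h
    rw [← h.contract_delete]
    have hc := h.isCircuit_contract
    have hnl : (M ／ {e}).IsNonloop g :=
      hc.isNonloop_of_mem ⟨g, by simp, f, by simp, h.ne_right⟩ (by simp)
    exact eq_comap_of_closure_eq (hc.subset_ground (by simp)) (hc.subset_ground (by simp))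
      h.ne_right ((hnl.closure_eq_closure_iff_isCircuit_of_ne h.ne_right).2 hc)
  have key2 : ∀ M : Matroid α, M.IsTriangleAt e f g →
      M✶ = (M ／ {e})✶.comap (Function.update id e g) := by
    intro M h
    have hc := h.cocircuit.isCircuit
    have hnl : M✶.IsNonloop e :=
      hc.isNonloop_of_mem ⟨e, by simp, g, by simp, h.ne⟩ (by simp)
    rw [dual_contract]
    exact eq_comap_of_closure_eq (M := M✶) h.mem_left h.mem_right
      h.ne ((hnl.closure_eq_closure_iff_isCircuit_of_ne h.ne).2 hc)
  rw [← dual_inj, key2 M h, key2 N h', key M h, key N h', heq]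

end IsTriangleAt

/-- Extending a matroid by an element parallel to a nonloop. -/
theorem exists_parallel_extension (hy : N.IsNonloop y) (hx : x ∉ N.E) :
    ∃ P : Matroid α, P.E = insert x N.E ∧ P ＼ {x} = N ∧ P.IsCircuit {x, y} := by
  classical
  have hyE := hy.mem_ground
  have hxy : x ≠ y := fun h => hx (h ▸ hyE)
  have hu : ∀ z, z ≠ x → Function.update id x y z = z := fun z hz => Function.update_of_ne hz _ _
  refine ⟨N.comapOn (insert x N.E) (Function.update id x y), rfl, ?_, ?_⟩
  · rw [comapOn_delete]
    have h1 : insert x N.E \ {x} = N.E := by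
      ext z; by_cases hz : z = x <;> simp [hz, hx]
    rw [h1]
    refine ext_indep rfl fun I hI => ?_
    have h2 : Set.EqOn (Function.update id x y) id I := fun z hz => hu z fun h => hx (h ▸ hI hz)
    have h3 : Set.InjOn (Function.update id x y) I :=
      (Set.injOn_id I).congr h2.symm
    have h4 : I ⊆ N.E := hI
    rw [comapOn_indep_iff, h2.image_eq, Set.image_id]
    simp [h3, h4]
  · rw [← IsNonloop.closure_eq_closure_iff_isCircuit_of_ne ?_ hxy]
    · ext z
      rw [mem_closure_comapOn, mem_closure_comapOn]
      have h1 : ({x} : Set α) ∩ insert x N.E = {x} := by simp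
      have h2 : ({y} : Set α) ∩ insert x N.E = {y} := by
        simp [hyE]
      rw [h1, h2]
      simp [hu y hxy.symm]
    · rw [← indep_singleton, comapOn_indep_iff]
      simpa using hy

/-- First add `g` parallel to `f`, then add `e` in series with `g`, that is, parallel to `g` in the
dual. -/
theorem exists_isTriangleAt (hf : N.IsNonloop f) (he : e ∉ N.E) (hg : g ∉ N.E) (hne : e ≠ g) :
    ∃ M : Matroid α, M.IsTriangleAt e f g ∧ M ＼ {e, g} = N := by
  have hfE := hf.mem_ground
  obtain ⟨P, hPE, hPd, hPc⟩ := exists_parallel_extension hf hg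
  have hgf : g ≠ f := fun h => hg (h ▸ hfE)
  have hef : e ≠ f := fun h => he (h ▸ hfE)
  have hgn : P✶.IsNonloop g := by
    refine ⟨?_, by simp [hPE]⟩
    rw [dual_isLoop_iff_isColoop]
    exact hPc.not_isColoop_of_mem (by simp)
  obtain ⟨Q, hQE, hQd, hQc⟩ := exists_parallel_extension (N := P✶) (x := e) hgn
    (by simp [hPE, he, hne])
  have hcon : Q✶ ／ {e} = P := by rw [← dual_delete, hQd, dual_dual]
  have hco : Q✶.IsCocircuit {e, g} := by rwa [isCocircuit_def, dual_dual]
  have hcirc : Q✶.IsCircuit {e, f, g} := by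
    obtain ⟨C, hC, h1, h2⟩ := (hcon ▸ hPc : (Q✶ ／ {e}).IsCircuit {g, f}).exists_subset_isCircuit_of_contract
    have h3 : e ∈ C := (hC.mem_iff_of_isCocircuit_pair hco).2 (h1 (by simp))
    convert hC using 1
    refine Set.Subset.antisymm ?_ ?_
    · rintro z (rfl | rfl | rfl)
      exacts [h3, h1 (by simp), h1 (by simp)]
    · intro z hz
      have := h2 hz
      simp at this ⊢
      tauto
  have hT : Q✶.IsTriangleAt e f g := ⟨hne, hef, hgf, hco, hcirc⟩
  exact ⟨_, hT, by rw [← hT.contract_delete, hcon, hPd]⟩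

/-- `g` is spanned by `e` and `f`, so the complement of `{e, g}` spans everything after adding the
single element `e`. -/
theorem restrict_triangle_le [Finite α] (hc : M.IsCircuit {e, f, g}) (heg : e ≠ g) (hgf : g ≠ f)
    : M.natRank ≤ (M ＼ {e, g}).natRank + 1 := by
  have hE : M.E ⊆ M.closure (insert e (M.E \ {e, g})) := by
    have h1 : g ∈ M.closure ({e, f, g} \ {g}) := hc.mem_closure_sdiff_singleton_of_mem (by simp)
    have hsub : insert e (M.E \ {e, g}) ⊆ M.E :=
      Set.insert_subset (hc.subset_ground (by simp)) Set.sdiff_subset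
    intro z hz
    by_cases hzg : z = g
    · subst hzg
      by_cases hef : e = f
      · subst hef
        refine M.closure_subset_closure ?_ h1
        intro w; simp; tauto
      · refine M.closure_subset_closure ?_ h1
        have := hc.subset_ground (show f ∈ _ by simp)
        rintro w ⟨rfl | rfl | rfl, hw⟩
        · simp
        · simp [this, Ne.symm hef, hgf.symm]
        · simp at hw
    · by_cases hze : z = e
      · subst hze; exact M.mem_closure_of_mem (by simp)
      · exact M.mem_closure_of_mem (by simp [hz, hze, hzg])
  have h2 : M.eRank ≤ M.eRk (M.E \ {e, g}) + 1 := by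
    rw [← M.eRk_ground]
    refine (M.eRk_mono hE).trans ?_
    rw [eRk_closure_eq]
    exact M.eRk_insert_le_add_one _ _
  rw [← eRank_restrict, ← delete_eq_restrict, ← natRank_cast, ← natRank_cast] at h2
  exact_mod_cast h2

/-- If `e` were spanned by the complement of `{e, g}`, the triangle would put `g` in that span too
and no rank would be lost. So `e` lies in the dual closure of `g`, and the two are in series. -/
theorem isTriangleAt_of_natRank [Finite α] (hc : M.IsCircuit {e, f, g}) (heg : e ≠ g) (hgf : g ≠ f)
    (hef : e ≠ f) (hr : (M ＼ {e, g}).natRank < M.natRank) : M.IsTriangleAt e f g := by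
  refine ⟨heg, hef, hgf, ?_, hc⟩
  have heE : e ∈ M.E := hc.subset_ground (by simp)
  have hnl : M✶.IsNonloop e := by
    refine ⟨?_, heE⟩
    rw [dual_isLoop_iff_isColoop]
    exact hc.not_isColoop_of_mem (by simp)
  rw [isCocircuit_def, ← hnl.closure_eq_closure_iff_isCircuit_of_ne heg]
  refine hnl.closure_eq_of_mem_closure ?_
  rw [dual_mem_closure_iff heE (by simpa using heg)]
  intro hcl
  refine hr.ne ?_
  have h1 : g ∈ M.closure ({e, f, g} \ {g}) := hc.mem_closure_sdiff_singleton_of_mem (by simp)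
  have h2 : M.Spanning (M.E \ {e, g}) := by
    rw [spanning_iff_closure_eq]
    refine (M.closure_subset_ground _).antisymm fun z hz => ?_
    by_cases hze : z = e
    · subst hze; exact hcl
    by_cases hzg : z = g
    · subst hzg
      rw [← closure_closure]
      refine M.closure_subset_closure ?_ h1
      rintro w ⟨rfl | rfl | rfl, hw⟩
      · exact hcl
      · refine M.mem_closure_of_mem ⟨hc.subset_ground (by simp), ?_⟩
        simp [hef.symm, hgf.symm]
      · simp at hw
    · exact M.mem_closure_of_mem (by simp [hz, hze, hzg])
  rw [natRank, natRank, delete_eq_restrict, h2.eRank_restrict]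

/-- The rank of a matroid in which all triples of a hypertree are circuits. -/
theorem natRank_le_of_hyperTree [Finite α] {T : Set (Set α)} {E : Set α} (hT : HyperTree E T)
    (hE : M.E = E) (hc : ∀ t ∈ T, M.IsCircuit t) : M.natRank ≤ T.ncard + 1 := by
  induction hT generalizing M with
  | single v =>
    have := M.eRank_le_encard_ground
    rw [hE, ← natRank_cast, Set.encard_singleton] at this
    have : M.natRank ≤ 1 := by exact_mod_cast this
    simpa
  | @step E T e f g h hf he hg hne ih =>
    have hgf : g ≠ f := fun h => hg (h ▸ hf)
    rw [Set.ncard_insert_of_notMem (h.notMem he) h.finite]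
    refine (restrict_triangle_le (hc _ (by simp)) hne hgf).trans ?_
    refine Nat.add_le_add_right (ih ?_ ?_) 1
    · rw [delete_ground, hE]
      ext z
      by_cases h1 : z = e <;> by_cases h2 : z = g <;> simp_all
    · intro t ht
      rw [delete_isCircuit_iff]
      refine ⟨hc t (by simp [ht]), Set.disjoint_right.2 ?_⟩
      rintro z (rfl | rfl)
      exacts [fun hz => he (h.subset t ht hz), fun hz => hg (h.subset t ht hz)]

/-- Each triple contributes at most one to the rank, so the lower bound on the rank forces each to
contribute exactly one. The last triple is then attached along `f`, and it is peeled off both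
matroids by induction. -/
theorem eq_of_hyperTree [Finite α] {T : Set (Set α)} {E : Set α} (hT : HyperTree E T)
    (hM : M.E = E) (hMc : ∀ t ∈ T, M.IsCircuit t) (hMr : T.ncard + 1 ≤ M.natRank)
    (hN : N.E = E) (hNc : ∀ t ∈ T, N.IsCircuit t) (hNr : T.ncard + 1 ≤ N.natRank) : M = N := by
  induction hT generalizing M N with
  | single v =>
    have key : ∀ M : Matroid α, M.E = {v} → 1 ≤ M.natRank → M = freeOn {v} := by
      intro M hM hr
      rw [eq_freeOn_iff]
      refine ⟨hM, ?_⟩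
      rw [indep_iff_eRk_eq_encard_of_finite (Set.toFinite _)]
      refine le_antisymm (M.eRk_le_encard _) ?_
      rw [← hM, eRk_ground, hM, Set.encard_singleton, ← natRank_cast]
      exact_mod_cast hr
    rw [key M hM (by simpa using hMr), key N hN (by simpa using hNr)]
  | @step E T e f g h hf he hg hne ih =>
    have hgf : g ≠ f := fun h => hg (h ▸ hf)
    have hef : e ≠ f := fun h => he (h ▸ hf)
    rw [Set.ncard_insert_of_notMem (h.notMem he) h.finite] at hMr hNr
    have key : ∀ M : Matroid α, M.E = insert e (insert g E) →
        (∀ t ∈ insert {e, f, g} T, M.IsCircuit t) → T.ncard + 1 + 1 ≤ M.natRank →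
        M.IsTriangleAt e f g ∧ (M ＼ {e, g}).E = E ∧
        (∀ t ∈ T, (M ＼ {e, g}).IsCircuit t) ∧ T.ncard + 1 ≤ (M ＼ {e, g}).natRank := by
      intro M hE hc hr
      have h1 : (M ＼ {e, g}).E = E := by
        rw [delete_ground, hE]
        ext z
        by_cases h1 : z = e <;> by_cases h2 : z = g <;> simp_all
      have h2 : ∀ t ∈ T, (M ＼ {e, g}).IsCircuit t := by
        intro t ht
        rw [delete_isCircuit_iff]
        refine ⟨hc t (by simp [ht]), Set.disjoint_right.2 ?_⟩
        rintro z (rfl | rfl)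
        exacts [fun hz => he (h.subset t ht hz), fun hz => hg (h.subset t ht hz)]
      have h3 := natRank_le_of_hyperTree h h1 h2
      have h4 := restrict_triangle_le (hc _ (by simp)) hne hgf
      exact ⟨isTriangleAt_of_natRank (hc _ (by simp)) hne hgf hef (by omega), h1, h2, by omega⟩
    obtain ⟨m1, m2, m3, m4⟩ := key M hM hMc hMr
    obtain ⟨n1, n2, n3, n4⟩ := key N hN hNc hNr
    exact m1.eq_of_delete_eq n1 (ih m2 m3 m4 n2 n3 n4)

theorem spReducible_freeOn_singleton (e : α) : (freeOn {e}).SPReducible := by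
  have hco : (freeOn {e}).IsColoop e := by
    rw [← dual_isLoop_iff_isColoop, freeOn_dual_eq, loopyOn_isLoop_iff]; rfl
  refine .coext (e := e) (X := ∅) Set.subsingleton_empty (by simp) hco ?_
  have : freeOn {e} ／ {e} = emptyOn α := by
    rw [← ground_eq_empty_iff]; simp
  rw [this]; exact .empty

theorem exists_of_hyperTree [Finite α] {T : Set (Set α)} {E : Set α} (hT : HyperTree E T) :
    ∃ M : Matroid α, M.SPReducible ∧ M.PairwiseIndep M.E ∧ M.E = E ∧ M.natRank = T.ncard + 1 ∧
      M.triangles = T := by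
  induction hT with
  | single v =>
    refine ⟨freeOn {v}, ?_, ?_, rfl, ?_, ?_⟩
    · exact spReducible_freeOn_singleton v
    · intro x hx y hy
      rw [freeOn_indep_iff]
      exact Set.pair_subset hx hy
    · rw [natRank_eq_iff, eRank_freeOn]; simp
    · ext C
      simp only [triangles, Set.mem_ofPred, Set.mem_empty_iff_false, iff_false]
      rintro ⟨hC, -⟩
      refine hC.not_indep ?_
      rw [freeOn_indep_iff]
      exact hC.subset_ground
  | @step E T e f g h hf he hg hne ih =>
    obtain ⟨N, hN1, hN2, hN3, hN4, hN5⟩ := ih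
    subst hN3
    have hfn : N.IsNonloop f := by simpa using hN2 f hf f hf
    obtain ⟨M, hM, rfl⟩ := exists_isTriangleAt hfn he hg hne
    refine ⟨M, hM.spReducible hN1, hM.pairwiseIndep hN2, hM.ground_eq, ?_, ?_⟩
    · rw [Set.ncard_insert_of_notMem (h.notMem he) h.finite, ← hN4, hM.natRank]
    · rw [hM.triangles_eq (hM.pairwiseIndep hN2), hN5]

/-- A simple matroid has no loop or parallel pair, so the reduction begins by contracting some `e`.
The bound applied to what survives shows that `e` has a series partner `g`, and the bound applied to
`M ／ {e}` shows that it is not simple. Pairs avoiding `g` remain independent, so `g` has become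
parallel to some `f`, and `{e, f, g}` is an attached triangle. Removing `e` and `g` preserves the
equality between size and rank. -/
theorem SPReducible.hyperTree_triangles [Finite α] (h : M.SPReducible) (hs : M.PairwiseIndep M.E)
    (hr : M.E.ncard + 1 = 2 * M.natRank) : HyperTree M.E M.triangles := by
  induction hn : M.E.ncard using Nat.strong_induction_on generalizing M with
  | _ n ih =>
    rcases Nat.lt_or_ge M.natRank 2 with hr2 | hr2
    · obtain ⟨v, hv⟩ := Set.ncard_eq_one.1 (show M.E.ncard = 1 by omega)
      have : M.triangles = ∅ := by
        rw [Set.eq_empty_iff_forall_notMem]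
        rintro C ⟨hC, h3⟩
        have := Set.ncard_le_ncard hC.subset_ground (Set.toFinite _)
        omega
      rw [hv, this]
      exact .single v
    cases h with
    | empty => simp at hr; omega
    | @ext _ e Y hY heY hcl _ =>
      exfalso
      have heE := M.closure_subset_ground _ hcl
      have hnl : M.IsNonloop e := by simpa using hs e heE e heE
      rcases hY.eq_empty_or_singleton with rfl | ⟨y, rfl⟩
      · exact hnl.not_isLoop hcl
      have hey : e ≠ y := by simpa using heY
      have hyE := (hnl.isNonloop_of_mem_closure hcl).mem_ground
      exact ((hnl.closure_eq_closure_iff_isCircuit_of_ne hey).1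
        (hnl.closure_eq_of_mem_closure hcl)).not_indep (hs e heE y hyE)
    | @coext _ e Y hY heY hcl hc =>
      have heE : e ∈ M.E := M✶.closure_subset_ground _ hcl
      have hnl : M.IsNonloop e := by simpa using hs e heE e heE
      have hrank := natRank_contract_add_one hnl
      have hX := hs.contract heY hcl
      have h4 := Set.le_ncard_sdiff (insert e Y) M.E
      have h5 := Set.ncard_insert_of_notMem heY
      have h6 := Set.ncard_le_one_iff_subsingleton.2 hY
      have hsub : M.E \ insert e Y ⊆ (M ／ {e}).E := hX.subset_ground
      have hres := (hc.restrict hsub).ncard_add_one_le (X := M.E \ insert e Y)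
        (fun x hx y hy => restrict_indep_iff.2 ⟨hX x hx y hy, Set.pair_subset hx hy⟩)
        (Set.nonempty_of_ncard_ne_zero (by omega))
      have h7 : ((M ／ {e}) ↾ (M.E \ insert e Y)).natRank ≤ (M ／ {e}).natRank := by
        have := (M ／ {e}).eRk_le_eRank (M.E \ insert e Y)
        rw [← eRank_restrict, ← natRank_cast, ← natRank_cast] at this
        exact_mod_cast this
      -- An empty `Y` would leave 2r - 2 pairwise independent elements in rank r - 1, one more than
      -- the bound allows.
      obtain ⟨g, rfl⟩ := Set.ncard_eq_one.1 (show Y.ncard = 1 by omega)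
      have heg : e ≠ g := by simpa using heY
      -- the contraction has too many elements to be simple
      have hns : ¬ (M ／ {e}).PairwiseIndep (M ／ {e}).E := by
        intro hp
        have h8 := Set.ncard_sdiff_singleton_add_one heE (Set.toFinite _)
        have h9 := hc.ncard_add_one_le hp (Set.nonempty_of_ncard_ne_zero (by
          rw [contract_ground]; omega))
        rw [contract_ground] at h9
        omega
      obtain ⟨f, hf, hfe, hfg, hdep⟩ : ∃ f ∈ M.E, f ≠ e ∧ f ≠ g ∧ g ∈ M.E ∧ ¬ M.Indep {e, f, g} := by
        simp only [PairwiseIndep, not_forall] at hns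
        obtain ⟨z, hz, w, hw, hd⟩ := hns
        rw [hnl.contractElem_indep_iff] at hd
        have hze : z ≠ e := hz.2
        have hwe : w ≠ e := hw.2
        have hd' : ¬ M.Indep {e, z, w} := fun h => hd ⟨by simp [hze.symm, hwe.symm], h⟩
        by_cases hzg : z = g
        · subst hzg
          by_cases hwg : w = z
          · subst hwg
            exact absurd (hs e heE w hw.1) (by simpa using hd')
          · exact ⟨w, hw.1, hwe, hwg, hz.1, by rwa [Set.pair_comm w z]⟩
        · by_cases hwg : w = g
          · subst hwg
            exact ⟨z, hz.1, hze, hzg, hw.1, hd'⟩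
          · exact absurd (hX z ⟨hz.1, by simp [hze, hzg]⟩ w ⟨hw.1, by simp [hwe, hwg]⟩)
              (by rw [hnl.contractElem_indep_iff]; exact hd)
      have hcirc := hs.isCircuit_of_dep heE hf hdep.1 hdep.2
      have hT : M.IsTriangleAt e f g := by
        refine ⟨heg, hfe.symm, hfg.symm, ?_, hcirc⟩
        have hnl' : M✶.IsNonloop e := by
          refine ⟨?_, heE⟩
          rw [dual_isLoop_iff_isColoop]
          exact hcirc.not_isColoop_of_mem (by simp)
        rw [isCocircuit_def, ← hnl'.closure_eq_closure_iff_isCircuit_of_ne heg]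
        exact hnl'.closure_eq_of_mem_closure hcl
      have hgr := hT.ground_eq
      have hcard : M.E.ncard = (M ＼ {e, g}).E.ncard + 2 := by
        conv_lhs => rw [hgr]
        rw [Set.ncard_insert_of_notMem (by simp [heg]), Set.ncard_insert_of_notMem (by simp)]
      have hrk := hT.natRank
      have hsp : (M ＼ {e, g}).SPReducible := by
        rw [← hT.contract_delete]
        exact hc.delete _
      have := ih _ (by omega) hsp (hs.delete _) (by omega) rfl
      rw [hT.triangles_eq hs, hgr]
      exact .step this ⟨hf, by simp [hfe, hfg]⟩ (by simp) (by simp) heg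

/-- Reducible simple matroids of rank `k` on `2 k - 1` elements correspond to hypertrees. -/
theorem ncard_spReducible_eq_ncard_hyperTree {V : Type*} [Finite V] {k : ℕ} (hk : 1 ≤ k)
    (hV : Nat.card V = 2 * k - 1) :
    {M : Matroid V | M.E = Set.univ ∧ M.IsSimpleMatroid ∧ M.SPReducible ∧ M.eRank = k}.ncard =
      {T : Set (Set V) | HyperTree Set.univ T}.ncard := by
  refine Set.ncard_congr (fun M _ => M.triangles) ?_ ?_ ?_
  · rintro M ⟨hE, hs, hM, hr⟩
    rw [← natRank_eq_iff] at hr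
    have := hM.hyperTree_triangles (isSimpleMatroid_iff_pairwiseIndep.1 hs)
      (by rw [hE, Set.ncard_univ]; omega)
    rwa [hE] at this
  · rintro M N ⟨hE, hs, hM, hr⟩ ⟨hE', hs', hN, hr'⟩ heq
    rw [← natRank_eq_iff] at hr hr'
    have hT := hM.hyperTree_triangles (isSimpleMatroid_iff_pairwiseIndep.1 hs)
      (by rw [hE, Set.ncard_univ]; omega)
    have hc := hT.ncard_eq
    rw [hE, Set.ncard_univ] at hc
    refine eq_of_hyperTree hT rfl (fun t ht => ht.1) (by omega) (hE'.trans hE.symm) ?_ (by omega)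
    intro t ht
    rw [heq] at ht
    exact ht.1
  · intro T hT
    obtain ⟨M, h1, h2, h3, h4, h5⟩ := exists_of_hyperTree hT
    refine ⟨M, ⟨h3, isSimpleMatroid_iff_pairwiseIndep.2 h2, h1, ?_⟩, h5⟩
    rw [← natRank_eq_iff, h4]
    have hc := HyperTree.ncard_eq hT
    rw [Set.ncard_univ] at hc
    omega

end Matroid

namespace Matroid

variable {α β : Type*} {M N : Matroid α} {e f g h x y z : α}

/-! ### Connected components -/

/-- Take a counterexample with the smallest union, and a common element y. Strong elimination of y
gives circuits A through `x` and B through `z`, both avoiding y. Minimality for the pair C, B forces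
B to contain D \ C, so A meets B; then A, B is a counterexample with a smaller union. -/
theorem IsCircuit.exists_mem_mem_of_inter_nonempty [Finite α] {C D : Set α} (hC : M.IsCircuit C)
    (hD : M.IsCircuit D) (hx : x ∈ C) (hz : z ∈ D) (hCD : (C ∩ D).Nonempty) :
    ∃ A, M.IsCircuit A ∧ x ∈ A ∧ z ∈ A := by
  by_contra hcon
  push Not at hcon
  induction hn : (C ∪ D).ncard using Nat.strong_induction_on generalizing C D with
  | _ n ih =>
    obtain ⟨y, hyC, hyD⟩ := hCD
    have hzC : z ∉ C := hcon C hC hx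
    have hxD : x ∉ D := fun h => hcon D hD h hz
    -- a pair of circuits whose union is no smaller than `C ∪ D`
    have hmin : ∀ A B, M.IsCircuit A → M.IsCircuit B → x ∈ A → z ∈ B → (A ∩ B).Nonempty →
        A ∪ B ⊆ C ∪ D → C ∪ D ⊆ A ∪ B := by
      intro A B hA hB hxA hzB hAB hsub
      by_contra hss
      exact ih _ (hn ▸ Set.ncard_lt_ncard ⟨hsub, hss⟩ (Set.toFinite _)) hA hB hxA hzB hAB rfl
    obtain ⟨A, hAs, hA, hxA⟩ := hC.strong_elimination hD hyC hyD hx hxD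
    obtain ⟨B, hBs, hB, hzB⟩ := hD.strong_elimination hC hyD hyC hz hzC
    have hyA : y ∉ A := fun h => (hAs h).2 rfl
    have hyB : y ∉ B := fun h => (hBs h).2 rfl
    have hmeet : ∀ {P Q R : Set α}, M.IsCircuit P → M.IsCircuit R → R ⊆ (P ∪ Q) \ {y} → y ∈ P →
        ∃ w ∈ R, w ∈ Q ∧ w ∉ P := by
      intro P Q R hP hR hRs hyP
      by_contra hno
      push Not at hno
      have hRP : R ⊆ P := fun w hw => (hRs hw).1.elim id fun h => hno w hw h
      have := hR.eq_of_subset_isCircuit hP hRP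
      exact (hRs (this ▸ hyP)).2 rfl
    obtain ⟨a, haA, haD, haC⟩ := hmeet hC hA hAs hyC
    obtain ⟨b, hbB, hbC, hbD⟩ := hmeet hD hB hBs hyD
    have hsubB : B ⊆ C ∪ D := fun w hw => (hBs hw).1.symm
    have hCB := hmin C B hC hB hx hzB ⟨b, hbC, hbB⟩ (Set.union_subset Set.subset_union_left hsubB)
    have haB : a ∈ B := (hCB (Or.inr haD)).resolve_left haC
    have := hmin A B hA hB hxA hzB ⟨a, haA, haB⟩
      (Set.union_subset (fun w hw => (hAs hw).1) hsubB) (Or.inl hyC)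
    exact this.elim hyA hyB

theorem mem_connectedComponent : f ∈ M.connectedComponent e ↔
    f ∈ M.E ∧ (f = e ∨ ∃ C, M.IsCircuit C ∧ e ∈ C ∧ f ∈ C) := Iff.rfl

theorem mem_connectedComponent_self (he : e ∈ M.E) : e ∈ M.connectedComponent e :=
  ⟨he, Or.inl rfl⟩

theorem IsCircuit.mem_connectedComponent {C : Set α} (hC : M.IsCircuit C) (he : e ∈ C)
    (hf : f ∈ C) : f ∈ M.connectedComponent e :=
  ⟨hC.subset_ground hf, Or.inr ⟨C, hC, he, hf⟩⟩

theorem mem_connectedComponent_symm (he : e ∈ M.E) (h : f ∈ M.connectedComponent e) :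
    e ∈ M.connectedComponent f := by
  obtain ⟨-, rfl | ⟨C, hC, h1, h2⟩⟩ := h
  · exact mem_connectedComponent_self he
  · exact hC.mem_connectedComponent h2 h1

theorem mem_connectedComponent_trans [Finite α] (h1 : f ∈ M.connectedComponent e)
    (h2 : g ∈ M.connectedComponent f) : g ∈ M.connectedComponent e := by
  obtain ⟨-, rfl | ⟨C, hC, he, hf⟩⟩ := h1
  · exact h2
  obtain ⟨hg, rfl | ⟨D, hD, hf', hg'⟩⟩ := h2
  · exact hC.mem_connectedComponent he hf
  obtain ⟨A, hA, heA, hgA⟩ := hC.exists_mem_mem_of_inter_nonempty hD he hg' ⟨f, hf, hf'⟩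
  exact hA.mem_connectedComponent heA hgA

theorem connectedComponent_eq [Finite α] (he : e ∈ M.E) (h : f ∈ M.connectedComponent e) :
    M.connectedComponent f = M.connectedComponent e :=
  Set.Subset.antisymm (fun _ hg => mem_connectedComponent_trans h hg)
    (fun _ hg => mem_connectedComponent_trans (mem_connectedComponent_symm he h) hg)

theorem connectedComponent_subset_ground : M.connectedComponent e ⊆ M.E := fun _ h => h.1

/-! ### Direct sums -/

/-- Since no circuit crosses between `X` and `Y`, each reduction of the `X` part is also a reduction
of `M`. When `X` is used up, `Y` remains. -/
theorem SPReducible.of_restrict_of_restrict {X Y : Set α} (hX : (M ↾ X).SPReducible)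
    (hY : (M ↾ Y).SPReducible) (hE : M.E = X ∪ Y) (hXY : Disjoint X Y)
    (hC : ∀ C, M.IsCircuit C → C ⊆ X ∨ C ⊆ Y) : M.SPReducible := by
  generalize hN : M ↾ X = N at hX
  induction hX generalizing M X with
  | empty =>
    have : X = ∅ := by rw [← M.restrict_ground_eq (R := X), hN]; rfl
    rw [this, Set.empty_union] at hE
    rwa [← hE, restrict_ground_eq_self] at hY
  | @ext N e Z hZ heZ hcl _ ih =>
    subst hN
    have heX : e ∈ X := closure_subset_ground _ _ hcl
    have heY : e ∉ Y := fun h => hXY.ne_of_mem heX h rfl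
    have hXE : X ⊆ M.E := hE ▸ Set.subset_union_left
    refine .ext hZ heZ ?_ (ih (M := M ＼ {e}) (X := X \ {e}) ?_ ?_ ?_ ?_ ?_)
    · rw [restrict_closure_eq', Set.sdiff_eq_empty.2 hXE, Set.union_empty] at hcl
      exact M.closure_subset_closure Set.inter_subset_left hcl.1
    · rwa [delete_eq_restrict, restrict_restrict_eq]
      exact Set.subset_sdiff_singleton (hE ▸ Set.subset_union_right) heY
    · rw [delete_ground, hE, Set.union_sdiff_distrib, Set.sdiff_singleton_eq_self heY]
    · exact hXY.mono_left Set.sdiff_subset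
    · intro C hC'
      rw [delete_isCircuit_iff] at hC'
      refine (hC C hC'.1).imp (fun h => ?_) id
      exact Set.subset_sdiff.2 ⟨h, hC'.2⟩
    · rw [delete_eq_restrict, delete_eq_restrict, restrict_restrict_eq _ (Set.sdiff_subset_sdiff_left hXE),
        restrict_ground_eq, restrict_restrict_eq _ Set.sdiff_subset]
  | @coext N e Z hZ heZ hcl _ ih =>
    subst hN
    have heX : e ∈ X := closure_subset_ground _ _ hcl
    have heY : e ∉ Y := fun h => hXY.ne_of_mem heX h rfl
    have hXE : X ⊆ M.E := hE ▸ Set.subset_union_left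
    have hYE : Y ⊆ M.E := hE ▸ Set.subset_union_right
    have hcl' := (dual_mem_closure_iff (M := M ↾ X) heX heZ).1 hcl
    have hcl2 : e ∉ M.closure (M.E \ insert e Z) := by
      intro hmem
      obtain ⟨C, hCs, hCc, heC⟩ := exists_isCircuit_of_mem_closure hmem (by simp)
      have hCX : C ⊆ X := (hC C hCc).resolve_right fun h => heY (h heC)
      refine hcl' ?_
      rw [restrict_closure_eq']
      refine Or.inl ⟨?_, heX⟩
      refine M.closure_subset_closure ?_ (hCc.mem_closure_sdiff_singleton_of_mem heC)
      rintro w ⟨hw, hwe⟩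
      have h1 := (hCs hw).resolve_left hwe
      exact ⟨⟨hCX hw, h1.2⟩, hCX hw⟩
    have hnl : M.IsNonloop e := isNonloop_of_notMem_closure hcl2 (hXE heX)
    refine .coext hZ heZ ((dual_mem_closure_iff (hXE heX) heZ).2 hcl2)
      (ih (M := M ／ {e}) (X := X \ {e}) ?_ ?_ ?_ ?_ ?_)
    · convert hY using 1
      refine ext_indep rfl fun I hI => ?_
      have hI' : I ⊆ Y := hI
      have heI : e ∉ I := fun h => heY (hI' h)
      simp only [restrict_indep_iff, hnl.contractElem_indep_iff, heI, not_false_eq_true, true_and,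
        hI', and_true]
      refine ⟨fun h => h.subset (Set.subset_insert _ _), fun h => ?_⟩
      rw [h.insert_indep_iff_of_notMem heI]
      refine ⟨hXE heX, fun hmem => ?_⟩
      obtain ⟨C, hCs, hCc, heC⟩ := exists_isCircuit_of_mem_closure hmem heI
      rcases hC C hCc with h1 | h1
      · have : C ⊆ {e} := fun w hw => by
          rcases hCs hw with h2 | h2
          · exact h2
          · exact absurd rfl (hXY.ne_of_mem (h1 hw) (hI' h2))
        exact hCc.not_indep (hnl.indep.subset this)
      · exact heY (h1 heC)
    · rw [contract_ground, hE, Set.union_sdiff_distrib, Set.sdiff_singleton_eq_self heY]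
    · exact hXY.mono_left Set.sdiff_subset
    · intro C hC'
      obtain ⟨D, hD, hCD, -⟩ := hC'.exists_subset_isCircuit_of_contract
      refine (hC D hD).imp (fun h => ?_) (fun h => hCD.trans h)
      exact Set.subset_sdiff.2 ⟨hCD.trans h, (Set.subset_sdiff.1 hC'.subset_ground).2⟩
    · rw [restrict_contract_eq_contract_restrict _ (Set.singleton_subset_iff.2 heX)]

/-! ### Quasi series-parallel matroids are the reducible ones -/

theorem IsSeriesParallel.spReducible (h : M.IsSeriesParallel) : M.SPReducible := by
  have pair : ∀ {C : Set α} {e : α}, C.encard = 2 → e ∈ C → ∃ g, g ≠ e ∧ C = {e, g} := by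
    intro C e h2 he
    obtain ⟨a, b, hab, rfl⟩ := Set.encard_eq_two.1 h2
    rcases he with rfl | rfl
    · exact ⟨b, hab.symm, rfl⟩
    · exact ⟨a, hab, Set.pair_comm _ _⟩
  have cl : ∀ {N : Matroid α} {e g : α}, g ≠ e → N.IsCircuit {e, g} → e ∈ N.closure {g} := by
    intro N e g hge hc
    have := hc.mem_closure_sdiff_singleton_of_mem (e := e) (by simp)
    rwa [Set.insert_sdiff_of_mem _ (Set.mem_singleton e),
      Set.sdiff_singleton_eq_self (by simpa using hge.symm)] at this
  induction h with
  | loop e => simpa [freeOn_dual_eq] using (spReducible_freeOn_singleton e).dual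
  | coloop e => exact spReducible_freeOn_singleton e
  | parallel _ h ih =>
    obtain ⟨e, C, hC, h2, he, rfl⟩ := h
    obtain ⟨g, hg, rfl⟩ := pair h2 he
    exact .ext (X := {g}) Set.subsingleton_singleton (by simpa using hg.symm) (cl hg hC) ih
  | series _ h ih =>
    obtain ⟨e, C, hC, h2, he, rfl⟩ := h
    obtain ⟨g, hg, rfl⟩ := pair h2 he
    exact .coext (X := {g}) Set.subsingleton_singleton (by simpa using hg.symm)
      (cl hg hC.isCircuit) ih

/-- Every circuit lies inside the component of `e` or inside its complement, so components can be
split off one at a time as direct summands. -/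
theorem IsQuasiSeriesParallel.spReducible [Finite α] (h : M.IsQuasiSeriesParallel) :
    M.SPReducible := by
  induction hn : M.E.ncard using Nat.strong_induction_on generalizing M with
  | _ n ih =>
    rcases M.E.eq_empty_or_nonempty with hE | ⟨e, he⟩
    · rw [ground_eq_empty_iff.1 hE]; exact .empty
    set X := M.connectedComponent e with hX
    have hXE : X ⊆ M.E := connectedComponent_subset_ground
    have hsub : ∀ C, M.IsCircuit C → C ⊆ X ∨ C ⊆ M.E \ X := by
      intro C hC
      by_cases hCX : Disjoint C X
      · exact Or.inr (Set.subset_sdiff.2 ⟨hC.subset_ground, hCX⟩)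
      · obtain ⟨w, hwC, hwX⟩ := Set.not_disjoint_iff.1 hCX
        exact Or.inl fun z hz => mem_connectedComponent_trans hwX
          (hC.mem_connectedComponent hwC hz)
    refine SPReducible.of_restrict_of_restrict (X := X) (Y := M.E \ X) (h e he).spReducible ?_
      (by rw [Set.union_sdiff_cancel hXE]) Set.disjoint_sdiff_right hsub
    refine ih (M := M ↾ (M.E \ X)) _ ?_ ?_ rfl
    · rw [restrict_ground_eq, ← hn]
      exact Set.ncard_lt_ncard ⟨Set.sdiff_subset, fun h =>
        (h he).2 (mem_connectedComponent_self he)⟩ (Set.toFinite _)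
    · intro f hf
      have hf' : f ∈ M.E \ X := hf
      have hcomp : (M ↾ (M.E \ X)).connectedComponent f = M.connectedComponent f := by
        ext w
        simp only [mem_connectedComponent, restrict_ground_eq,
          restrict_isCircuit_iff (show M.E \ X ⊆ M.E from Set.sdiff_subset)]
        constructor
        · rintro ⟨hw, h | ⟨C, hC, h1, h2⟩⟩
          exacts [⟨hw.1, Or.inl h⟩, ⟨hw.1, Or.inr ⟨C, hC.1, h1, h2⟩⟩]
        · rintro ⟨hw, rfl | ⟨C, hC, h1, h2⟩⟩
          · exact ⟨hf', Or.inl rfl⟩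
          · have hCs : C ⊆ M.E \ X := (hsub C hC).resolve_left fun h => hf'.2 (h h1)
            exact ⟨hCs h2, Or.inr ⟨C, ⟨hC, hCs⟩, h1, h2⟩⟩
      rw [hcomp, restrict_restrict_eq]
      · exact h f hf'.1
      · intro w hw
        have h2 := connectedComponent_subset_ground hw
        exact ⟨h2, fun hwX => hf'.2 (mem_connectedComponent_trans hwX
          (mem_connectedComponent_symm hf'.1 hw))⟩

/-- Removing an element that shares no circuit with others. -/
theorem IsQuasiSeriesParallel.of_delete_separator
    (h : (M ＼ {e}).IsQuasiSeriesParallel) (he : ∀ C, M.IsCircuit C → e ∈ C → C ⊆ {e})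
    (hsp : (M ↾ {e}).IsSeriesParallel) : M.IsQuasiSeriesParallel := by
  intro f hf
  by_cases hfe : f = e
  · subst hfe
    have : M.connectedComponent f = {f} := by
      refine Set.Subset.antisymm ?_ (Set.singleton_subset_iff.2 (mem_connectedComponent_self hf))
      rintro w ⟨-, rfl | ⟨C, hC, h1, h2⟩⟩
      exacts [rfl, he C hC h1 h2]
    rwa [this]
  have hcomp : M.connectedComponent f = (M ＼ {e}).connectedComponent f := by
    ext w
    simp only [mem_connectedComponent, delete_ground, delete_isCircuit_iff]
    constructor
    · rintro ⟨hw, rfl | ⟨C, hC, h1, h2⟩⟩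
      · exact ⟨⟨hw, hfe⟩, Or.inl rfl⟩
      · have heC : e ∉ C := fun h => hfe (he C hC h h1)
        exact ⟨⟨hw, fun h => heC (Set.mem_singleton_iff.1 h ▸ h2)⟩,
          Or.inr ⟨C, ⟨hC, by simpa using heC⟩, h1, h2⟩⟩
    · rintro ⟨hw, h | ⟨C, hC, h1, h2⟩⟩
      exacts [⟨hw.1, Or.inl h⟩, ⟨hw.1, Or.inr ⟨C, hC.1, h1, h2⟩⟩]
  have := h f ⟨hf, hfe⟩
  rw [delete_eq_restrict, restrict_restrict_eq _
    (by rw [← delete_eq_restrict]; exact connectedComponent_subset_ground),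
    ← delete_eq_restrict, ← hcomp] at this
  exact this

/-- Deleting `e` does not split its component, because connections through `e` can pass through its
parallel partner `g`. So that component is a parallel extension and the others do not change. -/
theorem IsQuasiSeriesParallel.of_delete_parallel [Finite α] (hc : M.IsCircuit {e, g}) (heg : e ≠ g)
    (h : (M ＼ {e}).IsQuasiSeriesParallel) : M.IsQuasiSeriesParallel := by
  suffices key : ∀ f ∈ M.E, f ≠ e → (M ↾ M.connectedComponent f).IsSeriesParallel by
    intro f hf
    by_cases hfe : f = e
    · subst hfe
      rw [← connectedComponent_eq hf (hc.mem_connectedComponent (f := g) (by simp) (by simp))]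
      exact key g (hc.subset_ground (by simp)) heg.symm
    · exact key f hf hfe
  intro f hf hfe
  -- circuits through `e` can be rerouted through `g`
  have reroute : ∀ C, M.IsCircuit C → e ∈ C → ∀ w ∈ C, w ≠ e →
      w ∈ (M ＼ {e}).connectedComponent g := by
    intro C hC heC w hw hwe
    by_cases hwg : w = g
    · subst hwg
      exact mem_connectedComponent_self ⟨hC.subset_ground hw, hwe⟩
    obtain ⟨D, hDs, hD, hwD⟩ := hC.strong_elimination hc heC (by simp) hw (by simp [hwe, hwg])
    have heD : e ∉ D := fun h => (hDs h).2 rfl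
    have hD' : (M ＼ {e}).IsCircuit D := by
      rw [delete_isCircuit_iff]; exact ⟨hD, by simpa using heD⟩
    have hgD : g ∈ D := by
      by_contra hgD
      have : D ⊆ C := fun z hz => (hDs hz).1.elim id fun h => by
        rcases h with rfl | rfl
        exacts [absurd hz heD, absurd hz hgD]
      exact heD (hD.eq_of_subset_isCircuit hC this ▸ heC)
    exact hD'.mem_connectedComponent hgD hwD
  have hgE : g ∈ (M ＼ {e}).E := ⟨hc.subset_ground (by simp), heg.symm⟩
  have hcomp : (M ＼ {e}).connectedComponent f = M.connectedComponent f \ {e} := by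
    ext w
    constructor
    · rintro ⟨hw, h | ⟨C, hC, h1, h2⟩⟩
      · exact ⟨⟨hw.1, Or.inl h⟩, hw.2⟩
      · exact ⟨hC.of_delete.mem_connectedComponent h1 h2, hw.2⟩
    · rintro ⟨⟨hw, rfl | ⟨C, hC, h1, h2⟩⟩, hwe⟩
      · exact mem_connectedComponent_self ⟨hf, hfe⟩
      · by_cases heC : e ∈ C
        · exact mem_connectedComponent_trans
            (mem_connectedComponent_symm hgE (reroute C hC heC f h1 hfe)) (reroute C hC heC w h2 hwe)
        · have : (M ＼ {e}).IsCircuit C := by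
            rw [delete_isCircuit_iff]; exact ⟨hC, by simpa using heC⟩
          exact this.mem_connectedComponent h1 h2
  have hK := h f ⟨hf, hfe⟩
  rw [hcomp, delete_eq_restrict, restrict_restrict_eq _
    (Set.sdiff_subset_sdiff_left connectedComponent_subset_ground)] at hK
  by_cases heK : e ∈ M.connectedComponent f
  · have hgK : g ∈ M.connectedComponent f :=
      mem_connectedComponent_trans heK (hc.mem_connectedComponent (by simp) (by simp))
    refine .parallel hK ⟨e, {e, g}, ?_, Set.encard_pair heg, by simp, ?_⟩
    · rw [restrict_isCircuit_iff connectedComponent_subset_ground]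
      exact ⟨hc, Set.pair_subset heK hgK⟩
    · rw [delete_eq_restrict, restrict_ground_eq, restrict_restrict_eq _ Set.sdiff_subset]
  · rwa [Set.sdiff_singleton_eq_self heK] at hK

/-- Every circuit through `e` contains `g` as well, so contracting `e` merely removes it from its
component. That component is a series extension and the others do not change. -/
theorem IsQuasiSeriesParallel.of_contract_series [Finite α] (hc : M.IsCocircuit {e, g})
    (heg : e ≠ g) (h : (M ／ {e}).IsQuasiSeriesParallel) : M.IsQuasiSeriesParallel := by
  have heE : e ∈ M.E := hc.subset_ground (by simp)
  have hnl : M.IsNonloop e := hc.isNonloop_of_mem (by simp)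
  have hiff : ∀ {C}, M.IsCircuit C → (e ∈ C ↔ g ∈ C) := fun hC => hC.mem_iff_of_isCocircuit_pair hc
  have hcirc : ∃ C, M.IsCircuit C ∧ e ∈ C := by
    refine exists_mem_isCircuit_of_not_isColoop heE ?_
    rw [← dual_isLoop_iff_isColoop]
    exact (hc.isCircuit.isNonloop_of_mem ⟨e, by simp, g, by simp, heg⟩ (by simp)).not_isLoop
  suffices key : ∀ f ∈ M.E, f ≠ e → (M ↾ M.connectedComponent f).IsSeriesParallel by
    intro f hf
    by_cases hfe : f = e
    · subst hfe
      obtain ⟨C, hC, hfC⟩ := hcirc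
      rw [← connectedComponent_eq hf (hC.mem_connectedComponent hfC ((hiff hC).1 hfC))]
      exact key g (hc.subset_ground (by simp)) heg.symm
    · exact key f hf hfe
  intro f hf hfe
  have hcomp : (M ／ {e}).connectedComponent f = M.connectedComponent f \ {e} := by
    ext w
    constructor
    · rintro ⟨hw, h | ⟨C, hC, h1, h2⟩⟩
      · exact ⟨⟨hw.1, Or.inl h⟩, hw.2⟩
      · obtain ⟨D, hD, hCD, -⟩ := hC.exists_subset_isCircuit_of_contract
        exact ⟨hD.mem_connectedComponent (hCD h1) (hCD h2), hw.2⟩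
    · rintro ⟨⟨hw, rfl | ⟨C, hC, h1, h2⟩⟩, hwe⟩
      · exact mem_connectedComponent_self ⟨hf, hfe⟩
      · by_cases heC : e ∈ C
        · have := hC.contractElem_isCircuit ⟨e, heC, f, h1, Ne.symm hfe⟩ heC
          exact this.mem_connectedComponent ⟨h1, hfe⟩ ⟨h2, hwe⟩
        -- A circuit avoiding `e` also avoids `g`, and so remains a circuit after the contraction: a
        -- smaller one could only come from a circuit through `e`, which would contain `g`.
        · have hd := hC.contract_dep (C := {e}) (by simpa using heC)
          obtain ⟨D, hDs, hD⟩ := hd.exists_isCircuit_subset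
          obtain ⟨D', hD', h3, h4⟩ := hD.exists_subset_isCircuit_of_contract
          have heD : e ∉ D' := by
            intro heD
            rcases h4 ((hiff hD').1 heD) with h5 | h5
            · exact heC ((hiff hC).2 (hDs h5))
            · exact heg h5.symm
          have hD'C : D' ⊆ C := fun z hz => by
            rcases h4 hz with h5 | h5
            · exact hDs h5
            · exact absurd (Set.mem_singleton_iff.1 h5 ▸ hz) heD
          have hDC : D = C := by
            refine hDs.antisymm ?_
            rw [← hD'.eq_of_subset_isCircuit hC hD'C]
            intro z hz
            exact (h4 hz).elim id fun h5 => absurd (Set.mem_singleton_iff.1 h5 ▸ hz) heD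
          subst hDC
          exact hD.mem_connectedComponent h1 h2
  have hK := h f ⟨hf, hfe⟩
  rw [hcomp] at hK
  by_cases heK : e ∈ M.connectedComponent f
  · obtain ⟨C, hC, heC⟩ := hcirc
    have hCK : C ⊆ M.connectedComponent f := fun z hz =>
      mem_connectedComponent_trans heK (hC.mem_connectedComponent heC hz)
    have hgK := hCK ((hiff hC).1 heC)
    have hC' : (M ↾ M.connectedComponent f).IsCircuit C := by
      rw [restrict_isCircuit_iff connectedComponent_subset_ground]
      exact ⟨hC, hCK⟩
    refine .series hK ⟨e, {e, g}, ?_, Set.encard_pair heg, by simp, ?_⟩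
    · have hnl' : (M ↾ M.connectedComponent f)✶.IsNonloop e := by
        refine ⟨?_, heK⟩
        rw [dual_isLoop_iff_isColoop]
        exact hC'.not_isColoop_of_mem heC
      rw [isCocircuit_def, ← hnl'.closure_eq_closure_iff_isCircuit_of_ne heg]
      refine hnl'.closure_eq_of_mem_closure ?_
      rw [dual_mem_closure_iff (by exact heK) (by simpa using heg)]
      intro hmem
      obtain ⟨D, hDs, hD, heD⟩ := exists_isCircuit_of_mem_closure hmem (by simp)
      rw [restrict_isCircuit_iff connectedComponent_subset_ground] at hD
      rcases hDs ((hiff hD.1).1 heD) with h5 | h5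
      · exact heg h5.symm
      · exact h5.2 (by simp)
    · rw [restrict_contract_eq_contract_restrict _ (Set.singleton_subset_iff.2 heK)]
  · have hgK : g ∉ M.connectedComponent f := by
      rintro ⟨-, rfl | ⟨C, hC, h1, h2⟩⟩
      · obtain ⟨C, hC, heC⟩ := hcirc
        exact heK (hC.mem_connectedComponent ((hiff hC).1 heC) heC)
      · exact heK (hC.mem_connectedComponent h1 ((hiff hC).2 h2))
    rw [Set.sdiff_singleton_eq_self heK] at hK
    convert hK using 1
    refine ext_indep rfl fun I hI => ?_
    have hI' : I ⊆ M.connectedComponent f := hI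
    have heI : e ∉ I := fun h => heK (hI' h)
    simp only [restrict_indep_iff, hnl.contractElem_indep_iff, heI, not_false_eq_true, true_and,
      hI', and_true]
    refine ⟨fun h => ?_, fun h => h.subset (Set.subset_insert _ _)⟩
    rw [h.insert_indep_iff_of_notMem heI]
    refine ⟨heE, fun hmem => ?_⟩
    obtain ⟨C, hCs, hCc, heC⟩ := exists_isCircuit_of_mem_closure hmem heI
    rcases hCs ((hiff hCc).1 heC) with h5 | h5
    · exact heg h5.symm
    · exact hgK (hI' h5)

theorem SPReducible.isQuasiSeriesParallel [Finite α] (h : M.SPReducible) :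
    M.IsQuasiSeriesParallel := by
  induction h with
  | empty => intro e he; simp at he
  | @ext M e X hX heX hcl _ ih =>
    have heE := M.closure_subset_ground _ hcl
    by_cases hl : M.IsLoop e
    · refine ih.of_delete_separator (fun C hC heC => (hl.eq_of_isCircuit_mem hC heC).le) ?_
      rw [restrict_subset_loops_eq (Set.singleton_subset_iff.2 hl)]
      exact .loop e
    · have hnl : M.IsNonloop e := ⟨hl, heE⟩
      rcases hX.eq_empty_or_singleton with rfl | ⟨y, rfl⟩
      · exact absurd hcl hl
      have hey : e ≠ y := by simpa using heX
      exact ih.of_delete_parallel ((hnl.closure_eq_closure_iff_isCircuit_of_ne hey).1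
        (hnl.closure_eq_of_mem_closure hcl)) hey
  | @coext M e X hX heX hcl _ ih =>
    have heE := M✶.closure_subset_ground _ hcl
    by_cases hl : M✶.IsLoop e
    · have hco : M.IsColoop e := hl
      rw [contract_eq_delete_of_subset_coloops (Set.singleton_subset_iff.2 hco)] at ih
      refine ih.of_delete_separator (fun C hC heC => absurd heC (hco.notMem_isCircuit hC)) ?_
      have : M ↾ {e} = freeOn {e} := by
        rw [eq_freeOn_iff]
        exact ⟨rfl, by rw [restrict_indep_iff]; exact ⟨hco.isNonloop.indep, le_rfl⟩⟩
      rw [this]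
      exact .coloop e
    · have hnl : M✶.IsNonloop e := ⟨hl, heE⟩
      rcases hX.eq_empty_or_singleton with rfl | ⟨y, rfl⟩
      · exact absurd hcl hl
      have hey : e ≠ y := by simpa using heX
      exact ih.of_contract_series ((hnl.closure_eq_closure_iff_isCircuit_of_ne hey).1
        (hnl.closure_eq_of_mem_closure hcl)) hey

theorem isQuasiSeriesParallel_iff [Finite α] : M.IsQuasiSeriesParallel ↔ M.SPReducible :=
  ⟨fun h => h.spReducible, fun h => h.isQuasiSeriesParallel⟩

end Matroid

/-! ### Counting labelled reducible matroids: duality and relabelling. -/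

namespace Matroid

variable {α β : Type*} {M N : Matroid α} {e f g h x y z : α}

instance finite_matroid [Finite α] : Finite (Matroid α) := by
  refine Finite.of_injective (fun M : Matroid α => (M.E, {I | M.Indep I})) fun M N h => ?_
  simp only [Prod.mk.injEq] at h
  exact ext_indep h.1 fun I _ => Set.ext_iff.1 h.2 I

/-- Reducible matroids of rank `r` with ground set `E`. -/
def reducibleSet (E : Set α) (r : ℕ) : Set (Matroid α) :=
  {M | M.E = E ∧ M.SPReducible ∧ M.natRank = r}

/-- Simple reducible matroids of rank `r` with ground set `E`. -/
def simpleReducibleSet (E : Set α) (r : ℕ) : Set (Matroid α) :=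
  {M | M ∈ reducibleSet E r ∧ M.PairwiseIndep M.E}

theorem simpleQuasiSeriesParallel_eq (n r : ℕ) :
    simpleQuasiSeriesParallel n r = simpleReducibleSet (Set.univ : Set (Fin n)) r := by
  ext M
  simp only [simpleQuasiSeriesParallel, simpleReducibleSet, reducibleSet, Set.mem_ofPred,
    isQuasiSeriesParallel_iff, isSimpleMatroid_iff_pairwiseIndep, natRank_eq_iff]
  tauto

theorem ncard_reducibleSet_dual [Finite α] {r s : ℕ} (h : r + s = Nat.card α) :
    (reducibleSet (Set.univ : Set α) r).ncard = (reducibleSet (Set.univ : Set α) s).ncard := by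
  have key : ∀ {r s : ℕ}, r + s = Nat.card α → ∀ M ∈ reducibleSet (Set.univ : Set α) r,
      M✶ ∈ reducibleSet (Set.univ : Set α) s := by
    rintro r s h M ⟨hE, hM, hr⟩
    refine ⟨hE, hM.dual, ?_⟩
    have := M.eRank_add_eRank_dual
    rw [hE, Set.encard_univ, ENat.card_eq_coe_natCard, ← natRank_cast, ← natRank_cast] at this
    have : M.natRank + M✶.natRank = Nat.card α := by exact_mod_cast this
    omega
  refine Set.ncard_congr (fun M _ => M✶) (key h) ?_ ?_
  · intro M N _ _ h
    exact dual_inj.1 h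
  · intro M hM
    exact ⟨M✶, key (by omega) M hM, dual_dual M⟩

theorem natRank_comapOn [Finite α] [Finite β] {M : Matroid β} {E : Set α} {f : α → β}
    (h : M.E ⊆ f '' E) : (M.comapOn E f).natRank = M.natRank := by
  rw [natRank, natRank, comapOn, eRank_restrict, eRk_comap, eRk_eq_eRank h]

theorem comapOn_univ (M : Matroid β) (f : α → β) (h : Set.range f = M.E) :
    M.comapOn Set.univ f = M.comap f := by
  rw [← comapOn_preimage_eq, ← h, Set.preimage_range]

theorem SPReducible.of_comap [Finite α] [Finite β] {M : Matroid β} {f : α → β}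
    (hf : f.Injective) (hE : M.E = Set.range f) (h : (M.comap f).SPReducible) :
    M.SPReducible := by
  rcases isEmpty_or_nonempty α with hα | hα
  · rw [Set.range_eq_empty, ground_eq_empty_iff] at hE
    rw [hE]; exact .empty
  · have : M = (M.comap f).comapOn (Set.range f) (Function.invFun f) := by
      refine ext_indep hE fun I hI => ?_
      rw [hE] at hI
      have himg : f '' (Function.invFun f '' I) = I := by
        ext z
        simp only [Set.mem_image, exists_exists_and_eq_and]
        constructor
        · rintro ⟨a, ha, rfl⟩
          obtain ⟨b, rfl⟩ := hI ha
          rwa [Function.leftInverse_invFun hf b]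
        · intro hz
          obtain ⟨b, rfl⟩ := hI hz
          exact ⟨f b, hz, by rw [Function.leftInverse_invFun hf b]⟩
      have hinj : Set.InjOn (Function.invFun f) I := by
        intro a ha b hb hab
        obtain ⟨a, rfl⟩ := hI ha
        obtain ⟨b, rfl⟩ := hI hb
        rw [Function.leftInverse_invFun hf, Function.leftInverse_invFun hf] at hab
        rw [hab]
      rw [comapOn_indep_iff, comap_indep_iff, himg]
      simp [hinj, hI, hf.injOn]
    rw [this]
    exact h.comapOn _ _

theorem bijOn_comap_reducibleSet [Finite α] [Finite β] {f : α → β} (hf : f.Injective) (r : ℕ) :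
    Set.BijOn (fun M : Matroid β => M.comap f) (reducibleSet (Set.range f) r)
      (reducibleSet Set.univ r) := by
  refine ⟨?_, ?_, ?_⟩
  · rintro M ⟨hE, hM, hr⟩
    refine ⟨by simp [hE], ?_, ?_⟩
    · dsimp only
      rw [← comapOn_univ M f hE.symm]
      exact hM.comapOn _ _
    · dsimp only
      rw [← comapOn_univ M f hE.symm, natRank_comapOn (by simp [hE]), hr]
  · rintro M ⟨hE, -⟩ N ⟨hE', -⟩ h
    have hM := map_comap (N := M) hE.le hf.injOn
    have hN := map_comap (N := N) hE'.le hf.injOn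
    rw [← hM, ← hN]
    congr 1
  · rintro N ⟨hE, hN, hr⟩
    have hc : (N.map f hf.injOn).comap f = N := comap_map hf
    have hE' : (N.map f hf.injOn).E = Set.range f := by simp [hE]
    refine ⟨N.map f hf.injOn, ⟨hE', .of_comap hf hE' (by rwa [hc]), ?_⟩, hc⟩
    rw [natRank, eRank_map]; exact hr

theorem pairwiseIndep_comap_iff {M : Matroid β} {f : α → β} (hf : f.Injective)
    (hE : M.E = Set.range f) :
    (M.comap f).PairwiseIndep (M.comap f).E ↔ M.PairwiseIndep M.E := by
  simp only [PairwiseIndep, comap_ground_eq, hE, Set.preimage_range, Set.mem_univ, comap_indep_iff,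
    Set.image_pair, hf.injOn, and_true, forall_const, Set.forall_mem_range]

theorem ncard_reducibleSet_range [Finite α] [Finite β] {f : α → β} (hf : f.Injective) (r : ℕ) :
    (reducibleSet (Set.range f) r).ncard = (reducibleSet (Set.univ : Set α) r).ncard := by
  rw [← (bijOn_comap_reducibleSet hf r).image_eq,
    (bijOn_comap_reducibleSet hf r).injOn.ncard_image]

theorem ncard_simpleReducibleSet_range [Finite α] [Finite β] {f : α → β} (hf : f.Injective)
    (r : ℕ) : (simpleReducibleSet (Set.range f) r).ncard =
      (simpleReducibleSet (Set.univ : Set α) r).ncard := by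
  have hb := bijOn_comap_reducibleSet hf r
  have : simpleReducibleSet (Set.univ : Set α) r =
      (fun M : Matroid β => M.comap f) '' (simpleReducibleSet (Set.range f) r) := by
    ext N
    constructor
    · rintro ⟨hN, hs⟩
      obtain ⟨M, hM, rfl⟩ := hb.surjOn hN
      exact ⟨M, ⟨hM, (pairwiseIndep_comap_iff hf hM.1).1 hs⟩, rfl⟩
    · rintro ⟨M, ⟨hM, hs⟩, rfl⟩
      exact ⟨hb.mapsTo hM, (pairwiseIndep_comap_iff hf hM.1).2 hs⟩
  rw [this, (hb.injOn.mono fun M hM => hM.1).ncard_image]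

/-! ### Simplification -/

/-- Elements are equivalent when they span the same flat. -/
def spanSetoid (M : Matroid α) : Setoid α := Setoid.ker fun i => M.closure {i}

theorem spanSetoid_iff : M.spanSetoid x y ↔ M.closure {x} = M.closure {y} := Iff.rfl

/-- Replacing elements by others with the same span preserves the rank, so independence can only be
lost by a collision. -/
theorem indep_iff_indep_image_of_closure_eq [Finite α] {φ : α → α} {I : Set α} (hI : I ⊆ M.E)
    (hφI : φ '' I ⊆ M.E) (h : ∀ i ∈ I, M.closure {φ i} = M.closure {i}) :
    M.Indep I ↔ M.Indep (φ '' I) ∧ Set.InjOn φ I := by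
  have h1 : M.eRk (φ '' I) = M.eRk I := by
    refine le_antisymm ?_ ?_
    · rw [← M.eRk_closure_eq I]
      refine M.eRk_mono ?_
      rintro _ ⟨i, hi, rfl⟩
      have := M.mem_closure_self (φ i) (hφI ⟨i, hi, rfl⟩)
      rw [h i hi] at this
      exact M.closure_subset_closure (by simpa using hi) this
    · rw [← M.eRk_closure_eq (φ '' I)]
      refine M.eRk_mono ?_
      intro i hi
      have := M.mem_closure_self i (hI hi)
      rw [← h i hi] at this
      exact M.closure_subset_closure (by simpa using ⟨i, hi, rfl⟩) this
  rw [indep_iff_eRk_eq_encard_of_finite (Set.toFinite _),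
    indep_iff_eRk_eq_encard_of_finite (Set.toFinite _), h1]
  constructor
  · intro h2
    have h3 : (φ '' I).encard = I.encard := by
      refine le_antisymm (Set.encard_image_le φ I) ?_
      rw [← h2, ← h1]
      exact M.eRk_le_encard _
    exact ⟨by rw [h3, h2], (Set.toFinite I).injOn_of_encard_image_eq h3⟩
  · rintro ⟨h2, h3⟩
    rw [h2, h3.encard_image]

section fiber

variable {V : Type*} {v₀ : V} {π : Setoid V} {r : ℕ}

/-- The extra point `v₀` marks loops: its class lies outside the ground set of `S`, so every other
member of that class pulls back to a loop. The remaining classes become the parallel classes. -/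
theorem closure_comapOn_mk {S : Matroid (Quotient π)} (hE : S.E = {(⟦v₀⟧ : Quotient π)}ᶜ)
    (hS : S.PairwiseIndep S.E) (i : V) :
    (S.comapOn {v₀}ᶜ (Quotient.mk π)).closure {i} =
      {j | j ≠ v₀ ∧ ((⟦j⟧ : Quotient π) = ⟦i⟧ ∨ (⟦j⟧ : Quotient π) = ⟦v₀⟧)} := by
  have hcl : ∀ a : Quotient π, S.closure {a} = {a} ∩ S.E := by
    intro a
    refine Set.Subset.antisymm (fun b hb => ⟨?_, S.closure_subset_ground _ hb⟩) ?_
    · have hbE := S.closure_subset_ground _ hb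
      have hbn : S.IsNonloop b := by simpa using hS b hbE b hbE
      have haE := (hbn.isNonloop_of_mem_closure hb).mem_ground
      by_contra hne
      exact ((hbn.closure_eq_closure_iff_isCircuit_of_ne hne).1
        (hbn.closure_eq_of_mem_closure hb)).not_indep (hS b hbE a haE)
    · rw [← S.closure_inter_ground]
      exact S.subset_closure _
  have hcl0 : S.closure ∅ = ∅ := by
    have := hcl ⟦v₀⟧
    rw [hE, Set.inter_compl_self] at this
    rw [Set.eq_empty_iff_forall_notMem] at this ⊢
    exact fun b hb => this b (S.closure_subset_closure (Set.empty_subset _) hb)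
  ext j
  rw [mem_closure_comapOn]
  by_cases hi : i = v₀
  · subst hi
    simp [hcl0, hE]
  · rw [Set.singleton_inter_of_mem (by simpa using hi), Set.image_singleton, hcl]
    simp only [hE, Set.mem_compl_iff, Set.mem_singleton_iff, Set.mem_inter_iff, Set.mem_ofPred,
      not_not, Ne]
    tauto

theorem comapOn_mk_mem [Finite V] {S : Matroid (Quotient π)}
    (hS : S ∈ simpleReducibleSet {(⟦v₀⟧ : Quotient π)}ᶜ r) :
    S.comapOn {v₀}ᶜ (Quotient.mk π) ∈ reducibleSet {v₀}ᶜ r ∧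
      (S.comapOn {v₀}ᶜ (Quotient.mk π)).spanSetoid = π := by
  obtain ⟨⟨hE, hR, hr⟩, hs⟩ := hS
  refine ⟨⟨rfl, hR.comapOn _ _, ?_⟩, ?_⟩
  · rw [natRank_comapOn, hr]
    rw [hE]
    intro a ha
    obtain ⟨i, rfl⟩ := Quotient.exists_rep a
    exact ⟨i, fun h => ha (by rw [Set.mem_singleton_iff.1 h]; rfl), rfl⟩
  · ext i j
    rw [spanSetoid_iff, closure_comapOn_mk hE hs, closure_comapOn_mk hE hs,
      show π i j ↔ (⟦i⟧ : Quotient π) = ⟦j⟧ from Quotient.eq.symm]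
    constructor
    · intro h
      by_cases hi : (⟦i⟧ : Quotient π) = ⟦v₀⟧
      · by_cases hj : (⟦j⟧ : Quotient π) = ⟦v₀⟧
        · rw [hi, hj]
        · have : j ∈ {k | k ≠ v₀ ∧ ((⟦k⟧ : Quotient π) = ⟦j⟧ ∨ (⟦k⟧ : Quotient π) = ⟦v₀⟧)} :=
            ⟨by rintro rfl; exact hj rfl, Or.inl rfl⟩
          rw [← h] at this
          exact (this.2.resolve_right hj).symm
      · have : i ∈ {k | k ≠ v₀ ∧ ((⟦k⟧ : Quotient π) = ⟦i⟧ ∨ (⟦k⟧ : Quotient π) = ⟦v₀⟧)} :=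
          ⟨by rintro rfl; exact hi rfl, Or.inl rfl⟩
        rw [h] at this
        exact this.2.resolve_right hi
    · intro h
      rw [h]

/-- `S` can be read off from one representative per class, chosen by `Quotient.out`. -/
theorem injOn_comapOn_mk [Finite V] : Set.InjOn
    (fun S : Matroid (Quotient π) => S.comapOn {v₀}ᶜ (Quotient.mk π))
    (simpleReducibleSet {(⟦v₀⟧ : Quotient π)}ᶜ r) := by
  intro S hS S' hS' h
  have hE := hS.1.1
  have hE' := hS'.1.1
  have key : ∀ S : Matroid (Quotient π), ∀ J ⊆ {(⟦v₀⟧ : Quotient π)}ᶜ,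
      (S.Indep J ↔ (S.comapOn {v₀}ᶜ (Quotient.mk π)).Indep (Quotient.out '' J)) := by
    intro S J hJ
    have h1 : Quotient.mk π '' (Quotient.out '' J) = J := by
      rw [Set.image_image]; simp
    have h2 : Set.InjOn (Quotient.mk π) (Quotient.out '' J) := by
      rintro _ ⟨a, -, rfl⟩ _ ⟨b, -, rfl⟩ hab
      rw [show a = b by simpa using hab]
    have h3 : Quotient.out '' J ⊆ {v₀}ᶜ := by
      rintro _ ⟨a, ha, rfl⟩ h
      refine hJ ha ?_
      rw [Set.mem_singleton_iff] at h ⊢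
      rw [← h, Quotient.out_eq]
    rw [comapOn_indep_iff, h1]
    simp [h2, h3]
  refine ext_indep (hE.trans hE'.symm) fun J hJ => ?_
  rw [key S J (hE ▸ hJ), key S' J (hE ▸ hJ)]
  dsimp only at h
  rw [h]

/-- The simplification of `M` is its pullback along a choice of representatives, with the class of
loops left out. -/
theorem exists_comapOn_mk_eq [Finite V] {M : Matroid V} (hM : M ∈ reducibleSet {v₀}ᶜ r)
    (hπ : M.spanSetoid = π) : ∃ S ∈ simpleReducibleSet {(⟦v₀⟧ : Quotient π)}ᶜ r,
      S.comapOn {v₀}ᶜ (Quotient.mk π) = M := by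
  obtain ⟨hE, hR, hr⟩ := hM
  have hcl : ∀ i j : V, (⟦i⟧ : Quotient π) = ⟦j⟧ ↔ M.closure {i} = M.closure {j} := by
    intro i j
    rw [Quotient.eq, ← hπ]; rfl
  have hcl0 : M.closure {v₀} = M.loops := by
    rw [← closure_inter_ground, hE, Set.inter_compl_self]; rfl
  have hloop : ∀ i, i ≠ v₀ → ((⟦i⟧ : Quotient π) ≠ ⟦v₀⟧ ↔ M.IsNonloop i) := by
    intro i hi
    rw [Ne, hcl, hcl0, ← not_isNonloop_iff_closure, not_not]
  have hout : ∀ a : Quotient π, a ≠ ⟦v₀⟧ → a.out ≠ v₀ := by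
    rintro a ha h
    exact ha (by rw [← h, Quotient.out_eq])
  have hnl : ∀ a : Quotient π, a ≠ ⟦v₀⟧ → M.IsNonloop a.out := by
    intro a ha
    rw [← hloop _ (hout a ha), Quotient.out_eq]
    exact ha
  have hspan : ∀ i ∈ M.E, i ∈ M.closure (Quotient.out '' {(⟦v₀⟧ : Quotient π)}ᶜ) := by
    intro i hi
    by_cases h0 : (⟦i⟧ : Quotient π) = ⟦v₀⟧
    · have h1 := M.mem_closure_self i hi
      rw [(hcl _ _).1 h0, hcl0] at h1
      exact M.closure_subset_closure (Set.empty_subset _) h1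
    · have h1 := M.mem_closure_self i hi
      rw [(hcl i (⟦i⟧ : Quotient π).out).1 (by simp)] at h1
      exact M.closure_subset_closure
        (Set.singleton_subset_iff.2 (Set.mem_image_of_mem Quotient.out h0)) h1
  refine ⟨M.comapOn {(⟦v₀⟧ : Quotient π)}ᶜ Quotient.out, ⟨⟨rfl, hR.comapOn _ _, ?_⟩, ?_⟩, ?_⟩
  · rw [← hr, natRank, natRank, comapOn, eRank_restrict, eRk_comap]
    congr 1
    rw [← M.eRk_closure_eq]
    exact eRk_eq_eRank hspan
  · intro a ha b hb
    have ha' : a ≠ ⟦v₀⟧ := ha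
    have hb' : b ≠ ⟦v₀⟧ := hb
    rw [comapOn_indep_iff, Set.image_pair]
    refine ⟨?_, Quotient.out_injective.injOn, Set.pair_subset ha hb⟩
    by_cases hab : a = b
    · subst hab
      simpa using hnl a ha'
    · by_contra hd
      have := ((hnl a ha').closure_eq_closure_iff_eq_or_dep (hnl b hb')).2 (Or.inr hd)
      rw [← hcl, Quotient.out_eq, Quotient.out_eq] at this
      exact hab this
  · refine ext_indep hE.symm fun I hI => ?_
    have hI' : I ⊆ {v₀}ᶜ := hI
    rw [comapOn_indep_iff, comapOn_indep_iff]
    simp only [hI', and_true, Quotient.out_injective.injOn, true_and]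
    by_cases h0 : ∃ i ∈ I, (⟦i⟧ : Quotient π) = ⟦v₀⟧
    · obtain ⟨i, hi, h0⟩ := h0
      refine iff_of_false ?_ ?_
      · rintro ⟨⟨-, h⟩, -⟩
        exact h ⟨i, hi, rfl⟩ h0
      · intro h
        exact (hloop i (hI' hi)).2 (h.isNonloop_of_mem hi) h0
    · push Not at h0
      have h1 : Quotient.mk π '' I ⊆ {(⟦v₀⟧ : Quotient π)}ᶜ := by
        rintro _ ⟨i, hi, rfl⟩
        exact h0 i hi
      have h2 := indep_iff_indep_image_of_closure_eq (M := M) (I := I)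
        (φ := fun i => (⟦i⟧ : Quotient π).out) (by rw [hE]; exact hI') ?_ ?_
      · rw [h2, Set.image_image]
        simp only [h1, and_true]
        refine and_congr_right fun _ => ⟨fun h => ?_, fun h => ?_⟩
        · exact fun a ha b hb hab => h ha hb (Quotient.out_injective hab)
        · exact fun a ha b hb hab => h ha hb (congrArg Quotient.out hab)
      · rintro _ ⟨i, hi, rfl⟩
        rw [hE]
        exact hout _ (h0 i hi)
      · intro i hi
        rw [← hcl, Quotient.out_eq]

theorem ncard_fiber_spanSetoid [Finite V] (v₀ : V) (π : Setoid V) (r : ℕ) :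
    {M | M ∈ reducibleSet {v₀}ᶜ r ∧ M.spanSetoid = π}.ncard =
      (simpleReducibleSet {(⟦v₀⟧ : Quotient π)}ᶜ r).ncard := by
  rw [← (injOn_comapOn_mk (v₀ := v₀)).ncard_image]
  congr 1
  ext M
  constructor
  · rintro ⟨h1, h2⟩
    exact exists_comapOn_mk_eq h1 h2
  · rintro ⟨S, hS, rfl⟩
    exact comapOn_mk_mem hS

theorem ncard_simpleReducibleSet_compl [Finite V] (v : V) (r : ℕ) :
    (simpleReducibleSet {v}ᶜ r).ncard =
      (simpleQuasiSeriesParallel (Nat.card V - 1) r).ncard := by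
  classical
  have := Fintype.ofFinite V
  have hc : Nat.card ({v}ᶜ : Set V) = Nat.card V - 1 := by
    rw [Nat.card_coe_set_eq, Set.ncard_compl, Set.ncard_singleton]
  let e : Fin (Nat.card V - 1) ≃ ({v}ᶜ : Set V) :=
    (finCongr hc.symm).trans (Finite.equivFin _).symm
  have hr : Set.range (fun i => (e i : V)) = {v}ᶜ := by
    ext w
    constructor
    · rintro ⟨i, rfl⟩
      exact (e i).2
    · intro hw
      exact ⟨e.symm ⟨w, hw⟩, by simp⟩
  rw [simpleQuasiSeriesParallel_eq, ← hr]
  exact ncard_simpleReducibleSet_range (Subtype.val_injective.comp e.injective) r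

/-- The number of reducible matroids, sorted by their simplification. -/
theorem sum_ncard_simpleQuasiSeriesParallel (N r : ℕ) [Fintype (Setoid (Fin (N + 1)))] :
    ∑ π : Setoid (Fin (N + 1)), (simpleQuasiSeriesParallel (Nat.card (Quotient π) - 1) r).ncard =
      (reducibleSet (Set.univ : Set (Fin N)) r).ncard := by
  classical
  -- `Fin N` is placed in `Fin (N + 1)` as the complement of `0`, and `0` serves as the marker of
  -- loops.
  rw [← ncard_reducibleSet_range (Fin.succ_injective N) r, Fin.range_succ,
    Set.ncard_eq_toFinset_card _ (Set.toFinite _),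
    Finset.card_eq_sum_card_fiberwise (f := spanSetoid) (t := Finset.univ)
      (fun _ _ => Finset.mem_coe.2 (Finset.mem_univ _))]
  refine Finset.sum_congr rfl fun π _ => ?_
  rw [← ncard_simpleReducibleSet_compl (⟦0⟧ : Quotient π), ← ncard_fiber_spanSetoid,
    Set.ncard_eq_toFinset_card _ (Set.toFinite _)]
  congr 1
  ext M
  simp

end fiber

theorem ncard_simpleQuasiSeriesParallel_eq_zero {N r : ℕ} (hN : 0 < N) (h : 2 * r ≤ N) :
    (simpleQuasiSeriesParallel N r).ncard = 0 := by
  rw [Set.ncard_eq_zero, simpleQuasiSeriesParallel_eq, Set.eq_empty_iff_forall_notMem]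
  rintro M ⟨⟨hE, hM, hr⟩, hs⟩
  have := hM.ncard_add_one_le hs (Set.nonempty_of_ncard_ne_zero (by simp [hE]; omega))
  rw [hE, Set.ncard_univ, Nat.card_fin] at this
  omega

theorem ncard_simpleQuasiSeriesParallel_eq_zero_of_lt {N r : ℕ} (h : N < r) :
    (simpleQuasiSeriesParallel N r).ncard = 0 := by
  rw [Set.ncard_eq_zero, simpleQuasiSeriesParallel_eq, Set.eq_empty_iff_forall_notMem]
  rintro M ⟨⟨hE, hM, hr⟩, hs⟩
  have := M.eRank_le_encard_ground
  rw [hE, Set.encard_univ, ← natRank_cast, hr] at this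
  simp at this
  omega

end Matroid

namespace Matroid

variable {α β : Type*} {M N : Matroid α} {e f g h x y z : α}

/-! ### Kazhdan–Lusztig polynomials of matroids whose flats are set partitions -/

theorem isFlat_contract_iff {F G : Set α} (hF : F ⊆ M.E) :
    (M ／ F).IsFlat G ↔ M.IsFlat (G ∪ F) ∧ Disjoint G F := by
  rw [isFlat_iff_closure_eq, isFlat_iff_closure_eq, contract_closure_eq]
  constructor
  · intro h
    have hd : Disjoint G F := by rw [← h]; exact Set.disjoint_sdiff_left
    refine ⟨?_, hd⟩
    have hsub : F ⊆ M.closure (G ∪ F) := by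
      rw [← closure_inter_ground]
      exact (Set.subset_inter Set.subset_union_right hF).trans
        (M.subset_closure _ Set.inter_subset_right)
    conv_rhs => rw [← h]
    rw [Set.sdiff_union_of_subset hsub]
  · rintro ⟨h, hd⟩
    rw [h, Set.union_sdiff_right, hd.sdiff_eq_left]

/-- Flats of a contraction. -/
def flatsContract {F : Set α} (hF : M.IsFlat F) :
    {G // (M ／ F).IsFlat G} ≃o {H : {H // M.IsFlat H} // ⟨F, hF⟩ ≤ H} where
  toFun G := ⟨⟨G.1 ∪ F, ((isFlat_contract_iff hF.subset_ground).1 G.2).1⟩, Set.subset_union_right⟩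
  invFun H := ⟨H.1.1 \ F, (isFlat_contract_iff hF.subset_ground).2
    ⟨by rw [Set.sdiff_union_of_subset (show F ⊆ H.1.1 from H.2)]; exact H.1.2, Set.disjoint_sdiff_left⟩⟩
  left_inv G := by
    ext1
    have := ((isFlat_contract_iff hF.subset_ground).1 G.2).2
    simp [this.sdiff_eq_left]
  right_inv H := by
    ext1; ext1
    exact Set.sdiff_union_of_subset (show F ⊆ H.1.1 from H.2)
  map_rel_iff' {G H} := by
    have hG := ((isFlat_contract_iff hF.subset_ground).1 G.2).2
    constructor
    · intro h z hz
      exact (h (Or.inl hz) : z ∈ H.1 ∪ F).resolve_right fun hzF => hG.ne_of_mem hz hzF rfl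
    · intro h
      exact Set.union_subset_union_left F h

theorem natRank_restrict_contract (hfin : M.Finite) {F G : Set α} (hF : M.IsFlat F)
    (hG : (M ／ F).IsFlat G) :
    (M ↾ F).natRank + ((M ／ F) ↾ G).natRank = (M ↾ (G ∪ F)).natRank := by
  obtain ⟨h1, h2⟩ := (isFlat_contract_iff hF.subset_ground).1 hG
  have hfin' : (M ↾ (G ∪ F)).Finite := ⟨hfin.ground_finite.subset h1.subset_ground⟩
  have hF' : (M ↾ (G ∪ F)).IsFlat F := by
    rw [isFlat_iff_closure_eq, restrict_closure_eq _ Set.subset_union_right h1.subset_ground, hF.closure]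
    exact Set.inter_eq_self_of_subset_left Set.subset_union_right
  have := natRank_restrict_add_contract hfin' hF'
  rwa [restrict_restrict_eq _ Set.subset_union_right,
    ← contract_restrict_eq_restrict_contract _ h2.symm] at this

/-- Third isomorphism theorem: `Setoid.correspondence r s` is `s` seen on the `r`-classes. -/
theorem card_quotient_correspondence {V : Type*} {r : Setoid V} (s : {s // r ≤ s}) :
    Nat.card (Quotient (Setoid.correspondence r s)) = Nat.card (Quotient s.1) := by
  symm
  refine Nat.card_eq_of_bijective
    (Quotient.map' (s₁ := s.1) (s₂ := Setoid.correspondence r s) (Quotient.mk r) fun _ _ h => h) ⟨?_, ?_⟩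
  · intro a b
    refine Quotient.inductionOn₂' a b fun a b h => ?_
    exact Quotient.sound' (s₁ := s.1) (Quotient.exact h : (Setoid.correspondence r s) _ _)
  · intro a
    obtain ⟨b, rfl⟩ := Quotient.exists_rep a
    obtain ⟨c, rfl⟩ := Quotient.exists_rep b
    exact ⟨Quotient.mk s.1 c, rfl⟩

theorem ncard_simpleQuasiSeriesParallel_zero : (simpleQuasiSeriesParallel 0 0).ncard = 1 := by
  rw [Set.ncard_eq_one]
  refine ⟨emptyOn (Fin 0), ?_⟩
  rw [simpleQuasiSeriesParallel_eq]
  ext M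
  have hE : M.E = ∅ := Set.eq_empty_of_isEmpty _
  rw [ground_eq_empty_iff.1 hE, Set.mem_singleton_iff, iff_true_right rfl]
  refine ⟨⟨(Set.eq_empty_of_isEmpty _).symm, .empty, by simp [natRank]⟩, ?_⟩
  intro x
  exact x.elim0

/-- The discrete partition contributes the simple matroids on all of [N]; the other partitions
correspond to the nonempty flats in the Kazhdan–Lusztig recursion. -/
theorem ncard_reducibleSet_sub_ncard_simple (N r : ℕ) [Fintype (Setoid (Fin (N + 1)))]
    [DecidableEq (Setoid (Fin (N + 1)))] :
    ∑ π : Setoid (Fin (N + 1)) with π ≠ ⊥,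
      ((simpleQuasiSeriesParallel (Nat.card (Quotient π) - 1) r).ncard : ℤ) =
      (reducibleSet (Set.univ : Set (Fin N)) r).ncard - (simpleQuasiSeriesParallel N r).ncard := by
  rw [← sum_ncard_simpleQuasiSeriesParallel, Nat.cast_sum,
    ← Finset.sum_filter_add_sum_filter_not Finset.univ (fun π => π ≠ (⊥ : Setoid (Fin (N + 1))))]
  have h1 : Finset.univ.filter (fun π => ¬ π ≠ (⊥ : Setoid (Fin (N + 1)))) = {⊥} := by
    ext; simp
  have h2 : Nat.card (Quotient (⊥ : Setoid (Fin (N + 1)))) = N + 1 := by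
    have : Function.Bijective (Quotient.mk (⊥ : Setoid (Fin (N + 1)))) :=
      ⟨fun a b h => (Quotient.exact h : (⊥ : Setoid _) a b), Quotient.mk_surjective⟩
    rw [← Nat.card_eq_of_bijective _ this, Nat.card_fin]
  rw [h1, Finset.sum_singleton, h2]
  simp

instance finite_setoid {V : Type*} [Finite V] : Finite (Setoid V) :=
  Finite.of_injective (fun s : Setoid V => (fun u v => s u v : V → V → Prop)) fun s t h => by
    ext u v
    exact iff_of_eq (congrFun (congrFun h u) v)

/-- The coefficients of the Kazhdan–Lusztig polynomial of a matroid whose lattice of flats is the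
lattice of partitions of an `(n + 1)`-element set count simple quasi series-parallel matroids. -/
theorem coeff_klPolynomial_of_flats_orderIso {n : ℕ} {V : Type} [Finite V]
    (hV : Nat.card V = n + 1) {M : Matroid α} (hfin : M.Finite) (hl : M.Loopless)
    (φ : {F // M.IsFlat F} ≃o Setoid V)
    (hφ : ∀ F, (M ↾ F.1).natRank + Nat.card (Quotient (φ F)) = n + 1) (i : ℕ) :
    M.klPolynomial.coeff i =
      if i ≤ n then ((simpleQuasiSeriesParallel n (n - i)).ncard : ℤ) else 0 := by
  classical
  induction n using Nat.strong_induction_on generalizing V M i with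
  | _ n ih =>
  have hVne : Nonempty V := by
    rw [← not_isEmpty_iff]
    intro h
    simp at hV
  have hcardpos : ∀ π : Setoid V, 0 < Nat.card (Quotient π) := fun π => by
    have : Nonempty (Quotient π) := hVne.map (Quotient.mk π)
    exact Nat.card_pos
  have hrank : M.natRank = n := by
    have h1 := hφ ⟨M.E, M.ground_isFlat⟩
    have h2 : φ ⟨M.E, M.ground_isFlat⟩ = ⊤ := by
      rw [eq_top_iff, ← φ.symm_apply_le]
      exact (φ.symm ⊤).2.subset_ground
    have h3 : Nat.card (Quotient (⊤ : Setoid V)) = 1 := by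
      have : Subsingleton (Quotient (⊤ : Setoid V)) := Quotient.subsingleton_iff.2 rfl
      have : Nonempty (Quotient (⊤ : Setoid V)) := hVne.map (Quotient.mk _)
      exact Nat.card_eq_one_iff_unique.2 ⟨inferInstance, inferInstance⟩
    rw [h2, h3, restrict_ground_eq_self] at h1
    omega
  have hempty : φ ⟨∅, isFlat_empty hl⟩ = ⊥ := by
    rw [eq_bot_iff, ← φ.le_symm_apply]
    exact Set.empty_subset _
  rcases Nat.eq_zero_or_pos n with hn0 | hnpos
  · subst hn0
    rw [klPolynomial_of_rank_zero hrank, Polynomial.coeff_one]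
    by_cases hi : i = 0
    · simp [hi, ncard_simpleQuasiSeriesParallel_zero]
    · simp [hi]
  have : Fintype (Setoid V) := Fintype.ofFinite _
  have hQ : ∀ j, j ≤ n → (properSum klPolynomial M).coeff j =
      ∑ π : Setoid V with π ≠ ⊥,
        ((simpleQuasiSeriesParallel (Nat.card (Quotient π) - 1) (n - j)).ncard : ℤ) := by
    intro j hj
    rw [coeff_properSum _ hfin]
    -- The value of `ψ` away from the flats is a dummy and is never used.
    let ψ : Set α → Setoid V := fun F => if h : M.IsFlat F then φ ⟨F, h⟩ else ⊥
    have hψ : ∀ {F} (h : M.IsFlat F), ψ F = φ ⟨F, h⟩ := fun h => dif_pos h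
    have hproper : ∀ {F} (h : M.IsFlat F), (M ／ F).natRank < M.natRank ↔ ψ F ≠ ⊥ := by
      intro F h
      have h1 := natRank_restrict_add_contract hfin h
      have h2 := natRank_restrict_eq_zero_iff hfin hl h
      rw [hψ h, ← hempty, Ne, φ.injective.eq_iff, Subtype.mk_eq_mk, ← h2]
      omega
    have hbij : Set.BijOn ψ {F | M.IsFlat F ∧ (M ／ F).natRank < M.natRank} {π | π ≠ ⊥} := by
      refine ⟨fun F hF => (hproper hF.1).1 hF.2, ?_, ?_⟩
      · rintro F ⟨hF, -⟩ G ⟨hG, -⟩ h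
        rw [hψ hF, hψ hG] at h
        exact congrArg Subtype.val (φ.injective h)
      · intro π hπ
        have h1 : ψ (φ.symm π).1 = π := by rw [hψ (φ.symm π).2]; simp
        refine ⟨(φ.symm π).1, ⟨(φ.symm π).2, (hproper (φ.symm π).2).2 ?_⟩, h1⟩
        rw [h1]
        exact hπ
    rw [finsum_mem_eq_of_bijOn (g := fun π : Setoid V =>
      ((simpleQuasiSeriesParallel (Nat.card (Quotient π) - 1) (n - j)).ncard : ℤ)) ψ hbij]
    · rw [finsum_mem_eq_finite_toFinset_sum _ (Set.toFinite _)]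
      refine Finset.sum_congr ?_ fun _ _ => rfl
      ext; simp
    · rintro F ⟨hF, hlt⟩
      have hr : (M ↾ F).natRank + Nat.card (Quotient (φ ⟨F, hF⟩)) = n + 1 := hφ ⟨F, hF⟩
      have hpos := hcardpos (φ ⟨F, hF⟩)
      have hadd := natRank_restrict_add_contract hfin hF
      rw [hψ hF]
      -- The flats of `M ／ F` form the interval above `F`, which is the partition lattice on the
      -- blocks of `φ F`.
      have hcoeff : ∀ i, (M ／ F).klPolynomial.coeff i = _ :=
        ih (Nat.card (Quotient (φ ⟨F, hF⟩)) - 1) (by omega) (V := Quotient (φ ⟨F, hF⟩))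
          (by omega) (finite_contract hfin F) (loopless_contract hF)
          (((flatsContract hF).trans
            { toEquiv := φ.toEquiv.subtypeEquiv fun H => (φ.le_iff_le).symm
              map_rel_iff' := fun {a b} => φ.le_iff_le }).trans
            (Setoid.correspondence (φ ⟨F, hF⟩))) ?_
      · rw [Polynomial.coeff_X_pow_mul']
        split_ifs with h1
        · rw [hcoeff, if_pos (by omega)]
          congr 3
          omega
        -- Here j is less than the rank of `F`, and correspondingly the rank n - j exceeds the
        -- number of elements, so both sides vanish.
        · rw [ncard_simpleQuasiSeriesParallel_eq_zero_of_lt (by omega), Nat.cast_zero]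
      · intro G
        have h1 := natRank_restrict_contract hfin hF G.2
        have h2 : (M ↾ (G.1 ∪ F)).natRank +
          Nat.card (Quotient (φ ((flatsContract hF) G).1)) = n + 1 := hφ ((flatsContract hF) G).1
        rw [OrderIso.trans_apply, card_quotient_correspondence]
        have h4 : Nat.card (Quotient (φ ((flatsContract hF) G).1)) =
          Nat.card (Quotient (((flatsContract hF).trans
            { toEquiv := φ.toEquiv.subtypeEquiv fun H => (φ.le_iff_le (x := ⟨F, hF⟩)).symm
              map_rel_iff' := fun {a b} => φ.le_iff_le } :
              _ ≃o {s // φ ⟨F, hF⟩ ≤ s}) G).1) := rfl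
        rw [← h4]
        omega
  have hQ' : ∀ j, j ≤ n → (properSum klPolynomial M).coeff j =
      (reducibleSet (Set.univ : Set (Fin n)) (n - j)).ncard -
        (simpleQuasiSeriesParallel n (n - j)).ncard := by
    intro j hj
    rw [hQ j hj]
    have : Fintype (Setoid (Fin (n + 1))) := Fintype.ofFinite _
    rw [← ncard_reducibleSet_sub_ncard_simple]
    let ε : V ≃ Fin (n + 1) := (Finite.equivFin V).trans (finCongr hV)
    refine Finset.sum_bij (fun π _ => π.comap ε.symm) ?_ ?_ ?_ ?_
    · intro π hπ
      simp only [Finset.mem_filter, Finset.mem_univ, true_and] at hπ ⊢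
      intro h
      apply hπ
      ext a b
      have := iff_of_eq (congrArg (fun s : Setoid _ => s (ε a) (ε b)) h)
      simpa [Setoid.comap_rel, Setoid.bot_def] using this
    · intro π _ π' _ h
      ext a b
      have := iff_of_eq (congrArg (fun s : Setoid _ => s (ε a) (ε b)) h)
      simpa [Setoid.comap_rel] using this
    · intro π hπ
      simp only [Finset.mem_filter, Finset.mem_univ, true_and] at hπ
      refine ⟨π.comap ε, ?_, ?_⟩
      · simp only [Finset.mem_filter, Finset.mem_univ, true_and]
        intro h
        apply hπ
        ext a b
        have := iff_of_eq (congrArg (fun s : Setoid _ => s (ε.symm a) (ε.symm b)) h)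
        simpa [Setoid.comap_rel, Setoid.bot_def] using this
      · ext a b
        simp [Setoid.comap_rel]
    · intro π _
      have : Nat.card (Quotient π) = Nat.card (Quotient (π.comap ε.symm)) :=
        Nat.card_congr (Quotient.congr ε fun a b => by simp [Setoid.comap_rel])
      rw [this]
  have hdual : ∀ i, i ≤ n → (reducibleSet (Set.univ : Set (Fin n)) i).ncard =
      (reducibleSet (Set.univ : Set (Fin n)) (n - i)).ncard := fun i hi =>
    ncard_reducibleSet_dual (by rw [Nat.card_fin]; omega)
  rw [coeff_klPolynomial (by omega), hrank]
  -- With n fixed, the recursion reads (q(i) - s(i)) - (q(n - i) - s(n - i)). Duality cancels the q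
  -- terms, and s(i) = 0 by the size bound. When 2i ≥ n the same bound gives s(n - i) = 0, as the
  -- degree condition requires.
  by_cases hi : 2 * i < n
  · rw [if_pos hi, if_pos (by omega), hQ' _ (by omega), hQ' _ (by omega),
      show n - (n - i) = i by omega, ncard_simpleQuasiSeriesParallel_eq_zero hnpos hi.le,
      hdual i (by omega)]
    simp
  · rw [if_neg hi]
    split_ifs with h
    · rw [ncard_simpleQuasiSeriesParallel_eq_zero hnpos (by omega), Nat.cast_zero]
    · rfl

end Matroid

/-! ### Flats of the braid matroids -/

namespace SimpleGraph

variable {V : Type*} [Finite V]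

theorem mem_closure_cycleMatroid_of_indep {G : SimpleGraph V} {I : Set (Sym2 V)}
    (hI : G.cycleMatroid.Indep I) {u v : V} :
    s(u, v) ∈ G.cycleMatroid.closure I ↔ G.Adj u v ∧ (fromEdgeSet I).Reachable u v := by
  have hI' := (G.cycleMatroid_indep_iff I).1 hI
  by_cases hadj : G.Adj u v
  swap
  · refine iff_of_false (fun h => hadj ?_) (fun h => hadj h.1)
    exact (mem_edgeSet G).1 (G.cycleMatroid.closure_subset_ground _ h)
  rw [and_iff_right hadj]
  by_cases hmem : s(u, v) ∈ I
  · refine iff_of_true (G.cycleMatroid.mem_closure_of_mem hmem hI.subset_ground) ?_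
    exact Adj.reachable (by simp [hmem, hadj.ne])
  have h1 := hI.insert_indep_iff_of_notMem hmem
  rw [← not_iff_not]
  have h2 : s(u, v) ∉ G.cycleMatroid.closure I ↔ G.cycleMatroid.Indep (insert s(u, v) I) := by
    rw [h1]
    simp [cycleMatroid_ground, hadj]
  rw [h2, cycleMatroid_indep_iff, Set.insert_subset_iff, ← Set.union_singleton,
    fromEdgeSet_union, ← edge, isAcyclic_sup_fromEdgeSet_iff]
  simp [hadj, hadj.ne, hI'.1, hI'.2, hmem]

theorem mem_closure_cycleMatroid {G : SimpleGraph V} {X : Set (Sym2 V)} (hX : X ⊆ G.edgeSet)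
    {u v : V} :
    s(u, v) ∈ G.cycleMatroid.closure X ↔ G.Adj u v ∧ (fromEdgeSet X).Reachable u v := by
  obtain ⟨I, hI⟩ := G.cycleMatroid.exists_isBasis X hX
  rw [← hI.closure_eq_closure, mem_closure_cycleMatroid_of_indep hI.indep]
  suffices h : (fromEdgeSet X).Reachable u v → (fromEdgeSet I).Reachable u v from
    and_congr_right fun _ => ⟨fun h => h.mono (fromEdgeSet_mono hI.subset), h⟩
  rintro ⟨w⟩
  induction w with
  | nil => exact Reachable.refl _
  | @cons a b c hab _ ih =>
    refine Reachable.trans ?_ ih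
    have hab' : s(a, b) ∈ X := by simpa using ((fromEdgeSet_adj _).1 hab).1
    exact ((mem_closure_cycleMatroid_of_indep hI.indep).1 (hI.subset_closure hab')).2

end SimpleGraph

section braid

open SimpleGraph

variable {n : ℕ}

/-- The edges inside the blocks of a partition. -/
def Setoid.blockEdges (π : Setoid (Fin n)) : Set (Sym2 (Fin n)) :=
  {e | ∃ u v, e = s(u, v) ∧ u ≠ v ∧ π u v}

theorem Setoid.mem_blockEdges {π : Setoid (Fin n)} {u v : Fin n} :
    s(u, v) ∈ π.blockEdges ↔ u ≠ v ∧ π u v := by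
  constructor
  · rintro ⟨a, b, h, hne, hab⟩
    rcases Sym2.eq_iff.1 h with ⟨rfl, rfl⟩ | ⟨rfl, rfl⟩
    exacts [⟨hne, hab⟩, ⟨hne.symm, π.symm hab⟩]
  · rintro ⟨hne, h⟩
    exact ⟨u, v, rfl, hne, h⟩

theorem Setoid.blockEdges_subset (π : Setoid (Fin n)) :
    π.blockEdges ⊆ (⊤ : SimpleGraph (Fin n)).edgeSet := by
  rintro _ ⟨u, v, rfl, hne, -⟩
  simpa

theorem Setoid.rel_of_reachable_blockEdges {π : Setoid (Fin n)} {u v : Fin n}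
    (h : (fromEdgeSet π.blockEdges).Reachable u v) : π u v := by
  obtain ⟨w⟩ := h
  induction w with
  | nil => exact π.refl _
  | cons hab _ ih =>
    exact π.trans (Setoid.mem_blockEdges.1 ((fromEdgeSet_adj _).1 hab).1).2 ih

theorem isFlat_blockEdges (π : Setoid (Fin n)) : (braidMatroid n).IsFlat π.blockEdges := by
  rw [Matroid.isFlat_iff_closure_eq]
  refine Set.Subset.antisymm ?_ ((braidMatroid n).subset_closure _ π.blockEdges_subset)
  intro e
  induction e with
  | _ u v =>
    intro h
    have := (mem_closure_cycleMatroid π.blockEdges_subset).1 h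
    exact Setoid.mem_blockEdges.2 ⟨this.1, Setoid.rel_of_reachable_blockEdges this.2⟩

/-- The partition given by a flat of the braid matroid. -/
def braidSetoid (F : {F // (braidMatroid n).IsFlat F}) : Setoid (Fin n) where
  r u v := u = v ∨ s(u, v) ∈ F.1
  iseqv := by
    refine ⟨fun u => Or.inl rfl, ?_, ?_⟩
    · rintro u v (rfl | h)
      · exact Or.inl rfl
      · exact Or.inr (by rwa [Sym2.eq_swap])
    · rintro u v w (rfl | h1) (rfl | h2)
      · exact Or.inl rfl
      · exact Or.inr h2
      · exact Or.inr h1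
      · by_cases huw : u = w
        · exact Or.inl huw
        · right
          have hE : F.1 ⊆ (⊤ : SimpleGraph (Fin n)).edgeSet := F.2.subset_ground
          have hne : ∀ {a b : Fin n}, s(a, b) ∈ F.1 → a ≠ b := fun h => by simpa using hE h
          have : s(u, w) ∈ (braidMatroid n).closure F.1 := by
            refine (mem_closure_cycleMatroid hE).2 ⟨huw, ?_⟩
            refine Reachable.trans (v := v) (Adj.reachable ?_) (Adj.reachable ?_)
            · exact (fromEdgeSet_adj _).2 ⟨h1, hne h1⟩
            · exact (fromEdgeSet_adj _).2 ⟨h2, hne h2⟩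
          rwa [F.2.closure] at this

/-- The lattice of flats of the braid matroid is the partition lattice. -/
def braidFlats (n : ℕ) : {F // (braidMatroid n).IsFlat F} ≃o Setoid (Fin n) where
  toFun := braidSetoid
  invFun π := ⟨π.blockEdges, isFlat_blockEdges π⟩
  left_inv F := by
    ext e
    induction e with
    | _ u v =>
      have hE : F.1 ⊆ (⊤ : SimpleGraph (Fin n)).edgeSet := F.2.subset_ground
      have hne : ∀ {a b : Fin n}, s(a, b) ∈ F.1 → a ≠ b := fun h => by simpa using hE h
      rw [Setoid.mem_blockEdges]
      change (u ≠ v ∧ (u = v ∨ s(u, v) ∈ F.1)) ↔ _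
      have := @hne u v
      tauto
  right_inv π := by
    ext u v
    change (u = v ∨ s(u, v) ∈ π.blockEdges) ↔ π u v
    rw [Setoid.mem_blockEdges]
    by_cases huv : u = v
    · subst huv; simp
    · simp [huv]
  map_rel_iff' {F G} := by
    have hE : F.1 ⊆ (⊤ : SimpleGraph (Fin n)).edgeSet := F.2.subset_ground
    have hne : ∀ {a b : Fin n}, s(a, b) ∈ F.1 → a ≠ b := fun h => by simpa using hE h
    constructor
    · intro h e he
      induction e with
      | _ u v => exact (h (Or.inr he) : u = v ∨ s(u, v) ∈ G.1).resolve_left (hne he)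
    · intro h u v
      exact Or.imp_right fun h' => h h'

/-- A basis of the flat is a forest of stars joining each vertex to the chosen representative `ρ` of
its block. It has one edge for each vertex that is not a representative. -/
theorem natRank_braid_flat (F : {F // (braidMatroid n).IsFlat F}) :
    ((braidMatroid n) ↾ F.1).natRank + Nat.card (Quotient (braidFlats n F)) = n := by
  obtain ⟨π, rfl⟩ := (braidFlats n).symm.surjective F
  rw [OrderIso.apply_symm_apply]
  change ((braidMatroid n) ↾ π.blockEdges).natRank + _ = n
  set ρ : Fin n → Fin n := fun v => (Quotient.mk π v).out with hρ
  have hρπ : ∀ v, π (ρ v) v := fun v => Quotient.mk_out v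
  have hρρ : ∀ v, ρ (ρ v) = ρ v := fun v => by simp [hρ]
  set S : Set (Fin n) := {v | v ≠ ρ v} with hS
  set I : Set (Sym2 (Fin n)) := (fun v => s(v, ρ v)) '' S with hI
  have hIπ : I ⊆ π.blockEdges := by
    rintro _ ⟨v, hv, rfl⟩
    exact Setoid.mem_blockEdges.2 ⟨hv, π.symm (hρπ v)⟩
  have hadj : ∀ {a b}, (fromEdgeSet I).Adj a b → b = ρ a ∨ a = ρ b := by
    intro a b hab
    obtain ⟨v, -, hvab⟩ := ((fromEdgeSet_adj _).1 hab).1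
    rcases Sym2.eq_iff.1 hvab with ⟨rfl, rfl⟩ | ⟨rfl, rfl⟩
    exacts [Or.inl rfl, Or.inr rfl]
  have hacyc : (fromEdgeSet I).IsAcyclic := by
    rw [isAcyclic_iff_forall_isBridge]
    intro e he
    rw [edgeSet_fromEdgeSet] at he
    obtain ⟨v, hv, rfl⟩ := he.1
    rw [isBridge_iff]
    -- A non-representative is a leaf of its star, hence isolated once its edge is removed; so every
    -- edge is a bridge.
    have hiso : ∀ x, ((fromEdgeSet I).deleteEdges {s(v, ρ v)}).Reachable v x → x = v := by
      rintro x ⟨w⟩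
      cases w with
      | nil => rfl
      | @cons _ b _ hab _ =>
        rw [deleteEdges_adj] at hab
        rcases hadj hab.1 with rfl | h
        · exact absurd rfl hab.2
        · exact absurd (by rw [h, hρρ]) hv
    exact fun h => hv (hiso _ h).symm
  have hindep : (braidMatroid n).Indep I :=
    (cycleMatroid_indep_iff _ I).2 ⟨hIπ.trans π.blockEdges_subset, hacyc⟩
  have hbasis : (braidMatroid n).IsBasis I π.blockEdges := by
    refine hindep.isBasis_of_subset_of_subset_closure hIπ ?_
    rintro _ ⟨u, v, rfl, hne, huv⟩
    refine (mem_closure_cycleMatroid_of_indep hindep).2 ⟨hne, ?_⟩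
    have hr : ∀ v, (fromEdgeSet I).Reachable v (ρ v) := by
      intro v
      by_cases hv : v = ρ v
      · rw [← hv]
      · exact Adj.reachable ((fromEdgeSet_adj _).2 ⟨⟨v, hv, rfl⟩, hv⟩)
    have : ρ u = ρ v := by simp only [hρ]; rw [Quotient.sound huv]
    exact (hr u).trans (this ▸ (hr v).symm)
  have hcard : I.ncard = S.ncard := by
    refine Set.InjOn.ncard_image fun a ha b hb hab => ?_
    rcases Sym2.eq_iff.1 hab with ⟨h, -⟩ | ⟨h1, h2⟩
    · exact h
    · exact absurd (by rw [h1, hρρ]) ha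
  have hquot : Nat.card (Quotient π) = Sᶜ.ncard := by
    have : Sᶜ = Set.range (Quotient.out : Quotient π → Fin n) := by
      ext v
      simp only [hS, Set.mem_compl_iff, Set.mem_ofPred, ne_eq, not_not, Set.mem_range]
      constructor
      · intro h
        exact ⟨_, h.symm⟩
      · rintro ⟨a, rfl⟩
        simp [hρ]
    rw [this, ← Set.image_univ, Quotient.out_injective.injOn.ncard_image, Set.ncard_univ]
  have hrk : ((braidMatroid n) ↾ π.blockEdges).natRank = I.ncard := by
    rw [Matroid.natRank, Matroid.eRank_restrict, ← hbasis.encard_eq_eRk]; rfl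
  rw [hrk, hcard, hquot, Set.ncard_add_ncard_compl, Nat.card_fin]

theorem braidMatroid_finite (n : ℕ) : (braidMatroid n).Finite := ⟨Set.toFinite _⟩

theorem braidMatroid_loopless (n : ℕ) : (braidMatroid n).Loopless := by
  refine ⟨?_⟩
  rw [Set.eq_empty_iff_forall_notMem]
  intro e
  induction e with
  | _ u v =>
    intro h
    have := (mem_closure_cycleMatroid_of_indep (G := ⊤) (Matroid.empty_indep _)).1 h
    obtain ⟨h1, ⟨w⟩⟩ := this
    cases w with
    | nil => simp at h1
    | cons hab _ => simp at hab

theorem coeff_klPolynomial_braidMatroid (n i : ℕ) :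
    (braidMatroid (n + 1)).klPolynomial.coeff i =
      if i ≤ n then ((Matroid.simpleQuasiSeriesParallel n (n - i)).ncard : ℤ) else 0 :=
  Matroid.coeff_klPolynomial_of_flats_orderIso (V := Fin (n + 1)) (Nat.card_fin _)
    (braidMatroid_finite _) (braidMatroid_loopless _) (braidFlats (n + 1)) natRank_braid_flat i

end braid

namespace HyperTree

variable {V : Type*} {E : Set V} {T : Set (Set V)} {r : V} {σ p : V → V}

/-! ### Rooted hypertrees -/

/-- A hypertree on `E` rooted at `r`, given by the pairing `σ` of the other vertices into the two
vertices of a triple lying away from the root, and the map `p` sending such a vertex to the third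
vertex of that triple. -/
structure IsRooting (E : Set V) (r : V) (σ p : V → V) : Prop where
  root_mem : r ∈ E
  pair_mem : ∀ v ∈ E, σ v ∈ E
  pair_pair : ∀ v ∈ E, σ (σ v) = v
  pair_eq_iff : ∀ v ∈ E, σ v = v ↔ v = r
  parent_mem : ∀ v ∈ E, p v ∈ E
  parent_pair : ∀ v ∈ E, p (σ v) = p v
  parent_root : p r = r
  reach : ∀ v ∈ E, ∃ n, p^[n] v = r

/-- The triples of a rooted hypertree. -/
def rootedTriples (E : Set V) (r : V) (σ p : V → V) : Set (Set V) :=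
  {t | ∃ v ∈ E, v ≠ r ∧ t = {v, σ v, p v}}

namespace IsRooting

theorem pair_root (h : IsRooting E r σ p) : σ r = r :=
  (h.pair_eq_iff r h.root_mem).2 rfl

theorem pair_ne_root (h : IsRooting E r σ p) {v : V} (hv : v ∈ E) (hvr : v ≠ r) : σ v ≠ r := by
  intro h1
  apply hvr
  rw [← h.pair_pair v hv, h1, h.pair_root]

theorem parent_ne (h : IsRooting E r σ p) {v : V} (hv : v ∈ E) (hvr : v ≠ r) : p v ≠ v := by
  intro h1
  obtain ⟨n, hn⟩ := h.reach v hv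
  rw [Function.iterate_fixed h1] at hn
  exact hvr hn

theorem parent_ne_pair (h : IsRooting E r σ p) {v : V} (hv : v ∈ E) (hvr : v ≠ r) :
    p v ≠ σ v := by
  rw [← h.parent_pair v hv]
  exact h.parent_ne (h.pair_mem v hv) (h.pair_ne_root hv hvr)

theorem parent_parent_ne (h : IsRooting E r σ p) {v : V} (hv : v ∈ E) (hvr : v ≠ r) :
    p (p v) ≠ v := by
  intro h1
  have h2 : ∀ n, p^[n] v = v ∨ p^[n] v = p v := by
    intro n
    induction n with
    | zero => exact Or.inl rfl
    | succ n ih =>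
      rw [Function.iterate_succ_apply']
      rcases ih with ih | ih <;> rw [ih]
      · exact Or.inr rfl
      · exact Or.inl h1
  obtain ⟨n, hn⟩ := h.reach v hv
  rcases h2 n with h3 | h3
  · exact hvr (h3.symm.trans hn)
  · rw [hn] at h3
    rw [← h3, h.parent_root] at h1
    exact hvr h1.symm

theorem singleton (v : V) : IsRooting {v} v id id where
  root_mem := rfl
  pair_mem _ h := h
  pair_pair _ _ := rfl
  pair_eq_iff := by simp
  parent_mem _ h := h
  parent_pair _ _ := rfl
  parent_root := rfl
  reach v hv := ⟨0, hv⟩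

theorem rootedTriples_singleton (v : V) (σ p : V → V) : rootedTriples {v} v σ p = ∅ := by
  rw [Set.eq_empty_iff_forall_notMem]
  rintro t ⟨w, hw, hne, -⟩
  exact hne hw

theorem rootedTriples_insert {e g : V} {σ' p' : V → V}
    (hE : ∀ v ∈ E, σ' v = σ v ∧ p' v = p v) (he : e ≠ r) (hg : g ≠ r) (heg : σ' e = g)
    (hge : σ' g = e) (hp : p' g = p' e) :
    rootedTriples (insert e (insert g E)) r σ' p' =
      insert {e, p' e, g} (rootedTriples E r σ p) := by
  ext t
  constructor
  · rintro ⟨v, hv, hvr, rfl⟩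
    rcases hv with rfl | rfl | hv
    · left
      rw [heg, Set.pair_comm]
    · left
      rw [hge, hp, Set.insert_comm, Set.pair_comm]
    · right
      exact ⟨v, hv, hvr, by rw [(hE v hv).1, (hE v hv).2]⟩
  · rintro (rfl | ⟨v, hv, hvr, rfl⟩)
    · exact ⟨e, by simp, he, by rw [heg, Set.pair_comm]⟩
    · exact ⟨v, by simp [hv], hvr, by rw [(hE v hv).1, (hE v hv).2]⟩

theorem exists_insert (h : IsRooting E r σ p) {e f g : V} (hf : f ∈ E) (he : e ∉ E) (hg : g ∉ E)
    (hne : e ≠ g) : ∃ σ' p', IsRooting (insert e (insert g E)) r σ' p' ∧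
      rootedTriples (insert e (insert g E)) r σ' p' =
        insert {e, f, g} (rootedTriples E r σ p) := by
  classical
  let σ' : V → V := fun v => if v = e then g else if v = g then e else σ v
  let p' : V → V := fun v => if v = e then f else if v = g then f else p v
  have hE : ∀ v ∈ E, σ' v = σ v ∧ p' v = p v := by
    intro v hv
    have h1 : v ≠ e := fun h => he (h ▸ hv)
    have h2 : v ≠ g := fun h => hg (h ▸ hv)
    simp [σ', p', h1, h2]
  have hσe : σ' e = g := by simp [σ']
  have hσg : σ' g = e := by simp [σ']
  have hpe : p' e = f := by simp [p']
  have hpg : p' g = f := by simp [p']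
  have her : e ≠ r := fun h' => he (h' ▸ h.root_mem)
  have hgr : g ≠ r := fun h' => hg (h' ▸ h.root_mem)
  have hiter : ∀ n, ∀ v ∈ E, p'^[n] v = p^[n] v := by
    intro n
    induction n with
    | zero => exact fun _ _ => rfl
    | succ n ih =>
      intro v hv
      rw [Function.iterate_succ_apply, Function.iterate_succ_apply, (hE v hv).2,
        ih _ (h.parent_mem v hv)]
  obtain ⟨m, hm⟩ := h.reach f hf
  have hm' : p'^[m] f = r := by rw [hiter m f hf, hm]
  refine ⟨σ', p', ⟨by simp [h.root_mem], ?_, ?_, ?_, ?_, ?_, ?_, ?_⟩, ?_⟩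
  · rintro v (rfl | rfl | hv)
    · simp [hσe]
    · simp [hσg]
    · rw [(hE v hv).1]; simp [h.pair_mem v hv]
  · rintro v (rfl | rfl | hv)
    · rw [hσe, hσg]
    · rw [hσg, hσe]
    · rw [(hE v hv).1, (hE _ (h.pair_mem v hv)).1, h.pair_pair v hv]
  · rintro v (rfl | rfl | hv)
    · simp [hσe, hne.symm, her]
    · simp [hσg, hne, hgr]
    · rw [(hE v hv).1, h.pair_eq_iff v hv]
  · rintro v (rfl | rfl | hv)
    · simp [hpe, hf]
    · simp [hpg, hf]
    · rw [(hE v hv).2]; simp [h.parent_mem v hv]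
  · rintro v (rfl | rfl | hv)
    · rw [hσe, hpe, hpg]
    · rw [hσg, hpe, hpg]
    · rw [(hE v hv).1, (hE v hv).2, (hE _ (h.pair_mem v hv)).2, h.parent_pair v hv]
  · rw [(hE r h.root_mem).2, h.parent_root]
  · rintro v (rfl | rfl | hv)
    · exact ⟨m + 1, by rw [Function.iterate_succ_apply, hpe, hm']⟩
    · exact ⟨m + 1, by rw [Function.iterate_succ_apply, hpg, hm']⟩
    · obtain ⟨n, hn⟩ := h.reach v hv
      exact ⟨n, by rw [hiter n v hv, hn]⟩
  · rw [IsRooting.rootedTriples_insert hE her hgr hσe hσg (by rw [hpe, hpg]), hpe]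

/-- The old tree is rooted at `f`. Moving the root to `e` makes `f` and `g` the pair of the new
triple, with parent `e`, and leaves every other triple oriented as before. -/
theorem exists_reroot {f : V} (h : IsRooting E f σ p) {e g : V} (he : e ∉ E) (hg : g ∉ E)
    (hne : e ≠ g) : ∃ σ' p', IsRooting (insert e (insert g E)) e σ' p' ∧
      rootedTriples (insert e (insert g E)) e σ' p' =
        insert {e, f, g} (rootedTriples E f σ p) := by
  classical
  have hfE := h.root_mem
  have hfe : f ≠ e := fun h => he (h ▸ hfE)
  have hfg : f ≠ g := fun h => hg (h ▸ hfE)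
  let σ' : V → V := fun v => if v = e then e else if v = g then f else if v = f then g else σ v
  let p' : V → V := fun v => if v = e then e else if v = g then e else if v = f then e else p v
  have hE : ∀ v ∈ E, v ≠ f → σ' v = σ v ∧ p' v = p v := by
    intro v hv hvf
    have h1 : v ≠ e := fun h => he (h ▸ hv)
    have h2 : v ≠ g := fun h => hg (h ▸ hv)
    simp [σ', p', h1, h2, hvf]
  have hσe : σ' e = e := by simp [σ']
  have hσg : σ' g = f := by simp [σ', hne.symm]
  have hσf : σ' f = g := by simp [σ', hfe, hfg]
  have hpe : p' e = e := by simp [p']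
  have hpg : p' g = e := by simp [p']
  have hpf : p' f = e := by simp [p']
  have hiter : ∀ n, ∀ v ∈ E, p^[n] v = f → ∃ m, p'^[m] v = e := by
    intro n
    induction n with
    | zero => rintro v _ rfl; exact ⟨1, hpf⟩
    | succ n ih =>
      intro v hv hn
      by_cases hvf : v = f
      · exact ⟨1, by rw [hvf]; exact hpf⟩
      · rw [Function.iterate_succ_apply] at hn
        obtain ⟨m, hm⟩ := ih _ (h.parent_mem v hv) hn
        exact ⟨m + 1, by rw [Function.iterate_succ_apply, (hE v hv hvf).2, hm]⟩
  have key : ∀ {P : V → Prop}, P e → P g → P f → (∀ v ∈ E, v ≠ f → P v) →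
      ∀ v ∈ insert e (insert g E), P v := by
    rintro P h1 h2 h3 h4 v (rfl | rfl | hv)
    · exact h1
    · exact h2
    · by_cases hvf : v = f
      · exact hvf ▸ h3
      · exact h4 v hv hvf
  refine ⟨σ', p', ⟨by simp, ?_, ?_, ?_, ?_, ?_, hpe, ?_⟩, ?_⟩
  · refine key (by simp [hσe]) (by simp [hσg, hfE]) (by simp [hσf]) fun v hv hvf => ?_
    rw [(hE v hv hvf).1]; simp [h.pair_mem v hv]
  · refine key (by rw [hσe, hσe]) (by rw [hσg, hσf]) (by rw [hσf, hσg]) fun v hv hvf => ?_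
    rw [(hE v hv hvf).1, (hE _ (h.pair_mem v hv) (h.pair_ne_root hv hvf)).1, h.pair_pair v hv]
  · refine key (by simp [hσe]) (by simp [hσg, hfg, hne.symm]) (by simp [hσf, hfg.symm, hfe])
      fun v hv hvf => ?_
    rw [(hE v hv hvf).1, h.pair_eq_iff v hv]
    exact iff_of_false hvf fun h => he (h ▸ hv)
  · refine key (by simp [hpe]) (by simp [hpg]) (by simp [hpf]) fun v hv hvf => ?_
    rw [(hE v hv hvf).2]; simp [h.parent_mem v hv]
  · refine key (by rw [hσe]) (by rw [hσg, hpf, hpg]) (by rw [hσf, hpf, hpg]) fun v hv hvf => ?_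
    rw [(hE v hv hvf).1, (hE v hv hvf).2, (hE _ (h.pair_mem v hv) (h.pair_ne_root hv hvf)).2,
      h.parent_pair v hv]
  · refine key ⟨0, rfl⟩ ⟨1, hpg⟩ ⟨1, hpf⟩ fun v hv _ => ?_
    obtain ⟨n, hn⟩ := h.reach v hv
    exact hiter n v hv hn
  · ext t
    constructor
    · rintro ⟨v, hv, hve, rfl⟩
      revert hve
      refine key (P := fun v => v ≠ e → ({v, σ' v, p' v} : Set V) ∈
        insert {e, f, g} (rootedTriples E f σ p)) (fun h => absurd rfl h) ?_ ?_ ?_ v hv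
      · intro _
        left
        rw [hσg, hpg, Set.pair_comm, Set.insert_comm, Set.pair_comm]
      · intro _
        left
        rw [hσf, hpf, Set.pair_comm, Set.insert_comm]
      · intro v hv hvf _
        right
        exact ⟨v, hv, hvf, by rw [(hE v hv hvf).1, (hE v hv hvf).2]⟩
    · rintro (rfl | ⟨v, hv, hvf, rfl⟩)
      · refine ⟨g, by simp, hne.symm, ?_⟩
        rw [hσg, hpg, Set.insert_comm, Set.pair_comm, Set.insert_comm]
      · refine ⟨v, by simp [hv], fun h => he (h ▸ hv), ?_⟩
        rw [(hE v hv hvf).1, (hE v hv hvf).2]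

/-- Induction on the distance to the root: the two rootings already agree at the parent of v. The
triple of v has some orientation in the second rooting, and it remains to see that its parent vertex
is the same. -/
theorem pair_eq_and_parent_eq {σ' p' : V → V} (h : IsRooting Set.univ r σ p)
    (h' : IsRooting Set.univ r σ' p')
    (hT : rootedTriples Set.univ r σ p = rootedTriples Set.univ r σ' p') (n : ℕ) :
    ∀ v, p^[n] v = r → σ' v = σ v ∧ p' v = p v := by
  have hroot : σ' r = σ r ∧ p' r = p r := by
    rw [h.pair_root, h'.pair_root, h.parent_root, h'.parent_root]
    exact ⟨rfl, rfl⟩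
  induction n with
  | zero => rintro v rfl; exact hroot
  | succ n ih =>
    intro v hv
    by_cases hvr : v = r
    · rw [hvr]; exact hroot
    rw [Function.iterate_succ_apply] at hv
    obtain ⟨hu1, hu2⟩ := ih _ hv
    have a1 := h.parent_ne (Set.mem_univ v) hvr
    have a2 := h.parent_ne_pair (Set.mem_univ v) hvr
    have a3 := h.parent_parent_ne (Set.mem_univ v) hvr
    have a4 : σ v ≠ v := fun h1 => hvr ((h.pair_eq_iff v trivial).1 h1)
    have b1 := h'.parent_ne (Set.mem_univ v) hvr
    have b2 := h'.parent_ne_pair (Set.mem_univ v) hvr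
    have b4 : σ' v ≠ v := fun h1 => hvr ((h'.pair_eq_iff v trivial).1 h1)
    have hmem : ({v, σ v, p v} : Set V) ∈ rootedTriples Set.univ r σ' p' := by
      rw [← hT]
      exact ⟨v, trivial, hvr, rfl⟩
    obtain ⟨w, -, hwr, hw⟩ := hmem
    have hswap : ({w, σ' w, p' w} : Set V) = {σ' w, σ' (σ' w), p' (σ' w)} := by
      rw [h'.pair_pair w trivial, h'.parent_pair w trivial, Set.insert_comm]
    -- the case where the two triples have the same pair
    have hmain : ({v, σ v, p v} : Set V) = {v, σ' v, p' v} → σ' v = σ v ∧ p' v = p v := by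
      intro heq
      have c1 : σ' v ∈ ({v, σ v, p v} : Set V) := by rw [heq]; simp
      have c2 : p' v ∈ ({v, σ v, p v} : Set V) := by rw [heq]; simp
      -- If `v` were paired with `p v` in the second rooting, agreement at `p v` would make them a
      -- pair in the first as well.
      have c3 : σ' v ≠ p v := by
        intro h1
        have h2 : σ (p v) = v := by rw [← hu1, ← h1, h'.pair_pair v trivial]
        apply a2
        rw [← h.pair_pair (p v) trivial, h2]
      simp only [Set.mem_insert_iff, Set.mem_singleton_iff] at c1 c2
      have c4 : σ' v = σ v := by tauto
      refine ⟨c4, ?_⟩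
      rw [← c4] at c2
      tauto
    -- If `v` were the parent vertex, `p v` would have `v` as its `p'`-parent, hence as its
    -- `p`-parent, giving a cycle that never reaches the root.
    have hpar : p' w ≠ v := by
      intro h1
      have hv' : p v ∈ ({w, σ' w, p' w} : Set V) := by rw [← hw]; simp
      rcases hv' with h2 | h2 | h2
      · apply a3
        rw [← hu2, h2, h1]
      · apply a3
        rw [← hu2, h2, h'.parent_pair w trivial, h1]
      · exact a1 (h2.trans h1)
    have hv' : v ∈ ({w, σ' w, p' w} : Set V) := by rw [← hw]; simp
    rcases hv' with h2 | h2 | h2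
    · rw [← h2] at hw
      exact hmain hw
    · rw [hswap, ← h2] at hw
      exact hmain hw
    · exact absurd h2.symm hpar

end IsRooting

theorem exists_isRooting (h : HyperTree E T) : ∀ r ∈ E,
    ∃ σ p, IsRooting E r σ p ∧ rootedTriples E r σ p = T := by
  induction h with
  | single v =>
    rintro r rfl
    exact ⟨id, id, IsRooting.singleton _, IsRooting.rootedTriples_singleton _ _ _⟩
  | @step E T e f g _ hf he hg hne ih =>
    rintro r (rfl | rfl | hr)
    · obtain ⟨σ, p, h1, rfl⟩ := ih f hf
      exact h1.exists_reroot he hg hne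
    · obtain ⟨σ, p, h1, rfl⟩ := ih f hf
      obtain ⟨σ', p', h2, h3⟩ := h1.exists_reroot hg he hne.symm
      rw [Set.insert_comm e r]
      refine ⟨σ', p', h2, ?_⟩
      rw [h3, Set.pair_comm, Set.insert_comm, Set.pair_comm]
    · obtain ⟨σ, p, h1, rfl⟩ := ih r hr
      exact h1.exists_insert hf he hg hne

/-- Take a maximal vertex set on which the rooting restricts to a tree. If some vertex is missing,
its path to the root first enters the set from some `w`; then `w` and its partner can be added with
their triple. -/
theorem of_isRooting [Finite V] (h : IsRooting Set.univ r σ p) :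
    HyperTree Set.univ (rootedTriples Set.univ r σ p) := by
  let S : Set (Set V) := {E | IsRooting E r σ p ∧ HyperTree E (rootedTriples E r σ p)}
  have hS : ({r} : Set V) ∈ S := by
    refine ⟨⟨rfl, ?_, ?_, ?_, ?_, ?_, h.parent_root, ?_⟩, ?_⟩
    · rintro v rfl; exact h.pair_root
    · rintro v rfl; rw [h.pair_root, h.pair_root]
    · rintro v rfl; exact iff_of_true h.pair_root rfl
    · rintro v rfl; exact h.parent_root
    · rintro v rfl; rw [h.pair_root]
    · rintro v rfl; exact ⟨0, rfl⟩
    · rw [IsRooting.rootedTriples_singleton]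
      exact .single r
  obtain ⟨E, hE⟩ := (Set.toFinite S).exists_maximal ⟨_, hS⟩
  obtain ⟨hER, hET⟩ := hE.1
  suffices hEu : E = Set.univ by rwa [hEu] at hET
  by_contra hEu
  obtain ⟨v, hv⟩ := (Set.ne_univ_iff_exists_notMem E).1 hEu
  have hstep : ∀ n, ∀ v, v ∉ E → p^[n] v = r → ∃ w, w ∉ E ∧ p w ∈ E := by
    intro n
    induction n with
    | zero => rintro v hv rfl; exact absurd hER.root_mem hv
    | succ n ih =>
      intro v hv hn
      by_cases hpv : p v ∈ E
      · exact ⟨v, hv, hpv⟩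
      · exact ih _ hpv (by rwa [Function.iterate_succ_apply] at hn)
  obtain ⟨n, hn⟩ := h.reach v trivial
  obtain ⟨w, hw, hpw⟩ := hstep n v hv hn
  have hwr : w ≠ r := fun h' => hw (h' ▸ hER.root_mem)
  have hσw : σ w ∉ E := by
    intro h'
    apply hw
    rw [← h.pair_pair w trivial]
    exact hER.pair_mem _ h'
  have hσσ := h.pair_pair w trivial
  have hpσ := h.parent_pair w trivial
  have hmem : insert w (insert (σ w) E) ∈ S := by
    constructor
    · refine ⟨by simp [hER.root_mem], ?_, fun v _ => h.pair_pair v trivial,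
        fun v _ => h.pair_eq_iff v trivial, ?_, fun v _ => h.parent_pair v trivial, h.parent_root,
        fun v _ => h.reach v trivial⟩
      · rintro v (rfl | rfl | hv)
        · simp
        · simp [hσσ]
        · simp [hER.pair_mem v hv]
      · rintro v (rfl | rfl | hv)
        · simp [hpw]
        · simp [hpσ, hpw]
        · simp [hER.parent_mem v hv]
    · rw [IsRooting.rootedTriples_insert (fun _ _ => ⟨rfl, rfl⟩) hwr (h.pair_ne_root trivial hwr) rfl hσσ
        hpσ]
      exact hET.step hpw hw hσw fun h' => hwr ((h.pair_eq_iff w trivial).1 h'.symm)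
  exact hw (hE.2 hmem (fun z hz => by simp [hz]) (Set.mem_insert _ _))

theorem ncard_eq_ncard_isRooting [Finite V] (r : V) :
    {x : Equiv.Perm V × (V → V) | IsRooting Set.univ r x.1 x.2}.ncard =
      {T : Set (Set V) | HyperTree Set.univ T}.ncard := by
  refine Set.BijOn.ncard_eq (f := fun x : Equiv.Perm V × (V → V) => rootedTriples Set.univ r x.1 x.2)
    ⟨fun x hx => of_isRooting (σ := x.1) (p := x.2) hx, ?_, ?_⟩
  · rintro ⟨σ, p⟩ h ⟨σ', p'⟩ h' hT
    have key : ∀ v, σ' v = σ v ∧ p' v = p v := fun v => by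
      obtain ⟨n, hn⟩ := IsRooting.reach h v trivial
      exact IsRooting.pair_eq_and_parent_eq h h' hT n v hn
    exact Prod.ext (Equiv.ext fun v => (key v).1.symm) (funext fun v => (key v).2.symm)
  · intro T hT
    obtain ⟨σ, p, h, rfl⟩ := exists_isRooting hT r trivial
    exact ⟨(Function.Involutive.toPerm σ fun v => h.pair_pair v trivial, p), h, rfl⟩

end HyperTree

/-! ### Counting rooted forests of blocks -/

/-- Given a partial partition `β` of `V` into blocks indexed by `B` and a map `p` sending each
block to a vertex, the vertices from which one can leave the blocks by iterating `p`. -/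
inductive BlockReach {V B : Type*} (β : V → Option B) (p : B → V) : V → Prop
  | base {v : V} : β v = none → BlockReach β p v
  | step {v : V} {i : B} : β v = some i → BlockReach β p (p i) → BlockReach β p v

namespace BlockReach

variable {V B : Type*}

theorem congr {β : V → Option B} {p : B → V} {v w : V} (h : BlockReach β p v) (hvw : β w = β v) :
    BlockReach β p w := by
  cases h with
  | base h => exact .base (hvw.trans h)
  | step h h' => exact .step (hvw.trans h) h'

/-- Merging the last block of `β` into the block of `x`. -/
def merge [DecidableEq (Option (Option B))] (β : V → Option (Option B)) (x v : V) : Option B :=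
  (if β v = some none then β x else β v).join

variable [DecidableEq (Option (Option B))] {β : V → Option (Option B)} {p : Option B → V}

/-- A vertex of the last block continues from `p none`, so it escapes exactly when that vertex does,
and the block may be merged with the block of `p none`. This only fails if `p none` lies in the last
block itself, where one is trapped. -/
theorem forall_iff_merge :
    (∀ v, BlockReach β p v) ↔
      β (p none) ≠ some none ∧ ∀ v, BlockReach (merge β (p none)) (p ∘ some) v := by
  constructor
  · intro h
    have hx : β (p none) ≠ some none := by
      have key : ∀ v, BlockReach β p v → β (p none) = some none → β v ≠ some none := by
        intro v hv hx
        induction hv with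
        | base h => simp [h]
        | @step v i h _ ih =>
          rintro h'
          rw [h, Option.some_inj] at h'
          exact ih (h' ▸ hx)
      exact fun hx => key _ (h _) hx hx
    refine ⟨hx, fun v => ?_⟩
    induction h v with
    | base h => exact .base (by simp [merge, h])
    | @step v i h _ ih =>
      cases i with
      | none => exact ih.congr (by simp [merge, h, hx])
      | some b => exact .step (i := b) (by simp [merge, h]) ih
  · rintro ⟨hx, h⟩ v
    induction h v with
    | @base v h =>
      by_cases hv : β v = some none
      · refine .step hv (.base ?_)
        cases hβ : β (p none) with
        | none => rfl
        | some i =>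
          cases i with
          | none => exact absurd hβ hx
          | some b => simp [merge, hv, hβ] at h
      · refine .base ?_
        cases hβ : β v with
        | none => rfl
        | some i =>
          cases i with
          | none => exact absurd hβ hv
          | some b => simp [merge, hβ] at h
    | @step v b h _ ih =>
      by_cases hv : β v = some none
      · refine .step hv (.step (i := some b) ?_ ih)
        cases hβ : β (p none) with
        | none => simp [merge, hv, hβ] at h
        | some i =>
          cases i with
          | none => exact absurd hβ hx
          | some c => simpa [merge, hv, hβ] using h
      · refine .step (i := some b) ?_ ih
        cases hβ : β v with
        | none => simp [merge, hβ] at h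
        | some i =>
          cases i with
          | none => exact absurd hβ hv
          | some c => simpa [merge, hβ] using h

end BlockReach

open Classical in
-- Let n = |V|, let a be the number of vertices in no block, and let l be the size of the last
-- block. Its image x can be any of the n - l vertices outside it, and merging changes a to a + l
-- when x is in no block, leaving a unchanged otherwise. Over all x these values add up to (n - l)a
-- + al = an. Multiplying by |V| avoids the exponent |B| - 1.
theorem card_blockReach_mul_card {V : Type*} [Fintype V] (B : Type*) [Fintype B]
    (β : V → Option B) :
    Nat.card {p : B → V // ∀ v, BlockReach β p v} * Fintype.card V =
      Fintype.card {v // β v = none} * Fintype.card V ^ Fintype.card B := by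
  revert β
  refine Fintype.induction_empty_option (P := fun B _ => ∀ β : V → Option B,
    Nat.card {p : B → V // ∀ v, BlockReach β p v} * Fintype.card V =
      Fintype.card {v // β v = none} * Fintype.card V ^ Fintype.card B) ?_ ?_ ?_ B
  · intro A B _ e ih β
    let _ := Fintype.ofEquiv B e.symm
    have h1 := ih fun v => (β v).map e.symm
    have h2 : ∀ p : A → V, ∀ v, BlockReach (fun v => (β v).map e.symm) p v ↔
        BlockReach β (p ∘ e.symm) v := by
      intro p v
      constructor
      · intro h
        induction h with
        | base h => exact .base (by simpa using h)
        | step h _ ih =>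
          obtain ⟨b, hb, rfl⟩ := Option.map_eq_some_iff.1 h
          exact .step hb ih
      · intro h
        induction h with
        | base h => exact .base (by simp [h])
        | step h _ ih => exact .step (by simp [h]) ih
    have h3 : Nat.card {p : B → V // ∀ v, BlockReach β p v} =
        Nat.card {p : A → V // ∀ v, BlockReach (fun v => (β v).map e.symm) p v} :=
      Nat.card_congr ((Equiv.subtypeEquiv (e.arrowCongr (Equiv.refl V))
        fun p => forall_congr' (h2 p)).symm)
    have h4 : Fintype.card {v // (β v).map e.symm = none} = Fintype.card {v // β v = none} :=
      Fintype.card_congr (Equiv.subtypeEquivRight fun v => by simp)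
    rw [h3, ← h4, ← Fintype.card_congr e]
    convert h1
  · intro β
    have h1 : ∀ v, β v = none := fun v => by
      cases h : β v with
      | none => rfl
      | some i => exact i.elim
    have h2 : ∀ p : PEmpty → V, ∀ v, BlockReach β p v := fun p v => .base (h1 v)
    simp [h1, h2]
  · intro B _ ih β
    let n := Fintype.card V
    let a := Fintype.card {v // β v = none}
    let l := Fintype.card {v // β v = some none}
    have e1 : {p : Option B → V // ∀ v, BlockReach β p v} ≃
        Σ x : {x : V // β x ≠ some none},
          {q : B → V // ∀ v, BlockReach (BlockReach.merge β x.1) q v} :=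
      { toFun p := ⟨⟨p.1 none, (BlockReach.forall_iff_merge.1 p.2).1⟩,
          ⟨p.1 ∘ some, (BlockReach.forall_iff_merge.1 p.2).2⟩⟩
        invFun y := ⟨fun i => i.elim y.1.1 y.2.1, BlockReach.forall_iff_merge.2 ⟨y.1.2, y.2.2⟩⟩
        left_inv p := by
          ext i
          cases i <;> rfl
        right_inv y := rfl }
    have hcard : ∀ x : {x : V // β x ≠ some none},
        Nat.card {q : B → V // ∀ v, BlockReach (BlockReach.merge β x.1) q v} * n =
          (a + if β x.1 = none then l else 0) * n ^ Fintype.card B := by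
      rintro ⟨x, hx⟩
      rw [ih]
      congr 1
      dsimp only
      have hm : ∀ v, BlockReach.merge β x v = none ↔ β v = none ∨ (β v = some none ∧ β x = none) := by
        intro v
        rcases h1 : β v with _ | _ | b
        · simp [BlockReach.merge, h1]
        · rcases h2 : β x with _ | _ | c
          · simp [BlockReach.merge, h1, h2]
          · exact absurd h2 hx
          · simp [BlockReach.merge, h1, h2]
        · simp [BlockReach.merge, h1]
      simp only [Fintype.card_subtype, hm, a, l]
      rw [Finset.filter_or, Finset.card_union_of_disjoint]
      · congr 1
        split_ifs with h <;> simp [h]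
      · rw [Finset.disjoint_filter]
        rintro v - h1 ⟨h2, -⟩
        rw [h1] at h2
        exact absurd h2 (by simp)
    rw [Nat.card_congr e1, Nat.card_sigma, Finset.sum_mul, Finset.sum_congr rfl
      fun x _ => hcard x, ← Finset.sum_mul, Finset.sum_add_distrib]
    have h5 : Fintype.card {x : V // β x ≠ some none} + l = n := by
      rw [Fintype.card_subtype_compl]
      exact Nat.sub_add_cancel (Fintype.card_subtype_le _)
    have h6 : (∑ x : {x : V // β x ≠ some none}, if β x.1 = none then l else 0) = a * l := by
      rw [Finset.sum_ite, Finset.sum_const_zero, add_zero, Finset.sum_const, smul_eq_mul]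
      congr 1
      rw [← Fintype.card_subtype]
      refine Fintype.card_congr
        { toFun y := ⟨y.1.1, y.2⟩
          invFun y := ⟨⟨y.1, by rw [y.2]; simp⟩, y.2⟩
          left_inv _ := rfl
          right_inv _ := rfl }
    rw [h6, Finset.sum_const, Finset.card_univ, smul_eq_mul, mul_comm _ a, ← mul_add, h5,
      Fintype.card_option, pow_succ, mul_assoc, mul_comm n]

/-! ### The number of trees of triples. -/

namespace HyperTree

/-- A permutation of `2 t + 1` points is a product of `t` disjoint transpositions exactly when it
is an involution with a unique fixed point. -/
theorem cycleType_eq_replicate_two_iff {V : Type*} [Fintype V] [DecidableEq V] {t : ℕ}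
    (hV : Fintype.card V = 2 * t + 1) (σ : Equiv.Perm V) :
    σ.cycleType = Multiset.replicate t 2 ↔
      ∃ r, (∀ v, σ (σ v) = v) ∧ ∀ v, σ v = v ↔ v = r := by
  have hsq : σ ^ 2 = 1 ↔ ∀ v, σ (σ v) = v := by
    rw [sq, Equiv.ext_iff]; rfl
  have hcompl := Finset.card_add_card_compl σ.support
  constructor
  · intro h
    have h1 : σ ^ 2 = 1 := Equiv.Perm.pow_prime_eq_one_iff.2 fun c hc =>
      Multiset.eq_of_mem_replicate (h ▸ hc)
    have h2 := σ.sum_cycleType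
    rw [h, Multiset.sum_replicate, smul_eq_mul] at h2
    obtain ⟨r, hr⟩ := Finset.card_eq_one.1 (show σ.supportᶜ.card = 1 by omega)
    refine ⟨r, hsq.1 h1, fun v => ?_⟩
    have h3 : v ∈ σ.supportᶜ ↔ v = r := by rw [hr, Finset.mem_singleton]
    simpa using h3
  · rintro ⟨r, h1, h2⟩
    have h3 := Equiv.Perm.cycleType_of_pow_prime_eq_one (hsq.2 h1)
    have h4 : σ.supportᶜ = {r} := by
      ext v
      simp [h2]
    rw [h4, Finset.card_singleton, ← σ.sum_cycleType, h3, Multiset.sum_replicate, smul_eq_mul] at hcompl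
    rw [h3]
    congr 1
    omega

/-- The conjugacy class has (2t + 1)! / (2^t t!) elements, and 2^t t! = (2t)!!. -/
theorem card_pairings {V : Type*} [Fintype V] [DecidableEq V] {t : ℕ}
    (hV : Fintype.card V = 2 * t + 1) :
    (Finset.univ.filter fun σ : Equiv.Perm V => σ.cycleType = Multiset.replicate t 2).card =
      (2 * t + 1) * Nat.doubleFactorial (2 * t - 1) := by
  have h := Equiv.Perm.card_of_cycleType_mul_eq V (Multiset.replicate t 2)
  have hprod : ∏ n ∈ (Multiset.replicate t 2).toFinset, ((Multiset.replicate t 2).count n).factorial =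
      t.factorial := by
    rcases Nat.eq_zero_or_pos t with rfl | ht
    · simp
    · rw [Multiset.toFinset_replicate, if_neg ht.ne', Finset.prod_singleton,
        Multiset.count_replicate_self]
  rw [hprod, if_pos, Multiset.sum_replicate, Multiset.prod_replicate, hV, smul_eq_mul,
    mul_comm t 2, show 2 * t + 1 - 2 * t = 1 by omega, Nat.factorial_one, one_mul,
    ← Nat.doubleFactorial_two_mul, Nat.factorial_eq_mul_doubleFactorial,
    Nat.doubleFactorial_add_one] at h
  · exact Nat.eq_of_mul_eq_mul_right (Nat.doubleFactorial_pos _) h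
  · refine ⟨by simp [hV]; omega, fun a ha => (Multiset.eq_of_mem_replicate ha).ge⟩

/-- A parent map is constant on pairs, so it is a map from the t pairs to the vertices. Reaching the
root means leaving the pairs, since the root is the only unpaired vertex. The order on `V` only
serves to name each pair by its smaller element. -/
theorem ncard_parents {V : Type*} [Fintype V] [LinearOrder V] {t : ℕ}
    (hV : Fintype.card V = 2 * t + 1) {σ : Equiv.Perm V} {r : V} (hσ : ∀ v, σ (σ v) = v)
    (hr : ∀ v, σ v = v ↔ v = r) :
    Nat.card {p : V → V // IsRooting Set.univ r σ p} * (2 * t + 1) = (2 * t + 1) ^ t := by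
  let B := {v : V // v < σ v}
  let β : V → Option B := fun v => if h : v < σ v then some ⟨v, h⟩ else
    if h : σ v < v then some ⟨σ v, by rwa [hσ]⟩ else none
  have hβlt : ∀ b : B, β b.1 = some b := fun b => dif_pos b.2
  have hβσ : ∀ v, β (σ v) = β v := by
    intro v
    rcases lt_trichotomy v (σ v) with h | h | h
    · simp [β, hσ, h, h.not_gt]
    · rw [← h]
    · simp [β, hσ, h, h.not_gt]
  have hβnone : ∀ v, β v = none ↔ v = r := by
    intro v
    rw [← hr]
    rcases lt_trichotomy v (σ v) with h | h | h
    · simp [β, h, h.ne']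
    · simp [β, ← h]
    · simp [β, h, h.not_gt, h.ne]
  have hβsome : ∀ {v b}, β v = some b → v = b.1 ∨ v = σ b.1 := by
    intro v b h
    by_cases h1 : v < σ v
    · simp only [β, dif_pos h1, Option.some_inj] at h
      exact Or.inl (congrArg Subtype.val h)
    · by_cases h2 : σ v < v
      · simp only [β, dif_neg h1, dif_pos h2, Option.some_inj] at h
        right
        rw [← h, hσ]
      · simp [β, h1, h2] at h
  have hB : Fintype.card B = t := by
    have h1 : (Finset.univ.filter fun v => v < σ v).card =
        (Finset.univ.filter fun v => σ v < v).card :=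
      Finset.card_nbij' σ σ (fun v => by simp [hσ]) (fun v => by simp [hσ])
        (fun v _ => hσ v) (fun v _ => hσ v)
    have h2 : (Finset.univ.filter fun v => ¬ v < σ v) =
        insert r (Finset.univ.filter fun v => σ v < v) := by
      ext v
      simp [← hr, le_iff_eq_or_lt]
    have h3 := Finset.card_filter_add_card_filter_not (s := Finset.univ) (fun v => v < σ v)
    rw [h2, Finset.card_insert_of_notMem (by simp [(hr r).2 rfl]), ← h1, Finset.card_univ, hV] at h3
    rw [Fintype.card_subtype]
    omega
  have hparent : ∀ {p}, IsRooting Set.univ r σ p → ∀ {v b}, β v = some b → p v = p b.1 := by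
    intro p hp v b h
    rcases hβsome h with rfl | rfl
    · rfl
    · exact hp.parent_pair _ trivial
  let e : {p : V → V // IsRooting Set.univ r σ p} ≃ {q : B → V // ∀ v, BlockReach β q v} :=
    { toFun p := ⟨fun b => p.1 b.1, by
        have key : ∀ n v, p.1^[n] v = r → BlockReach β (fun b => p.1 b.1) v := by
          intro n
          induction n with
          | zero => exact fun v h => .base ((hβnone v).2 h)
          | succ n ih =>
            intro v h
            rcases hv : β v with _ | b
            · exact .base hv
            · refine .step hv (ih _ ?_)
              rwa [← hparent p.2 hv]
        intro v
        obtain ⟨n, hn⟩ := p.2.reach v trivial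
        exact key n v hn⟩
      invFun q := ⟨fun v => (β v).elim r q.1,
        { root_mem := trivial
          pair_mem _ _ := trivial
          pair_pair v _ := hσ v
          pair_eq_iff v _ := hr v
          parent_mem _ _ := trivial
          parent_pair v _ := by rw [hβσ]
          parent_root := by rw [(hβnone r).2 rfl]; rfl
          reach v _ := by
            induction q.2 v with
            | base h => exact ⟨0, (hβnone _).1 h⟩
            | step h _ ih =>
              obtain ⟨n, hn⟩ := ih trivial
              refine ⟨n + 1, ?_⟩
              rw [Function.iterate_succ_apply, h]
              exact hn }⟩
      left_inv p := by
        ext v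
        dsimp only
        rcases hv : β v with _ | b
        · rw [(hβnone v).1 hv]
          exact p.2.parent_root.symm
        · exact (hparent p.2 hv).symm
      right_inv q := by
        ext b
        dsimp only
        rw [hβlt]
        rfl }
  have h1 := card_blockReach_mul_card B β
  have h2 : Fintype.card {v // β v = none} = 1 := by
    simp [hβnone]
  rw [h2, one_mul, hB, hV] at h1
  rw [Nat.card_congr e, h1]

/-- The number of hypertrees. -/
theorem ncard_univ {V : Type*} [Finite V] {t : ℕ} (hV : Nat.card V = 2 * t + 1) :
    {T : Set (Set V) | HyperTree Set.univ T}.ncard =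
      Nat.doubleFactorial (2 * t - 1) * (2 * t + 1) ^ (t - 1) := by
  classical
  have := Fintype.ofFinite V
  have : LinearOrder V := LinearOrder.lift' _ (Finite.equivFin V).injective
  rw [Nat.card_eq_fintype_card] at hV
  set H := {T : Set (Set V) | HyperTree Set.univ T}.ncard with hH
  have h1 : ∀ r : V, H = ∑ σ : Equiv.Perm V, Nat.card {p : V → V // IsRooting Set.univ r σ p} := by
    intro r
    rw [hH, ← ncard_eq_ncard_isRooting r, ← Nat.card_coe_set_eq, ← Nat.card_sigma]
    exact Nat.card_congr
      (Equiv.subtypeProdEquivSigmaSubtype fun (σ : Equiv.Perm V) p => IsRooting Set.univ r σ p)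
  -- The number for a fixed root is independent of the root. Summing over all roots lets each σ
  -- supply its own, as its unique fixed point.
  have h2 : (2 * t + 1) * H = ∑ σ : Equiv.Perm V, ∑ r : V,
      Nat.card {p : V → V // IsRooting Set.univ r σ p} := by
    rw [Finset.sum_comm, ← Finset.sum_congr rfl fun r _ => h1 r]
    simp [hV]
  have h3 : ∀ σ : Equiv.Perm V,
      (∑ r : V, Nat.card {p : V → V // IsRooting Set.univ r σ p}) * (2 * t + 1) =
        if σ.cycleType = Multiset.replicate t 2 then (2 * t + 1) ^ t else 0 := by
    intro σ
    split_ifs with h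
    · obtain ⟨r, hσ, hr⟩ := (cycleType_eq_replicate_two_iff hV σ).1 h
      rw [Finset.sum_eq_single r, ncard_parents hV hσ hr]
      · intro r' _ hne
        have : IsEmpty {p : V → V // IsRooting Set.univ r' σ p} :=
          ⟨fun p => hne ((hr r').1 p.2.pair_root)⟩
        exact Nat.card_of_isEmpty
      · simp
    · rw [Finset.sum_eq_zero, zero_mul]
      intro r _
      have : IsEmpty {p : V → V // IsRooting Set.univ r σ p} :=
        ⟨fun p => h ((cycleType_eq_replicate_two_iff hV σ).2
          ⟨r, fun v => p.2.pair_pair v trivial, fun v => p.2.pair_eq_iff v trivial⟩)⟩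
      exact Nat.card_of_isEmpty
  have h4 : (2 * t + 1) * (H * (2 * t + 1)) =
      (2 * t + 1) * (Nat.doubleFactorial (2 * t - 1) * (2 * t + 1) ^ t) := by
    rw [← mul_assoc, h2, Finset.sum_mul, Finset.sum_congr rfl fun σ _ => h3 σ,
      ← Finset.sum_filter, Finset.sum_const, card_pairings hV, smul_eq_mul, mul_assoc]
  have h5 := Nat.eq_of_mul_eq_mul_left (Nat.succ_pos _) h4
  -- At t = 0 the exponent t - 1 is truncated to 0, which is harmless because the base is 1.
  rcases Nat.eq_zero_or_pos t with rfl | ht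
  · simpa using h5
  · refine Nat.eq_of_mul_eq_mul_right (Nat.succ_pos (2 * t)) (h5.trans ?_)
    rw [mul_assoc, ← pow_succ, Nat.sub_add_cancel ht]

end HyperTree

/-! ### Triangular cacti and hypertrees -/

/-- The pairs of distinct elements of a set. -/
def Set.pairs {V : Type*} (t : Set V) : Set (Sym2 V) := {e | ¬ e.IsDiag ∧ ∀ x ∈ e, x ∈ t}

theorem Set.mk_mem_pairs {V : Type*} {t : Set V} {x y : V} :
    s(x, y) ∈ t.pairs ↔ x ≠ y ∧ x ∈ t ∧ y ∈ t := by
  simp [Set.pairs]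

theorem Set.pairs_triple {V : Type*} {a b c : V} (hab : a ≠ b) (hbc : b ≠ c) (hac : a ≠ c) :
    ({a, b, c} : Set V).pairs = {s(a, b), s(b, c), s(a, c)} := by
  ext e
  induction e with
  | _ x y =>
    simp only [Set.mk_mem_pairs, Set.mem_insert_iff, Set.mem_singleton_iff, Sym2.eq_iff]
    grind

theorem Set.ncard_pairs_triple {V : Type*} {a b c : V} (hab : a ≠ b) (hbc : b ≠ c) (hac : a ≠ c) :
    ({a, b, c} : Set V).pairs.ncard = 3 := by
  rw [Set.pairs_triple hab hbc hac, Set.ncard_eq_three]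
  refine ⟨_, _, _, ?_, ?_, ?_, rfl⟩ <;> simp only [ne_eq, Sym2.eq_iff] <;> grind

namespace SimpleGraph

variable {V : Type*} {G : SimpleGraph V}

/-- The graph whose edges are the pairs inside the members of `T`. -/
def ofTriples (T : Set (Set V)) : SimpleGraph V where
  Adj a b := a ≠ b ∧ ∃ t ∈ T, a ∈ t ∧ b ∈ t
  symm := ⟨fun _ _ ⟨h, t, ht, h1, h2⟩ => ⟨h.symm, t, ht, h2, h1⟩⟩
  loopless := ⟨fun _ h => h.1 rfl⟩

/-- The vertex sets of the triangles of a graph. -/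
def triangleSets (G : SimpleGraph V) : Set (Set V) :=
  {t | ∃ a b c, G.Adj a b ∧ G.Adj b c ∧ G.Adj a c ∧ t = {a, b, c}}

theorem isCycleEdgeSet_pairs {t : Set V} (ht : t ∈ G.triangleSets) :
    G.IsCycleEdgeSet t.pairs := by
  obtain ⟨a, b, c, hab, hbc, hac, rfl⟩ := ht
  refine ⟨a, .cons hab (.cons hbc (.cons hac.symm .nil)), ?_, ?_⟩
  · have h1 := hab.ne
    have h2 := hbc.ne
    have h3 := hac.ne
    rw [Walk.cons_isCycle_iff, Walk.isPath_def]
    simp [h1, h1.symm, h2, h3, h3.symm]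
  · rw [Set.pairs_triple hab.ne hbc.ne hac.ne]
    simp [Walk.edgeSet_cons, Sym2.eq_swap (a := c) (b := a)]

theorem exists_of_mem_triangleSets {t : Set V} (ht : t ∈ G.triangleSets) {x : V} (hx : x ∈ t) :
    ∃ y z, G.Adj x y ∧ G.Adj y z ∧ G.Adj x z ∧ t = {x, y, z} := by
  obtain ⟨a, b, c, hab, hbc, hac, rfl⟩ := ht
  rcases hx with rfl | rfl | rfl
  · exact ⟨b, c, hab, hbc, hac, rfl⟩
  · exact ⟨a, c, hab.symm, hac, hbc, Set.insert_comm _ _ _⟩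
  · exact ⟨a, b, hac.symm, hab, hbc.symm, by rw [Set.pair_comm, Set.insert_comm a]⟩

theorem adj_of_mem_triangleSets {t : Set V} (ht : t ∈ G.triangleSets) {x y : V} (hx : x ∈ t)
    (hy : y ∈ t) (hne : x ≠ y) : G.Adj x y := by
  obtain ⟨a, b, h1, h2, h3, rfl⟩ := exists_of_mem_triangleSets ht hx
  rcases hy with rfl | rfl | rfl
  exacts [absurd rfl hne, h1, h3]

namespace Walk

/-- A vertex on a cycle has exactly two neighbours along it, so if there are only two candidates
both are used. -/
theorem IsCycle.mem_edges_of_adj {v : V} {w : G.Walk v v} (hw : w.IsCycle) {x a b : V}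
    (hx : x ∈ w.support) (h : ∀ y, s(x, y) ∈ w.edges → y = a ∨ y = b) :
    s(x, a) ∈ w.edges ∧ s(x, b) ∈ w.edges := by
  have h1 := hw.ncard_neighborSet_toSubgraph_eq_two hx
  have h2 : w.toSubgraph.neighborSet x = {a, b} := by
    refine Set.eq_of_subset_of_ncard_le ?_ ?_ (Set.toFinite _)
    · exact fun y hy => h y (adj_toSubgraph_iff_mem_edges.1 hy)
    · rw [h1]
      exact (Set.ncard_insert_le _ _).trans (by rw [Set.ncard_singleton])
  have ha : a ∈ w.toSubgraph.neighborSet x := by simp [h2]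
  have hb : b ∈ w.toSubgraph.neighborSet x := by simp [h2]
  exact ⟨adj_toSubgraph_iff_mem_edges.1 ha, adj_toSubgraph_iff_mem_edges.1 hb⟩

theorem IsCycle.eq_or_eq_of_mem_edges {v : V} {w : G.Walk v v} (hw : w.IsCycle) {x a b y : V}
    (ha : s(x, a) ∈ w.edges) (hb : s(x, b) ∈ w.edges) (hab : a ≠ b) (hy : s(x, y) ∈ w.edges) :
    y = a ∨ y = b := by
  have h1 := hw.ncard_neighborSet_toSubgraph_eq_two (w.fst_mem_support_of_mem_edges ha)
  have h2 : ({a, b} : Set V) = w.toSubgraph.neighborSet x := by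
    refine Set.eq_of_subset_of_ncard_le ?_ ?_ w.finite_neighborSet_toSubgraph
    · rintro z (rfl | rfl)
      exacts [adj_toSubgraph_iff_mem_edges.2 ha, adj_toSubgraph_iff_mem_edges.2 hb]
    · rw [h1, Set.ncard_pair hab]
  have h3 : y ∈ w.toSubgraph.neighborSet x := adj_toSubgraph_iff_mem_edges.2 hy
  rwa [← h2] at h3

theorem mem_iff_of_mem_support {u v : V} (w : G.Walk u v) {S : Set V}
    (h : ∀ x y, s(x, y) ∈ w.edges → (x ∈ S ↔ y ∈ S)) : ∀ z ∈ w.support, (z ∈ S ↔ u ∈ S) := by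
  induction w with
  | nil => simp
  | @cons a b c hab p ih =>
    intro z hz
    rw [support_cons, List.mem_cons] at hz
    rcases hz with rfl | hz
    · rfl
    · rw [ih (fun x y hxy => h x y (by simp [hxy])) z hz, h a b (by simp)]

end Walk

end SimpleGraph

open SimpleGraph

namespace HyperTree

variable {V : Type*} {E : Set V} {T : Set (Set V)}

theorem reachable (h : HyperTree E T) : ∀ u ∈ E, ∀ v ∈ E, (ofTriples T).Reachable u v := by
  induction h with
  | single v =>
    rintro u rfl v rfl
    rfl
  | @step E T e f g h hf he hg hne ih =>
    have hmono : ofTriples T ≤ ofTriples (insert {e, f, g} T) :=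
      fun a b ⟨hab, t, ht, h1⟩ => ⟨hab, t, Or.inr ht, h1⟩
    have key : ∀ u ∈ insert e (insert g E),
        (ofTriples (insert {e, f, g} T)).Reachable u f := by
      rintro u (rfl | rfl | hu)
      · exact Adj.reachable ⟨fun h => he (h ▸ hf), _, Or.inl rfl, by simp, by simp⟩
      · exact Adj.reachable ⟨fun h => hg (h ▸ hf), _, Or.inl rfl, by simp, by simp⟩
      · exact (ih u hu f hf).mono hmono
    exact fun u hu v hv => (key u hu).trans (key v hv).symm

theorem eq_triple (h : HyperTree E T) :
    ∀ t ∈ T, ∃ a b c, a ≠ b ∧ b ≠ c ∧ a ≠ c ∧ t = {a, b, c} := by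
  induction h with
  | single v => simp
  | @step E T e f g h hf he hg hne ih =>
    rintro t (rfl | ht)
    · exact ⟨e, f, g, fun h => he (h ▸ hf), fun h => hg (h ▸ hf), hne, rfl⟩
    · exact ih t ht

theorem mem_triangleSets (h : HyperTree E T) {t : Set V} (ht : t ∈ T) :
    t ∈ (ofTriples T).triangleSets := by
  obtain ⟨a, b, c, hab, hbc, hac, rfl⟩ := h.eq_triple t ht
  exact ⟨a, b, c, ⟨hab, _, ht, by simp, by simp⟩, ⟨hbc, _, ht, by simp, by simp⟩,
    ⟨hac, _, ht, by simp, by simp⟩, rfl⟩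

/-- A newly attached triple meets the earlier ones in `f` alone. -/
theorem eq_of_mem_of_mem (h : HyperTree E T) : ∀ t ∈ T, ∀ t' ∈ T, ∀ a b, a ≠ b → a ∈ t → b ∈ t →
    a ∈ t' → b ∈ t' → t = t' := by
  induction h with
  | single v => simp
  | @step E T e f g h hf he hg hne ih =>
    have key : ∀ t ∈ T, ∀ a ∈ t, a ∈ ({e, f, g} : Set V) → a = f := by
      rintro t ht a hat (rfl | rfl | rfl)
      · exact absurd (h.subset t ht hat) he
      · rfl
      · exact absurd (h.subset t ht hat) hg
    rintro t (rfl | ht) t' (rfl | ht') a b hab hat hbt hat' hbt'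
    · rfl
    · exact absurd ((key t' ht' a hat' hat).trans (key t' ht' b hbt' hbt).symm) hab
    · exact absurd ((key t ht a hat hat').trans (key t ht b hbt hbt').symm) hab
    · exact ih t ht t' ht' a b hab hat hbt hat' hbt'

/-- The new vertices `e` and `g` have no neighbours outside their triple. A cycle through one of
them must use both of its edges there, and so is the new triangle; any other cycle lives in the old
graph. -/
theorem isCycleEdgeSet (h : HyperTree E T) :
    ∀ C, (ofTriples T).IsCycleEdgeSet C → ∃ t ∈ T, C = t.pairs := by
  induction h with
  | single v =>
    rintro _ ⟨u, w, hw, rfl⟩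
    cases w with
    | nil => exact absurd rfl hw.ne_nil
    | cons hab _ => exact absurd hab.2 (by simp)
  | @step E T e f g h hf he hg hne ih =>
    rintro _ ⟨u, w, hw, rfl⟩
    have hef : e ≠ f := fun h => he (h ▸ hf)
    have hgf : g ≠ f := fun h => hg (h ▸ hf)
    have hadj : ∀ {x y}, s(x, y) ∈ w.edges → (ofTriples (insert {e, f, g} T)).Adj x y :=
      fun h => w.adj_of_mem_edges h
    have hnbr : ∀ {x}, x ∉ E → ∀ {y}, (ofTriples (insert {e, f, g} T)).Adj x y →
        y ∈ ({e, f, g} : Set V) := by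
      rintro x hx y ⟨-, t, rfl | ht, h1, h2⟩
      · exact h2
      · exact absurd (h.subset t ht h1) hx
    have he' : ∀ y, s(e, y) ∈ w.edges → y = f ∨ y = g := by
      intro y hy
      exact (hnbr he (hadj hy)).resolve_left (hadj hy).ne'
    have hg' : ∀ y, s(g, y) ∈ w.edges → y = e ∨ y = f := by
      intro y hy
      rcases hnbr hg (hadj hy) with h | h | h
      exacts [Or.inl h, Or.inr h, absurd h (hadj hy).ne']
    by_cases hsupp : e ∈ w.support ∨ g ∈ w.support
    · have hes : e ∈ w.support := by
        rcases hsupp with hs | hs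
        · exact hs
        · exact w.snd_mem_support_of_mem_edges (hw.mem_edges_of_adj hs hg').1
      obtain ⟨h1, h2⟩ := hw.mem_edges_of_adj hes he'
      obtain ⟨-, h3⟩ := hw.mem_edges_of_adj (w.snd_mem_support_of_mem_edges h2) hg'
      -- The cycle already passes from `f` to `e` and to `g`, which uses up both of its edges at
      -- `f`, so it cannot leave the triple.
      have hf' : ∀ y, s(f, y) ∈ w.edges → y = e ∨ y = g := fun y hy =>
        hw.eq_or_eq_of_mem_edges (by rwa [Sym2.eq_swap]) (by rwa [Sym2.eq_swap]) hne hy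
      have hclosed : ∀ x y, s(x, y) ∈ w.edges → x ∈ ({e, f, g} : Set V) →
          y ∈ ({e, f, g} : Set V) := by
        rintro x y hxy (rfl | rfl | rfl)
        · rcases he' y hxy with rfl | rfl <;> simp
        · rcases hf' y hxy with rfl | rfl <;> simp
        · rcases hg' y hxy with rfl | rfl <;> simp
      have hS := w.mem_iff_of_mem_support (S := {e, f, g}) fun x y hxy =>
        ⟨hclosed x y hxy, hclosed y x (by rwa [Sym2.eq_swap])⟩
      have hu := (hS e hes).1 (by simp)
      refine ⟨_, Or.inl rfl, ?_⟩
      rw [Set.pairs_triple hef hgf.symm hne]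
      ext z
      induction z with
      | _ x y =>
        constructor
        · intro hxy
          rw [← Set.pairs_triple hef hgf.symm hne, Set.mk_mem_pairs]
          exact ⟨(hadj hxy).ne, (hS x (w.fst_mem_support_of_mem_edges hxy)).2 hu,
            (hS y (w.snd_mem_support_of_mem_edges hxy)).2 hu⟩
        · rintro (h4 | h4 | h4) <;> rw [h4]
          exacts [h1, by rwa [Sym2.eq_swap], h2]
    · push Not at hsupp
      have htr : ∀ z ∈ w.edges, z ∈ (ofTriples T).edgeSet := by
        intro z hz
        induction z with
        | _ x y =>
          have key : ∀ x ∈ w.support, x ∈ ({e, f, g} : Set V) → x = f := by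
            rintro x hx (rfl | rfl | rfl)
            exacts [absurd hx hsupp.1, rfl, absurd hx hsupp.2]
          obtain ⟨hxy, t, rfl | ht, h1, h2⟩ := hadj hz
          · exact absurd ((key x (w.fst_mem_support_of_mem_edges hz) h1).trans
              (key y (w.snd_mem_support_of_mem_edges hz) h2).symm) hxy
          · exact ⟨hxy, t, ht, h1, h2⟩
      obtain ⟨t, ht, h1⟩ := ih w.edgeSet ⟨u, w.transfer _ htr, hw.transfer htr, by simp⟩
      exact ⟨t, Or.inr ht, h1⟩

theorem isTriangularCactus (h : HyperTree Set.univ T) : (ofTriples T).IsTriangularCactus := by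
  refine ⟨{ preconnected := fun u v => h.reachable u trivial v trivial
            nonempty := ⟨h.nonempty.some⟩ }, fun e he => ?_⟩
  induction e with
  | _ a b =>
    obtain ⟨hab, t, ht, ha, hb⟩ := he
    refine ⟨t.pairs, ⟨isCycleEdgeSet_pairs (h.mem_triangleSets ht),
      Set.mk_mem_pairs.2 ⟨hab, ha, hb⟩⟩, ?_, ?_⟩
    · obtain ⟨x, y, z, hxy, hyz, hxz, rfl⟩ := h.eq_triple t ht
      exact Set.ncard_pairs_triple hxy hyz hxz
    · intro C hC habC
      obtain ⟨t', ht', rfl⟩ := h.isCycleEdgeSet C hC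
      obtain ⟨-, ha', hb'⟩ := Set.mk_mem_pairs.1 habC
      rw [h.eq_of_mem_of_mem t ht t' ht' a b hab ha hb ha' hb']

theorem triangleSets_ofTriples (h : HyperTree E T) : (ofTriples T).triangleSets = T := by
  refine Set.Subset.antisymm (fun t ht => ?_) fun t ht => h.mem_triangleSets ht
  obtain ⟨t', ht', heq⟩ := h.isCycleEdgeSet _ (isCycleEdgeSet_pairs ht)
  obtain ⟨a, b, c, hab, hbc, hac, rfl⟩ := ht
  obtain ⟨x, y, z, -, -, -, rfl⟩ := h.eq_triple t' ht'
  have h1 : s(a, b) ∈ ({x, y, z} : Set V).pairs := by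
    rw [← heq]; exact Set.mk_mem_pairs.2 ⟨hab.ne, by simp, by simp⟩
  have h2 : s(b, c) ∈ ({x, y, z} : Set V).pairs := by
    rw [← heq]; exact Set.mk_mem_pairs.2 ⟨hbc.ne, by simp, by simp⟩
  have h3 : ({a, b, c} : Set V) = {x, y, z} := by
    refine Set.eq_of_subset_of_ncard_le ?_ ?_ (Set.toFinite _)
    · rintro w (rfl | rfl | rfl)
      exacts [(Set.mk_mem_pairs.1 h1).2.1, (Set.mk_mem_pairs.1 h1).2.2, (Set.mk_mem_pairs.1 h2).2.2]
    · rw [Set.ncard_eq_three.2 ⟨a, b, c, hab.ne, hac.ne, hbc.ne, rfl⟩]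
      refine (Set.ncard_insert_le _ _).trans (Nat.succ_le_succ ?_)
      exact (Set.ncard_insert_le _ _).trans (by rw [Set.ncard_singleton])
  rwa [h3]

end HyperTree

namespace SimpleGraph

variable {V : Type*} {G : SimpleGraph V}

namespace IsTriangularCactus

/-- Both `C` and the triangle are cycles through the same edge. -/
theorem eq_pairs (hG : G.IsTriangularCactus) {C : Set (Sym2 V)} (hC : G.IsCycleEdgeSet C)
    {t : Set V} (ht : t ∈ G.triangleSets) {x y : V} (hx : x ∈ t) (hy : y ∈ t) (hxy : x ≠ y)
    (hmem : s(x, y) ∈ C) : C = t.pairs := by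
  obtain ⟨D, -, -, hD⟩ := hG.2 s(x, y) (adj_of_mem_triangleSets ht hx hy hxy)
  rw [hD C hC hmem, hD _ (isCycleEdgeSet_pairs ht) (Set.mk_mem_pairs.2 ⟨hxy, hx, hy⟩)]

theorem exists_adj_adj (hG : G.IsTriangularCactus) {a b : V} (hab : G.Adj a b) :
    ∃ c, G.Adj a c ∧ G.Adj b c := by
  obtain ⟨_, ⟨⟨v, w, hw, rfl⟩, habw⟩, hcard, -⟩ := hG.2 s(a, b) hab
  have hlen : w.length = 3 := by
    classical
    rw [← Walk.length_edges, ← hcard, ← Walk.coe_edges_toFinset, Set.ncard_coe_finset,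
      List.toFinset_card_of_nodup hw.edges_nodup]
  cases w with
  | nil => simp at hlen
  | @cons _ x _ h1 p =>
    cases p with
    | nil => simp at hlen
    | @cons _ y _ h2 q =>
      cases q with
      | nil => simp at hlen
      | @cons _ z _ h3 r =>
        cases r with
        | cons _ _ => simp at hlen
        | nil =>
          rw [Walk.mem_edgeSet] at habw
          simp only [Walk.edges_cons, Walk.edges_nil, List.mem_cons, List.not_mem_nil, or_false,
            Sym2.eq_iff] at habw
          rcases habw with (⟨rfl, rfl⟩ | ⟨rfl, rfl⟩) | (⟨rfl, rfl⟩ | ⟨rfl, rfl⟩) |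
            (⟨rfl, rfl⟩ | ⟨rfl, rfl⟩)
          exacts [⟨_, h3.symm, h2⟩, ⟨_, h2, h3.symm⟩, ⟨_, h1.symm, h3⟩, ⟨_, h3, h1.symm⟩,
            ⟨_, h2.symm, h1⟩, ⟨_, h1, h2.symm⟩]

theorem ofTriples_triangleSets (hG : G.IsTriangularCactus) : ofTriples G.triangleSets = G := by
  ext a b
  constructor
  · rintro ⟨hab, t, ht, ha, hb⟩
    exact adj_of_mem_triangleSets ht ha hb hab
  · intro hab
    obtain ⟨c, hac, hbc⟩ := hG.exists_adj_adj hab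
    exact ⟨hab.ne, {a, b, c}, ⟨a, b, c, hab, hbc, hac, rfl⟩, by simp, by simp⟩

/-- A vertex outside a sub-hypertree of a triangular cactus has at most one neighbour in it. -/
theorem eq_of_adj_of_adj (hG : G.IsTriangularCactus) {E : Set V} {T : Set (Set V)}
    (hE : HyperTree E T) (hT : T ⊆ G.triangleSets) {e x y : V} (he : e ∉ E) (hx : x ∈ E)
    (hy : y ∈ E) (hex : G.Adj e x) (hey : G.Adj e y) : x = y := by
  by_contra hxy
  obtain ⟨p, hp⟩ := (hE.reachable x hx y hy).exists_isPath
  have hle : ofTriples T ≤ G := fun a b ⟨hab, t, ht, ha, hb⟩ =>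
    adj_of_mem_triangleSets (hT ht) ha hb hab
  have hsupp : ∀ z ∈ p.support, z ∈ E := by
    refine fun z hz => (p.mem_iff_of_mem_support (S := E) ?_ z hz).2 hx
    intro a b hab
    obtain ⟨-, t, ht, h1, h2⟩ := p.adj_of_mem_edges hab
    exact iff_of_true (hE.subset t ht h1) (hE.subset t ht h2)
  have hep : e ∉ p.support := fun h => he (hsupp e h)
  have hcyc : (Walk.cons hex ((p.mapLe hle).concat hey.symm)).IsCycle := by
    rw [Walk.cons_isCycle_iff]
    refine ⟨(hp.mapLe hle).concat (by rwa [Walk.support_mapLe_eq_support]) _, ?_⟩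
    rw [Walk.edges_concat, Walk.edges_mapLe_eq_edges, List.concat_eq_append, List.mem_append,
      List.mem_singleton]
    rintro (h | h)
    · exact hep (p.fst_mem_support_of_mem_edges h)
    · rcases Sym2.eq_iff.1 h with ⟨h1, -⟩ | ⟨-, h1⟩
      · exact hey.ne h1
      · exact hxy h1
  -- The first edge of the path lies in a triple inside `E`, whose triangle must be the whole cycle;
  -- but the cycle passes through `e`, outside `E`.
  cases p with
  | nil => exact hxy rfl
  | @cons _ z _ hxz q =>
    have hxz' := hxz
    obtain ⟨hne, t, ht, h1, h2⟩ := hxz'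
    have heq := hG.eq_pairs ⟨e, _, hcyc, rfl⟩ (hT ht) h1 h2 hne (by simp [Walk.mem_edgeSet])
    have hmem : s(e, x) ∈ t.pairs := by
      rw [← heq]
      simp [Walk.mem_edgeSet]
    exact he (hE.subset t ht (Set.mk_mem_pairs.1 hmem).2.1)

/-- Take a maximal vertex set `E` whose inner triangles form a tree of triples. If it is not
everything, connectedness gives an edge leaving it. The triangle on that edge has both other
vertices outside `E`, and no further triangle appears when it is attached. -/
theorem hyperTree [Finite V] (hG : G.IsTriangularCactus) : HyperTree Set.univ G.triangleSets := by
  let S : Set (Set V) := {E | HyperTree E {t | t ∈ G.triangleSets ∧ t ⊆ E}}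
  obtain ⟨r⟩ := hG.1.nonempty
  have hS : ({r} : Set V) ∈ S := by
    have : {t | t ∈ G.triangleSets ∧ t ⊆ {r}} = ∅ := by
      rw [Set.eq_empty_iff_forall_notMem]
      rintro t ⟨⟨a, b, c, hab, -, -, rfl⟩, ht⟩
      have h1 : a = r := ht (by simp)
      have h2 : b = r := ht (by simp)
      exact hab.ne (h1.trans h2.symm)
    change HyperTree _ _
    rw [this]
    exact .single r
  obtain ⟨E, hmax⟩ := (Set.toFinite S).exists_maximal ⟨_, hS⟩
  have hE : HyperTree E {t | t ∈ G.triangleSets ∧ t ⊆ E} := hmax.1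
  have hTE : {t | t ∈ G.triangleSets ∧ t ⊆ E} ⊆ G.triangleSets := fun _ h => h.1
  suffices hEu : E = Set.univ by
    rw [hEu] at hE
    simpa using hE
  by_contra hEu
  obtain ⟨v, hv⟩ := (Set.ne_univ_iff_exists_notMem E).1 hEu
  obtain ⟨u, hu⟩ := hE.nonempty
  obtain ⟨w⟩ := hG.1.preconnected u v
  obtain ⟨⟨⟨f, e⟩, hfe⟩, -, hf, he⟩ := w.exists_boundary_dart E hu hv
  dsimp only at hf he hfe
  obtain ⟨g, hfg, heg⟩ := hG.exists_adj_adj hfe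
  -- Otherwise `e` would have the two distinct neighbours `f` and `g` in `E`.
  have hg : g ∉ E := fun hg => hfg.ne (hG.eq_of_adj_of_adj hE hTE he hf hg hfe.symm heg)
  have hnbr_e : ∀ y ∈ insert e (insert g E), G.Adj e y → y = f ∨ y = g := by
    rintro y (rfl | rfl | hy) hadj
    · exact absurd rfl hadj.ne
    · exact Or.inr rfl
    · exact Or.inl (hG.eq_of_adj_of_adj hE hTE he hy hf hadj hfe.symm)
  have hnbr_g : ∀ y ∈ insert e (insert g E), G.Adj g y → y = f ∨ y = e := by
    rintro y (rfl | rfl | hy) hadj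
    · exact Or.inr rfl
    · exact absurd rfl hadj.ne
    · exact Or.inl (hG.eq_of_adj_of_adj hE hTE hg hy hf hadj hfg.symm)
  have hmem : insert e (insert g E) ∈ S := by
    have hset : {t | t ∈ G.triangleSets ∧ t ⊆ insert e (insert g E)} =
        insert {e, f, g} {t | t ∈ G.triangleSets ∧ t ⊆ E} := by
      ext t
      constructor
      · rintro ⟨ht, hsub⟩
        have key : ∀ {x y : V}, x ∈ t → (∀ z ∈ insert e (insert g E), G.Adj x z → z = f ∨ z = y) →
            t = {x, f, y} := by
          intro x y hx hnbr
          obtain ⟨a, b, h1, h2, h3, rfl⟩ := exists_of_mem_triangleSets ht hx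
          have ha := hnbr a (hsub (by simp)) h1
          have hb := hnbr b (hsub (by simp)) h3
          have hab := h2.ne
          rcases ha with rfl | rfl <;> rcases hb with rfl | rfl
          · exact absurd rfl hab
          · rfl
          · rw [Set.pair_comm]
          · exact absurd rfl hab
        by_cases het : e ∈ t
        · exact Or.inl (key het hnbr_e)
        · by_cases hgt : g ∈ t
          · left
            rw [key hgt hnbr_g, Set.pair_comm, Set.insert_comm, Set.pair_comm]
          · right
            refine ⟨ht, fun z hz => ?_⟩
            rcases hsub hz with rfl | rfl | h
            exacts [absurd hz het, absurd hz hgt, h]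
      · rintro (rfl | ⟨ht, hsub⟩)
        · refine ⟨⟨e, f, g, hfe.symm, hfg, heg, rfl⟩, ?_⟩
          rintro z (rfl | rfl | rfl) <;> simp [hf]
        · exact ⟨ht, fun z hz => by simp [hsub hz]⟩
    change HyperTree _ _
    rw [hset]
    exact hE.step hf he hg heg.ne
  exact he (hmax.2 hmem (fun z hz => by simp [hz]) (Set.mem_insert _ _))

end IsTriangularCactus

theorem ncard_isTriangularCactus {V : Type*} [Finite V] :
    {G : SimpleGraph V | G.IsTriangularCactus}.ncard =
      {T : Set (Set V) | HyperTree Set.univ T}.ncard := by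
  refine Set.BijOn.ncard_eq (f := triangleSets)
    ⟨fun G hG => hG.hyperTree, fun G hG G' hG' h => ?_, fun T hT => ?_⟩
  · rw [← IsTriangularCactus.ofTriples_triangleSets hG, h,
      IsTriangularCactus.ofTriples_triangleSets hG']
  · exact ⟨ofTriples T, HyperTree.isTriangularCactus hT, HyperTree.triangleSets_ofTriples hT⟩

end SimpleGraph

/-! ### The leading coefficient and the final count. -/

/-- The natural-number expression `(2k-3)‼ * (2k-1)^(k-2)` gives the intended value also at
`k = 1`, where `(-1)‼ = 1` and `1^(-1) = 1`. -/
theorem mainTheorem3 (k : ℕ) (hk : 1 ≤ k) :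
    (Matroid.simpleQuasiSeriesParallel (2 * k - 1) k).ncard =
        Nat.doubleFactorial (2 * k - 3) * (2 * k - 1) ^ (k - 2) ∧
    (braidMatroid (2 * k)).klPolynomial.natDegree = k - 1 ∧
    (braidMatroid (2 * k)).klPolynomial.leadingCoeff =
        ((Matroid.simpleQuasiSeriesParallel (2 * k - 1) k).ncard : ℤ) ∧
    (braidMatroid (2 * k)).klPolynomial.leadingCoeff =
        (({G : SimpleGraph (Fin (2 * k - 1)) | G.IsTriangularCactus}).ncard : ℤ) := by
  obtain ⟨t, rfl⟩ : ∃ t, k = t + 1 := ⟨k - 1, by omega⟩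
  have hcard : Nat.card (Fin (2 * (t + 1) - 1)) = 2 * (t + 1) - 1 := Nat.card_fin _
  have h1 : (Matroid.simpleQuasiSeriesParallel (2 * (t + 1) - 1) (t + 1)).ncard =
      {T : Set (Set (Fin (2 * (t + 1) - 1))) | HyperTree Set.univ T}.ncard := by
    rw [← Matroid.ncard_spReducible_eq_ncard_hyperTree hk hcard]
    simp only [Matroid.simpleQuasiSeriesParallel, Matroid.isQuasiSeriesParallel_iff]
  have h2 := HyperTree.ncard_univ (V := Fin (2 * (t + 1) - 1)) (t := t) (by rw [hcard]; omega)
  have hpos : (Matroid.simpleQuasiSeriesParallel (2 * (t + 1) - 1) (t + 1)).ncard ≠ 0 := by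
    rw [h1, h2]
    exact (Nat.mul_pos (Nat.doubleFactorial_pos _) (pow_pos (Nat.succ_pos _) _)).ne'
  -- With n = 2t + 1 and k = t + 1, the exponent t = k - 1 corresponds to rank n - t = k. For larger
  -- exponents twice the rank is at most n, so the coefficient vanishes.
  have hcoeff := coeff_klPolynomial_braidMatroid (2 * t + 1)
  have hlead : (braidMatroid (2 * (t + 1))).klPolynomial.coeff t =
      ((Matroid.simpleQuasiSeriesParallel (2 * (t + 1) - 1) (t + 1)).ncard : ℤ) := by
    have h3 := hcoeff t
    rw [if_pos (by omega)] at h3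
    rw [show 2 * (t + 1) - 1 = 2 * t + 1 by omega]
    rwa [show 2 * t + 1 - t = t + 1 by omega] at h3
  have hdeg : (braidMatroid (2 * (t + 1))).klPolynomial.natDegree = t := by
    refine Polynomial.natDegree_eq_of_le_of_coeff_ne_zero ?_ ?_
    · rw [Polynomial.natDegree_le_iff_coeff_eq_zero]
      intro i hi
      refine (hcoeff i).trans ?_
      split_ifs with h
      · rw [Matroid.ncard_simpleQuasiSeriesParallel_eq_zero (by omega) (by omega), Nat.cast_zero]
      · rfl
    · rw [hlead]
      exact_mod_cast hpos
  have hlc : (braidMatroid (2 * (t + 1))).klPolynomial.leadingCoeff =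
      ((Matroid.simpleQuasiSeriesParallel (2 * (t + 1) - 1) (t + 1)).ncard : ℤ) := by
    rw [Polynomial.leadingCoeff, hdeg, hlead]
  refine ⟨?_, by rw [hdeg]; rfl, hlc, ?_⟩
  · rw [h1, h2]
    congr 2
  · rw [hlc, h1, SimpleGraph.ncard_isTriangularCactus]
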